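/- Setting. A learner chooses one of $k\ge 2$ actions in each of $T$ rounds and observes a reward drawn, independently of the past, from the distribution $\mathcal D_i$ of the chosen action $i$. The unknown $\mathcal D_1,\dots,\mathcal D_k$ are sub-Gaussian with variance proxy $1$ around their means $\mu_i$, and $|\mu_i-\mu_j|\le 1$ for all $i,j$. A policy $\pi$ is a sequence of probability kernels from the past actions and observed rewards to the next action $\pi_t$. A switching graph $G$ on $[k]$ has symmetric costs $c_{i,j}=c_{j,i}\in[0,\infty]$ with $c_{i,i}=0$ that satisfy the triangle inequality; we assume that not all costs are $0$. For $S\in[0,\infty)$ let $\Pi_S$ be the set of policies such that $\sum_{t=1}^{T-1}c_{\pi_t,\pi_{t+1}}\le S$ almost surely under every $\mathcal D$, and let $$R_S^*(T)=\inf_{\pi\in\Pi_S}\sup_{\mathcal D}\Big\{T\max_i\mu_i-\mathbb E^\pi_{\mathcal D}\Big[\sum_{t=1}^T\mu_{\pi_t}\Big]\Big\}.$$ Let $H$ be the total weight of a shortest Hamiltonian path of $G$ and put $$m_G^U(S)=\Big\lfloor\frac{S-\max_{i,j}c_{i,j}}{H}\Big\rfloor,\qquad m_G^L(S)=\Big\lfloor\frac{S-\max_i\min_{j\ne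 i}c_{i,j}}{H}\Big\rfloor,$$ where $\lfloor x\rfloor=0$ for $x<0$, and both indices are $0$ if $H=\infty$. Theorem. For every fixed $k\ge 2$ there are constants $c,C>0$, $a\in\mathbb N$ and $T_0\ge 2$, depending only on $k$, such that every switching graph $G$ on $[k]$ with not all costs zero determines an integer-valued function $S\mapsto m_G(S)$, independent of $T$, with $m_G(S)\in\{m_G^U(S),m_G^L(S)\}$ and $R_S^*(T)=\tilde\Theta\big(T^{1/(2-2^{-m_G(S)})}\big)$, that is, $$c\,(\log T)^{-a}\,T^{\frac1{2-2^{-m_G(S)}}}\le R_S^*(T)\le C\,(\log T)^{a}\,T^{\frac1{2-2^{-m_G(S)}}}\qquad\text{for all }S\ge 0,\ T\ge T_0.$$ Moreover, let $S_j=\inf\{S\ge0: m_G(S)\ge j\}$ for $j\ge 0$ (so $S_0=0$, and $\inf\emptyset=\infty$); $S_j$ with $j\ge 1$ is called the $j$-th critical point. Then for every $j\ge 0$ and every $S\in[S_j,S_{j+1})$ one has $m_G(S)=j$ and $R_S^*(T)=\tilde\Theta\big(T^{1/(2-2^{-j})}\big)$ (with the same constants), and if $H<\infty$ then $0=S_0<S_1<S_2<\cdots<\infty$.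 Hence for $H<\infty$ and every $j\ge1$ the order of $T$ in $R_S^*(T)$ drops at $S_j$ from $\tilde\Theta\big(T^{1/(2-2^{1-j})}\big)$ to $\tilde\Theta\big(T^{1/(2-2^{-j})}\big)$. -/

import Mathlib

open MeasureTheory ProbabilityTheory
open scoped ENNReal NNReal

namespace BwSC

/-! ### Switching graphs -/

/-- Total weight of a sequence of vertices `p 0, …, p (n - 1)`, namely
`∑ c (p t) (p (t + 1))` over consecutive pairs. -/
noncomputable def pathCost {k n : ℕ} (c : Fin k → Fin k → ℝ≥0∞) (p : Fin n → Fin k) : ℝ≥0∞ :=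
  ∑ t : Fin (n - 1), c (p ⟨t, by omega⟩) (p ⟨t + 1, by omega⟩)

/-- A switching graph: the complete graph on the `k` actions, whose edges carry symmetric switching
costs in `[0, ∞]` satisfying the triangle inequality. -/
structure SwitchingGraph (k : ℕ) where
  cost : Fin k → Fin k → ℝ≥0∞
  cost_self : ∀ i, cost i i = 0
  cost_symm : ∀ i j, cost i j = cost j i
  cost_triangle : ∀ i j l, cost i j ≤ cost i l + cost l j

namespace SwitchingGraph

variable {k : ℕ} (G : SwitchingGraph k)

/-- `H`: the total weight of a shortest Hamiltonian path. -/
noncomputable def hamiltonianWeight : ℝ≥0∞ :=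
  ⨅ σ : Equiv.Perm (Fin k), pathCost G.cost σ

/-- `max_{i,j} c_{i,j}`. -/
noncomputable def maxCost : ℝ≥0∞ := ⨆ i, ⨆ j, G.cost i j

/-- `max_i min_{j ≠ i} c_{i,j}`. -/
noncomputable def maxMinCost : ℝ≥0∞ := ⨆ i, ⨅ j, ⨅ _ : j ≠ i, G.cost i j

/-- `m_G^U(S) = ⌊(S - max_{i,j} c_{i,j}) / H⌋`, where the floor of a negative number is `0`
(the subtraction of `ℝ≥0∞` is truncated at `0`, and `x / ∞ = 0`). -/
noncomputable def mU (S : ℝ≥0) : ℕ := ⌊((S - G.maxCost) / G.hamiltonianWeight).toReal⌋₊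

/-- `m_G^L(S) = ⌊(S - max_i min_{j ≠ i} c_{i,j}) / H⌋`, with the same convention. -/
noncomputable def mL (S : ℝ≥0) : ℕ := ⌊((S - G.maxMinCost) / G.hamiltonianWeight).toReal⌋₊

end SwitchingGraph

/-! ### Environments, policies and the law of the interaction -/

/-- An environment: a reward distribution for each action, each of which is sub-Gaussian with
variance proxy `1` around its mean, with means at distance at most `1` from each other. -/
structure Environment (k : ℕ) where
  law : Fin k → Measure ℝ
  isProb : ∀ i, IsProbabilityMeasure (law i)
  subG : ∀ i, HasSubgaussianMGF (fun x => x - ∫ y, y ∂(law i)) 1 (law i)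
  gap_le : ∀ i j, |(∫ y, y ∂(law i)) - ∫ y, y ∂(law j)| ≤ 1

namespace Environment

variable {k : ℕ} (D : Environment k)

/-- Mean reward of an action. -/
noncomputable def mean (i : Fin k) : ℝ := ∫ y, y ∂(D.law i)

/-- Largest mean reward. -/
noncomputable def bestMean : ℝ := ⨆ i, D.mean i

/-- The reward distributions as a kernel from actions to rewards. -/
noncomputable def rewardKernel : Kernel (Fin k) ℝ := Kernel.ofFunOfCountable D.law

instance : IsMarkovKernel D.rewardKernel := ⟨D.isProb⟩

end Environment

/-- The action chosen and the reward observed in each of the first `t` rounds. -/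
abbrev History (k t : ℕ) : Type := Fin t → Fin k × ℝ

/-- A non-anticipating, possibly randomized policy: for each `t`, a probability kernel from the
history of the first `t` rounds to the action of the next round. For a horizon `T` only the kernels
with index `t < T` matter. -/
structure Policy (k : ℕ) where
  act : ∀ t : ℕ, Kernel (History k t) (Fin k)
  isMarkov : ∀ t, IsMarkovKernel (act t)

namespace Policy

variable {k : ℕ} (π : Policy k) (D : Environment k)

instance (t : ℕ) : IsMarkovKernel (π.act t) := π.isMarkov t

/-- One round of interaction: the policy chooses an action given the history, then a reward is drawn
from the distribution of that action, independently of the past. -/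
noncomputable def step (t : ℕ) : Kernel (History k t) (Fin k × ℝ) :=
  (π.act t) ⊗ₖ (Kernel.prodMkLeft (History k t) D.rewardKernel)

instance (t : ℕ) : IsMarkovKernel (π.step D t) := by
  unfold step; infer_instance

/-- Append one round to a history. -/
def snocHistory (k t : ℕ) (p : History k t × (Fin k × ℝ)) : History k (t + 1) :=
  Fin.snoc (α := fun _ => Fin k × ℝ) p.1 p.2

theorem measurable_snocHistory (k t : ℕ) : Measurable (snocHistory k t) := by
  refine measurable_pi_lambda _ fun i => ?_
  refine Fin.lastCases ?_ (fun j => ?_) i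
  · simpa [snocHistory] using measurable_snd
  · simp only [snocHistory, Fin.snoc_castSucc]
    exact (measurable_pi_apply j).comp measurable_fst

/-- The law of the history of the first `t` rounds under policy `π` in environment `D`. -/
noncomputable def histLaw : ∀ t : ℕ, Measure (History k t)
  | 0 => Measure.dirac Fin.elim0
  | t + 1 => ((histLaw t) ⊗ₘ (π.step D t)).map (snocHistory k t)

instance (t : ℕ) : IsProbabilityMeasure (π.histLaw D t) := by
  induction t with
  | zero => unfold histLaw; infer_instance
  | succ t ih =>
    unfold histLaw
    exact Measure.isProbabilityMeasure_map (measurable_snocHistory k t).aemeasurable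

/-- `π` is an `S`-switching-budget policy over `T` rounds: in every environment, the total switching
cost `∑_{t=1}^{T-1} c_{π_t, π_{t+1}}` is at most `S` almost surely. -/
def IsBudgeted (G : SwitchingGraph k) (S : ℝ≥0) (T : ℕ) : Prop :=
  ∀ D : Environment k, ∀ᵐ h ∂(π.histLaw D T), pathCost G.cost (fun t => (h t).1) ≤ S

/-- Regret in a given environment: `T μ* - E[∑_t μ_{π_t}]`. -/
noncomputable def regretIn (T : ℕ) : ℝ :=
  T * D.bestMean - ∫ h, ∑ t : Fin T, D.mean (h t).1 ∂(π.histLaw D T)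

/-- Worst-case regret `R^π(T)`. -/
noncomputable def regret (T : ℕ) : EReal := ⨆ D : Environment k, ((π.regretIn D T : ℝ) : EReal)

end Policy

/-- Minimax regret `R_S^*(T)`: the infimum of the worst-case regret over all `S`-switching-budget
policies. -/
noncomputable def optRegret {k : ℕ} (G : SwitchingGraph k) (S : ℝ≥0) (T : ℕ) : EReal :=
  ⨅ π : Policy k, ⨅ _ : π.IsBudgeted G S T, π.regret T

/-! ### Rates and critical points -/

/-- The rate `T ^ (1 / (2 - 2 ^ (-m)))`. -/
noncomputable def rate (m T : ℕ) : ℝ := (T : ℝ) ^ (1 / (2 - (2 : ℝ) ^ (-(m : ℤ))))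

/-- `R(T)` equals `rate m T` up to the constant factors `c`, `C` and the logarithmic factor
`(log T) ^ a`, for all `T ≥ T₀`. -/
def IsThetaTildeRate (c C : ℝ) (a T₀ : ℕ) (R : ℕ → EReal) (m : ℕ) : Prop :=
  ∀ T : ℕ, T₀ ≤ T →
    ((c * rate m T / Real.log T ^ a : ℝ) : EReal) ≤ R T ∧
      R T ≤ ((C * rate m T * Real.log T ^ a : ℝ) : EReal)

/-- The `j`-th critical point `inf {S | m S ≥ j}` of an index function `m`
(`∞` if there is no such `S`). -/
noncomputable def criticalPoint (m : ℝ≥0 → ℕ) (j : ℕ) : ℝ≥0∞ :=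
  ⨅ S : ℝ≥0, ⨅ _ : j ≤ m S, (S : ℝ≥0∞)

end BwSC

/-! The index is decided by an elimination game on `G`. In every stage the player visits all
surviving arms; after each visit the adversary declares that the arm ties with the current leaders,
beats them all, or is beaten. The leaders survive into the next stage, and after the last stage the
player must still move to a survivor. `threshold m` is the least switching budget that suffices for
`m` stages against every adversary, and `stages S` is the largest `m` with `threshold m ≤ S`. This
is `m_G(S)`, and the critical points are the thresholds.

Combinatorics. Constant ties force a Hamiltonian path in each stage. In the last stage the adversary
can also force the player to enter or leave any prescribed arm `z` at the end. Hence `m * H +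
maxMinCost ≤ threshold m` for `m ≥ 1` (`le_threshold`). Sweeping back and forth along a shortest
Hamiltonian path gives `threshold m ≤ m * H + maxCost` (`threshold_le`). Since `maxCost ≤ H`, the
two floors differ by at most one, so `stages S` is one of them (`stages_eq_or`).

Upper bound. Let `a_0 = 0`, `a_{m+1} = 1` and `a_{j+1} - a_j / 2 = 1 / (2 - 2^{-m})`. The policy
follows an optimal play with visits of about `T^{a_j}` rounds in the `j`-th stage and answers read
off the empirical means. Up to logarithms, the survivors of that stage are within `T^{-a_j/2}` of
the best arm, so every visit of the next stage costs at most the rate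
(`regretIn_eliminationPolicy_le`).

Lower bound. Let `S < threshold (m + 1)`. The `j`-th milestone of an arm is roughly its `T^{a_j}`-th
play. By the triangle inequality the order in which milestones are reached is a walk that is no more
expensive than the actions themselves. The adversary plays optimally against this walk: when an arm
reaches its milestone, its Gaussian mean is moved by about `T^{-a_j/2}` according to the answer. The
arm has been played too rarely for this to be noticed, so a likely continuation loses at most a
factor `6 * k` in probability. The whole game does not fit into the budget, so at some point a
leader or a beaten arm reaches a further milestone prematurely, at a regret of about `T^{a_{j+1}} *
T^{-a_j/2}`, which is the rate (`ChainNode.exists_le_regretIn`).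

Uniformity in `m`. After about `log log T` stages the rate is `√T` up to a factor `2`. The player
ignores further stages, and the lower bound then comes from a two-arm argument
(`exists_le_regretIn_of_two_le`). -/

namespace BwSC

/-! ### The elimination game: optimal moves and answers. -/

namespace SwitchingGraph

variable {k : ℕ} (G : SwitchingGraph k)

/-- The possible sets of leading arms after the arm `i` is compared with the set `C` of leading
arms: `i` ties with them, beats them all, or is beaten. -/
def IsAnswer (C : Finset (Fin k)) (i : Fin k) (C' : Finset (Fin k)) : Prop :=
  C' = insert i C ∨ C' = {i} ∨ (C' = C ∧ C.Nonempty)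

theorem IsAnswer.nonempty {C C' : Finset (Fin k)} {i : Fin k} (h : IsAnswer C i C') :
    C'.Nonempty := by
  rcases h with rfl | rfl | ⟨rfl, h⟩
  · exact Finset.insert_nonempty _ _
  · exact Finset.singleton_nonempty _
  · exact h

theorem IsAnswer.subset {C C' : Finset (Fin k)} {i : Fin k} (h : IsAnswer C i C') :
    C' ⊆ insert i C := by
  rcases h with rfl | rfl | ⟨rfl, -⟩
  · exact subset_rfl
  · simp
  · exact Finset.subset_insert _ _

/-- The elimination game: in each of `q` stages the player visits all surviving arms. `B` is the set
of the surviving arms not yet compared in the current stage, among them the current arm `i`, and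
`C` is the set of the arms that lead in the current stage. The game ends with the first visit after
the last stage. Its value is the switching cost that the player has yet to pay. -/
noncomputable def gameValue : ℕ → Finset (Fin k) → Finset (Fin k) → Fin k → ℝ≥0∞
  | 0, _, _, _ => 0
  | q + 1, B, C, i =>
    if h : i ∈ B then
      ⨆ C', ⨆ (_ : IsAnswer C i C'),
        if B.erase i = ∅ then ⨅ j ∈ C', G.cost i j + gameValue q C' ∅ j
        else ⨅ j ∈ B.erase i, G.cost i j + gameValue (q + 1) (B.erase i) C' j
    else 0
  termination_by q B => (q, B.card)
  decreasing_by
    · exact Prod.Lex.left _ _ (Nat.lt_succ_self q)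
    · exact Prod.Lex.right _ (Finset.card_erase_lt_of_mem h)

/-- The number of remaining stages, counting the current one, after the arm `i` is compared. -/
def nextStage (q : ℕ) (B : Finset (Fin k)) (i : Fin k) : ℕ := if B.erase i = ∅ then q else q + 1

/-- The arms that are to be visited in the current stage after the arm `i` is compared. -/
def nextToVisit (B C' : Finset (Fin k)) (i : Fin k) : Finset (Fin k) :=
  if B.erase i = ∅ then C' else B.erase i

/-- The leading arms of the current stage after the arm `i` is compared. -/
def nextLeaders (B C' : Finset (Fin k)) (i : Fin k) : Finset (Fin k) :=
  if B.erase i = ∅ then ∅ else C'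

theorem nextToVisit_nonempty {B C C' : Finset (Fin k)} {i : Fin k} (h : IsAnswer C i C') :
    (nextToVisit B C' i).Nonempty := by
  unfold nextToVisit
  split_ifs with hB
  · exact h.nonempty
  · exact Finset.nonempty_iff_ne_empty.2 hB

@[simp] theorem gameValue_zero (B C : Finset (Fin k)) (i : Fin k) : G.gameValue 0 B C i = 0 := by
  rw [gameValue]

/-- The end of a stage and a move within a stage become one formula, so that later arguments can
treat both alike until they have to split. -/
theorem gameValue_succ (q : ℕ) {B : Finset (Fin k)} (C : Finset (Fin k)) {i : Fin k} (h : i ∈ B) :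
    G.gameValue (q + 1) B C i = ⨆ C', ⨆ (_ : IsAnswer C i C'), ⨅ j ∈ nextToVisit B C' i,
      (G.cost i j + G.gameValue (nextStage q B i) (nextToVisit B C' i) (nextLeaders B C' i) j) := by
  rw [gameValue, dif_pos h]
  congr! 5 with C' hC'
  unfold nextToVisit nextLeaders nextStage
  split_ifs <;> rfl

/-- An optimal move of the player. -/
theorem exists_move {q : ℕ} {B C C' : Finset (Fin k)} {i : Fin k} (h : i ∈ B)
    (hC : IsAnswer C i C') :
    ∃ j ∈ nextToVisit B C' i, G.cost i j +
      G.gameValue (nextStage q B i) (nextToVisit B C' i) (nextLeaders B C' i) j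
        ≤ G.gameValue (q + 1) B C i := by
  obtain ⟨j, hj, hmin⟩ := Finset.exists_min_image (nextToVisit B C' i) (fun j => G.cost i j +
    G.gameValue (nextStage q B i) (nextToVisit B C' i) (nextLeaders B C' i) j)
    (nextToVisit_nonempty hC)
  refine ⟨j, hj, ?_⟩
  rw [gameValue_succ G q C h]
  exact (le_iInf₂ hmin).trans (le_iSup₂_of_le C' hC le_rfl)

/-- An optimal answer of the adversary. -/
theorem exists_answer {q : ℕ} {B C : Finset (Fin k)} {i : Fin k} (h : i ∈ B) {a : ℝ≥0∞} {S : ℝ≥0}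
    (hS : S < a + G.gameValue (q + 1) B C i) :
    ∃ C', IsAnswer C i C' ∧ ∀ j ∈ nextToVisit B C' i, S < a + G.cost i j +
      G.gameValue (nextStage q B i) (nextToVisit B C' i) (nextLeaders B C' i) j := by
  by_contra! hcon
  refine hS.not_ge ?_
  have ha : a ≤ S := by
    obtain ⟨j, -, hj⟩ := hcon {i} (Or.inr (Or.inl rfl))
    exact le_trans (by rw [add_assoc]; exact le_self_add) hj
  have : G.gameValue (q + 1) B C i ≤ S - a := by
    rw [gameValue_succ G q C h]
    refine iSup₂_le fun C' hC' => ?_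
    obtain ⟨j, hj, hle⟩ := hcon C' hC'
    refine (iInf₂_le j hj).trans ?_
    refine ENNReal.le_sub_of_add_le_left (ne_top_of_le_ne_top ENNReal.coe_ne_top ha) ?_
    rwa [← add_assoc]
  calc _ ≤ a + (S - a) := by gcongr
    _ = S := add_tsub_cancel_of_le ha

/-- Lower bounds on the value: one answer of the adversary suffices, checked against all moves. -/
theorem le_add_gameValue_succ {q : ℕ} {B C : Finset (Fin k)} {i : Fin k} (h : i ∈ B)
    {C' : Finset (Fin k)} (hC : IsAnswer C i C') {a b : ℝ≥0∞}
    (ha : ∀ j ∈ nextToVisit B C' i, b ≤ a + (G.cost i j +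
      G.gameValue (nextStage q B i) (nextToVisit B C' i) (nextLeaders B C' i) j)) :
    b ≤ a + G.gameValue (q + 1) B C i := by
  rw [← tsub_le_iff_left, gameValue_succ G q C h]
  exact le_iSup₂_of_le C' hC (le_iInf₂ fun j hj => tsub_le_iff_left.2 (ha j hj))

/-- Upper bounds on the value: one move for each answer suffices. The summand `p` carries the
potential of the sweeping argument; its finiteness allows subtraction in `ℝ≥0∞`. -/
theorem gameValue_succ_add_le {q : ℕ} {B C : Finset (Fin k)} {i : Fin k} (h : i ∈ B)
    {p a : ℝ≥0∞} (hp : p ≠ ∞)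
    (ha : ∀ C', IsAnswer C i C' → ∃ j ∈ nextToVisit B C' i, (G.cost i j +
      G.gameValue (nextStage q B i) (nextToVisit B C' i) (nextLeaders B C' i) j) + p ≤ a) :
    G.gameValue (q + 1) B C i + p ≤ a := by
  have hpa : p ≤ a := by
    obtain ⟨j, -, hj⟩ := ha {i} (Or.inr (Or.inl rfl))
    exact le_add_self.trans hj
  have : G.gameValue (q + 1) B C i ≤ a - p := by
    rw [gameValue_succ G q C h]
    refine iSup₂_le fun C' hC' => ?_
    obtain ⟨j, hj, hle⟩ := ha C' hC'
    exact (iInf₂_le j hj).trans (ENNReal.le_sub_of_add_le_right hp hle)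
  calc _ ≤ a - p + p := by gcongr
    _ = a := tsub_add_cancel_of_le hpa

/-! ### Upper and lower bounds for the thresholds. -/

/-- The budget that is needed for `m` stages of the elimination game. -/
noncomputable def threshold (m : ℕ) : ℝ≥0∞ := ⨅ i, G.gameValue m Finset.univ ∅ i

theorem threshold_zero [NeZero k] : G.threshold 0 = 0 := by
  simp [threshold]

/-- Total weight of a sequence of vertices, given as a list. -/
noncomputable def walkCost : List (Fin k) → ℝ≥0∞
  | [] => 0
  | [_] => 0
  -- The list runs backwards in time, newest vertex first, so the step goes from `b` to `a`.
  | a :: b :: l => G.cost b a + walkCost (b :: l)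

@[simp] theorem walkCost_nil : G.walkCost [] = 0 := rfl
@[simp] theorem walkCost_singleton (a : Fin k) : G.walkCost [a] = 0 := rfl
@[simp] theorem walkCost_cons_cons (a b : Fin k) (l : List (Fin k)) :
    G.walkCost (a :: b :: l) = G.cost b a + G.walkCost (b :: l) := rfl

theorem walkCost_eq_sum (l : List (Fin k)) {n : ℕ} (hn : l.length = n) :
    G.walkCost l = ∑ t : Fin (n - 1), G.cost (l.get ⟨(t : ℕ) + 1, by omega⟩)
      (l.get ⟨(t : ℕ), by omega⟩) := by
  subst hn
  induction l with
  | nil => simp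
  | cons a l ih =>
    cases l with
    | nil => simp
    | cons b l =>
      rw [walkCost_cons_cons, ih]
      exact (Fin.sum_univ_succ (n := l.length) (fun t => G.cost ((a :: b :: l).get
        ⟨(t : ℕ) + 1, Nat.succ_lt_succ t.2⟩) ((a :: b :: l).get
        ⟨(t : ℕ), Nat.lt_succ_of_lt t.2⟩))).symm

theorem hamiltonianWeight_le_walkCost {l : List (Fin k)} (hl : l.Nodup)
    (hmem : ∀ i, i ∈ l) : G.hamiltonianWeight ≤ G.walkCost l := by
  have hlen : l.length = k := by
    have h := List.toFinset_card_of_nodup hl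
    rw [← h, (Finset.eq_univ_iff_forall.2 fun i => List.mem_toFinset.2 (hmem i)),
      Finset.card_univ, Fintype.card_fin]
  let f : Fin k → Fin k := fun t => l.get (Fin.cast hlen.symm t)
  have hf : Function.Injective f := fun a b hab =>
    (Fin.cast_injective _) (List.nodup_iff_injective_get.1 hl hab)
  let σ : Equiv.Perm (Fin k) := Equiv.ofBijective f (Finite.injective_iff_bijective.1 hf)
  refine (iInf_le (fun σ : Equiv.Perm (Fin k) => pathCost G.cost σ) σ).trans (le_of_eq ?_)
  rw [walkCost_eq_sum G l hlen, pathCost]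
  refine Finset.sum_congr rfl fun t _ => ?_
  rw [G.cost_symm]
  rfl

/-- Used at the end of a stage: `i` is the only arm left and `l` lists all the others, so `i :: l`
is a Hamiltonian path. -/
theorem hamiltonianWeight_le_walkCost_cons {B : Finset (Fin k)} {i : Fin k} {l : List (Fin k)}
    (hi : i ∈ B) (hB : B.erase i = ∅) (hl : l.Nodup) (hmem : ∀ j, j ∈ l ↔ j ∉ B) :
    G.hamiltonianWeight ≤ G.walkCost (i :: l) := by
  refine G.hamiltonianWeight_le_walkCost
    (List.nodup_cons.2 ⟨fun h => (hmem i).1 h hi, hl⟩) fun j => ?_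
  rcases eq_or_ne j i with rfl | hj
  · simp
  · refine List.mem_cons_of_mem _ ((hmem j).2 fun hjB => ?_)
    exact Finset.notMem_empty j (hB ▸ Finset.mem_erase.2 ⟨hj, hjB⟩)

theorem mem_cons_iff_notMem_erase {B : Finset (Fin k)} {i : Fin k} {l : List (Fin k)}
    (hmem : ∀ j, j ∈ l ↔ j ∉ B) (j : Fin k) : j ∈ i :: l ↔ j ∉ B.erase i := by
  rw [List.mem_cons, hmem, Finset.mem_erase]
  tauto

/-- The adversary declares ties in the current stage. -/
theorem le_walkCost_add_gameValue_of_ties (q n : ℕ) {B : Finset (Fin k)} {i : Fin k}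
    {l : List (Fin k)} (hcard : B.card = n) (hi : i ∈ B) (hl : l.Nodup)
    (hmem : ∀ j, j ∈ l ↔ j ∉ B) :
    G.hamiltonianWeight + G.threshold q ≤
      G.walkCost (i :: l) + G.gameValue (q + 1) B Bᶜ i := by
  induction n generalizing B i l with
  | zero => simp_all
  | succ n ih =>
    have hil : i ∉ l := fun h => (hmem i).1 h hi
    -- The leaders are always all arms visited so far, so a tie adds `i` to `Bᶜ`.
    refine G.le_add_gameValue_succ hi (C' := (B.erase i)ᶜ)
      (Or.inl (Finset.compl_erase)) fun j hj => ?_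
    by_cases hB : B.erase i = ∅
    · simp only [nextToVisit, nextStage, nextLeaders, hB, if_true, Finset.compl_empty] at hj ⊢
      exact add_le_add (G.hamiltonianWeight_le_walkCost_cons hi hB hl hmem)
        ((iInf_le _ j).trans le_add_self)
    · simp only [nextToVisit, nextStage, nextLeaders, hB, if_false] at hj ⊢
      have := ih (B := B.erase i) (i := j) (l := i :: l)
        (by rw [Finset.card_erase_of_mem hi, hcard]; rfl) hj (List.nodup_cons.2 ⟨hil, hl⟩)
        (mem_cons_iff_notMem_erase hmem)
      rw [walkCost_cons_cons] at this
      calc _ ≤ _ := this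
        _ = _ := by ring

/-- With ties throughout the first stage the player walks a Hamiltonian path and then faces the game
with `q` stages and all arms alive. -/
theorem hamiltonianWeight_add_threshold_le (q : ℕ) :
    G.hamiltonianWeight + G.threshold q ≤ G.threshold (q + 1) := by
  refine le_iInf fun i => ?_
  simpa using G.le_walkCost_add_gameValue_of_ties q _ rfl (Finset.mem_univ i) List.nodup_nil
    (by simp)

/-- The arm `z` leads, and the adversary declares all other arms beaten. -/
theorem le_walkCost_add_gameValue_of_leader (z : Fin k) (n : ℕ) {B : Finset (Fin k)} {i : Fin k}
    {l : List (Fin k)} (hcard : B.card = n) (hi : i ∈ B) (hz : z ∉ B) (hl : l.Nodup)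
    (hmem : ∀ j, j ∈ l ↔ j ∉ B) :
    G.hamiltonianWeight + (⨅ j, ⨅ _ : j ≠ z, G.cost z j) ≤
      G.walkCost (i :: l) + G.gameValue 1 B {z} i := by
  induction n generalizing B i l with
  | zero => simp_all
  | succ n ih =>
    have hil : i ∉ l := fun h => (hmem i).1 h hi
    refine G.le_add_gameValue_succ (q := 0) hi (C' := {z})
      (Or.inr (Or.inr ⟨rfl, Finset.singleton_nonempty _⟩)) fun j hj => ?_
    by_cases hB : B.erase i = ∅
    · simp only [nextToVisit, nextStage, nextLeaders, hB, if_true, Finset.mem_singleton] at hj ⊢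
      subst hj
      refine add_le_add (G.hamiltonianWeight_le_walkCost_cons hi hB hl hmem) ?_
      -- The final move enters `z` from another arm; symmetry turns this into an edge that leaves
      -- `z`.
      rw [gameValue_zero, add_zero, G.cost_symm]
      exact iInf₂_le i (show i ≠ j from ne_of_mem_of_not_mem hi hz)
    · simp only [nextToVisit, nextStage, nextLeaders, hB, if_false] at hj ⊢
      have := ih (B := B.erase i) (i := j) (l := i :: l)
        (by rw [Finset.card_erase_of_mem hi, hcard]; rfl) hj
        (fun h => hz (Finset.mem_of_mem_erase h)) (List.nodup_cons.2 ⟨hil, hl⟩)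
        (mem_cons_iff_notMem_erase hmem)
      rw [walkCost_cons_cons] at this
      calc _ ≤ _ := this
        _ = _ := by ring

/-- The adversary declares ties until the arm `z` is visited; then `z` is declared the leader unless
it is the last arm, in which case it is declared beaten. -/
theorem le_walkCost_add_gameValue_of_target (z : Fin k) (n : ℕ) {B : Finset (Fin k)} {i : Fin k}
    {l : List (Fin k)} (hcard : B.card = n) (hi : i ∈ B) (hz : z ∈ B) (hl : l.Nodup)
    (hmem : ∀ j, j ∈ l ↔ j ∉ B) (hne : Bᶜ.Nonempty ∨ B.erase i ≠ ∅) :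
    G.hamiltonianWeight + (⨅ j, ⨅ _ : j ≠ z, G.cost z j) ≤
      G.walkCost (i :: l) + G.gameValue 1 B Bᶜ i := by
  induction n generalizing B i l with
  | zero => simp_all
  | succ n ih =>
    have hil : i ∉ l := fun h => (hmem i).1 h hi
    rcases eq_or_ne i z with rfl | hiz
    · by_cases hB : B.erase i = ∅
      -- To be beaten requires an existing leader. Since no arm is left besides `i`, `hne` provides
      -- an earlier visited one.
      · refine G.le_add_gameValue_succ (q := 0) hi (C' := Bᶜ)
          (Or.inr (Or.inr ⟨rfl, hne.resolve_right fun h => h hB⟩)) fun j hj => ?_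
        simp only [nextToVisit, nextStage, nextLeaders, hB, if_true, Finset.mem_compl] at hj ⊢
        refine add_le_add (G.hamiltonianWeight_le_walkCost_cons hi hB hl hmem) ?_
        rw [gameValue_zero, add_zero]
        exact iInf₂_le j (ne_of_mem_of_not_mem hi hj).symm
      · refine G.le_add_gameValue_succ (q := 0) hi (C' := {i}) (Or.inr (Or.inl rfl)) fun j hj => ?_
        simp only [nextToVisit, nextStage, nextLeaders, hB, if_false] at hj ⊢
        have := G.le_walkCost_add_gameValue_of_leader i _ rfl hj (Finset.notMem_erase i B)
          (List.nodup_cons.2 ⟨hil, hl⟩) (mem_cons_iff_notMem_erase hmem)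
        rw [walkCost_cons_cons] at this
        calc _ ≤ _ := this
          _ = _ := by ring
    · have hzB : z ∈ B.erase i := Finset.mem_erase.2 ⟨hiz.symm, hz⟩
      have hB : B.erase i ≠ ∅ := Finset.ne_empty_of_mem hzB
      refine G.le_add_gameValue_succ (q := 0) hi (C' := (B.erase i)ᶜ)
        (Or.inl (Finset.compl_erase)) fun j hj => ?_
      simp only [nextToVisit, nextStage, nextLeaders, hB, if_false] at hj ⊢
      have := ih (B := B.erase i) (i := j) (l := i :: l)
        (by rw [Finset.card_erase_of_mem hi, hcard]; rfl) hj hzB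
        (List.nodup_cons.2 ⟨hil, hl⟩) (mem_cons_iff_notMem_erase hmem)
        (Or.inl ⟨i, by simp⟩)
      rw [walkCost_cons_cons] at this
      calc _ ≤ _ := this
        _ = _ := by ring

theorem hamiltonianWeight_add_maxMinCost_le (hk : 2 ≤ k) :
    G.hamiltonianWeight + G.maxMinCost ≤ G.threshold 1 := by
  have : Nonempty (Fin k) := ⟨⟨0, by omega⟩⟩
  refine le_iInf fun i => ?_
  rw [maxMinCost, ENNReal.add_iSup]
  refine iSup_le fun z => ?_
  have hne : (Finset.univ : Finset (Fin k)).erase i ≠ ∅ := by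
    rw [← Finset.card_pos.trans Finset.nonempty_iff_ne_empty,
      Finset.card_erase_of_mem (Finset.mem_univ i), Finset.card_univ, Fintype.card_fin]
    omega
  simpa using G.le_walkCost_add_gameValue_of_target z _ rfl (Finset.mem_univ i)
    (Finset.mem_univ z) List.nodup_nil (by simp) (Or.inr hne)

/-- The forced extra move at `z` is played in the last stage only; every stage put in front of it
costs another `H` by ties. -/
theorem le_threshold (hk : 2 ≤ k) {m : ℕ} (hm : 1 ≤ m) :
    m * G.hamiltonianWeight + G.maxMinCost ≤ G.threshold m := by
  induction m, hm using Nat.le_induction with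
  | base => simpa using G.hamiltonianWeight_add_maxMinCost_le hk
  | succ m _ ih =>
    calc ((m + 1 : ℕ) : ℝ≥0∞) * G.hamiltonianWeight + G.maxMinCost
        = G.hamiltonianWeight + (m * G.hamiltonianWeight + G.maxMinCost) := by push_cast; ring
      _ ≤ G.hamiltonianWeight + G.threshold m := by gcongr
      _ ≤ _ := G.hamiltonianWeight_add_threshold_le m

/-- The player sweeps along a line back and forth. -/
theorem gameValue_add_le_of_line {H M : ℝ≥0∞} (hH : H ≠ ∞) (hM : ∀ i j, G.cost i j ≤ M) (q n : ℕ)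
    {P P' : Fin k → ℝ≥0∞} {x : Fin k → ℤ} (hP : ∀ i, P i + P' i = H)
    (hc : ∀ i j, x i ≤ x j → G.cost i j + P i ≤ P j)
    (hc' : ∀ i j, x i ≤ x j → G.cost i j + P' j ≤ P' i)
    {B C : Finset (Fin k)} {i : Fin k} (hcard : B.card = n) (hi : i ∈ B)
    (hB : ∀ j ∈ B, x i ≤ x j) (hC : ∀ j ∈ C, x j ≤ x i) :
    G.gameValue (q + 1) B C i + P i ≤ (q + 1) * H + M := by
  induction q generalizing n P P' x B C i with
  | zero =>
    induction n generalizing B C i with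
    | zero => simp_all
    | succ n ih =>
      have hPi : P i ≤ H := (hP i) ▸ le_self_add
      refine G.gameValue_succ_add_le hi (ne_top_of_le_ne_top hH hPi) fun C' hC' => ?_
      have hCi : ∀ j ∈ C', x j ≤ x i := fun j hj => by
        rcases Finset.mem_insert.1 (hC'.subset hj) with rfl | h
        exacts [le_rfl, hC j h]
      by_cases hBi : B.erase i = ∅
      · simp only [nextToVisit, nextStage, nextLeaders, hBi, if_true]
        obtain ⟨j, hj⟩ := hC'.nonempty
        refine ⟨j, hj, ?_⟩
        rw [gameValue_zero, add_zero, add_comm]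
        simpa using add_le_add hPi (hM i j)
      · simp only [nextToVisit, nextStage, nextLeaders, hBi, if_false]
        obtain ⟨j, hj, hmin⟩ := Finset.exists_min_image (B.erase i) x
          (Finset.nonempty_iff_ne_empty.2 hBi)
        have hij := hB j (Finset.mem_of_mem_erase hj)
        refine ⟨j, hj, ?_⟩
        calc _ = G.gameValue 1 (B.erase i) C' j + (G.cost i j + P i) := by ring
          _ ≤ G.gameValue 1 (B.erase i) C' j + P j := by gcongr; exact hc i j hij
          _ ≤ _ := ih (by rw [Finset.card_erase_of_mem hi, hcard]; rfl) hj hmin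
            fun j' hj' => (hCi j' hj').trans hij
  | succ q ihq =>
    induction n generalizing B C i with
    | zero => simp_all
    | succ n ih =>
      have hPi : P i ≤ H := (hP i) ▸ le_self_add
      refine G.gameValue_succ_add_le hi (ne_top_of_le_ne_top hH hPi) fun C' hC' => ?_
      have hCi : ∀ j ∈ C', x j ≤ x i := fun j hj => by
        rcases Finset.mem_insert.1 (hC'.subset hj) with rfl | h
        exacts [le_rfl, hC j h]
      by_cases hBi : B.erase i = ∅
      · simp only [nextToVisit, nextStage, nextLeaders, hBi, if_true]
        -- The sweep has ended at the right. The next stage starts at the rightmost survivor, so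
        -- that all others lie to its left.
        obtain ⟨j, hj, hmax⟩ := Finset.exists_max_image C' x hC'.nonempty
        refine ⟨j, hj, ?_⟩
        have h1 : G.gameValue (q + 1) C' ∅ j + P' j ≤ (q + 1) * H + M :=
          -- Reflection of the line: the next sweep runs in the opposite direction, and the two
          -- potentials exchange their roles.
          ihq _ (P := P') (P' := P) (x := fun i => -x i) (fun i => by rw [add_comm, hP])
            (fun i j h => by rw [G.cost_symm]; exact hc' j i (neg_le_neg_iff.1 h))
            (fun i j h => by rw [G.cost_symm]; exact hc j i (neg_le_neg_iff.1 h)) rfl hj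
            (fun j' hj' => neg_le_neg (hmax j' hj')) (by simp)
        calc _ = G.gameValue (q + 1) C' ∅ j + G.cost i j + P i := by ring
          _ ≤ G.gameValue (q + 1) C' ∅ j + P' j + H := by
            gcongr
            rw [G.cost_symm]
            exact le_self_add.trans (hc' j i (hCi j hj))
          _ ≤ (q + 1) * H + M + H := by gcongr
          _ = _ := by push_cast; ring
      · simp only [nextToVisit, nextStage, nextLeaders, hBi, if_false]
        obtain ⟨j, hj, hmin⟩ := Finset.exists_min_image (B.erase i) x
          (Finset.nonempty_iff_ne_empty.2 hBi)
        have hij := hB j (Finset.mem_of_mem_erase hj)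
        refine ⟨j, hj, ?_⟩
        calc _ = G.gameValue (q + 1 + 1) (B.erase i) C' j + (G.cost i j + P i) := by ring
          _ ≤ G.gameValue (q + 1 + 1) (B.erase i) C' j + P j := by gcongr; exact hc i j hij
          _ ≤ _ := ih (by rw [Finset.card_erase_of_mem hi, hcard]; rfl) hj hmin
            fun j' hj' => (hCi j' hj').trans hij

theorem cost_le_maxCost (i j : Fin k) : G.cost i j ≤ G.maxCost :=
  le_iSup₂_of_le i j le_rfl

/-- Shortcuts along a path are no dearer than the path, by the triangle inequality. -/
theorem cost_le_sum_path (p : ℕ → Fin k) {a b : ℕ} (hab : a ≤ b) :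
    G.cost (p a) (p b) ≤ ∑ t ∈ Finset.Ico a b, G.cost (p t) (p (t + 1)) := by
  induction b, hab using Nat.le_induction with
  | base => simp [G.cost_self]
  | succ b hb ih =>
    rw [Finset.sum_Ico_succ_top hb]
    exact (G.cost_triangle _ _ (p b)).trans (add_le_add_left ih _)

theorem pathCost_eq_sum_range {n : ℕ} (p : Fin n → Fin k) (p' : ℕ → Fin k)
    (h : ∀ t : Fin n, p' t = p t) :
    pathCost G.cost p = ∑ t ∈ Finset.range (n - 1), G.cost (p' t) (p' (t + 1)) := by
  rw [pathCost, ← Fin.sum_univ_eq_sum_range (fun t => G.cost (p' t) (p' (t + 1)))]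
  refine Finset.sum_congr rfl fun t _ => ?_
  rw [← h, ← h]

/-- The line is a shortest Hamiltonian path: the coordinate of an arm is its position, `P` is the
weight of the path before it and `P'` the weight after it. The play starts at the first arm of the
path. -/
theorem threshold_le [NeZero k] (m : ℕ) :
    G.threshold m ≤ m * G.hamiltonianWeight + G.maxCost := by
  obtain _ | q := m
  · simp [threshold_zero]
  by_cases hH : G.hamiltonianWeight = ∞
  · simp [hH, ENNReal.mul_top]
  obtain ⟨σ, hσ⟩ : ∃ σ : Equiv.Perm (Fin k), pathCost G.cost σ = G.hamiltonianWeight :=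
    exists_eq_ciInf_of_finite
  let p : ℕ → Fin k := fun t => if ht : t < k then σ ⟨t, ht⟩ else 0
  have hp : ∀ t : Fin k, p t = σ t := fun t => by simp [p]
  have hpi : ∀ i, p (σ.symm i) = i := fun i => by rw [hp, σ.apply_symm_apply]
  have hsum := G.pathCost_eq_sum_range σ p hp
  rw [hσ] at hsum
  have hle : ∀ i, ((σ.symm i : Fin k) : ℕ) ≤ k - 1 := fun i => by omega
  obtain ⟨i, -, hi⟩ := Finset.exists_min_image Finset.univ
    (fun i => (((σ.symm i : Fin k) : ℕ) : ℤ)) Finset.univ_nonempty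
  refine (iInf_le _ i).trans (le_self_add.trans (G.gameValue_add_le_of_line hH G.cost_le_maxCost q _
    (P := fun i => ∑ t ∈ Finset.Ico 0 (σ.symm i : ℕ), G.cost (p t) (p (t + 1)))
    (P' := fun i => ∑ t ∈ Finset.Ico (σ.symm i : ℕ) (k - 1), G.cost (p t) (p (t + 1)))
    (x := fun i => ((σ.symm i : Fin k) : ℕ)) ?_ ?_ ?_ rfl (Finset.mem_univ i) hi (by simp))) |>.trans
    (by push_cast; rfl)
  · intro i
    rw [hsum, Finset.range_eq_Ico]
    exact Finset.sum_Ico_consecutive _ (Nat.zero_le _) (hle i)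
  · intro i j hij
    have hij' : (σ.symm i : ℕ) ≤ (σ.symm j : ℕ) := by exact_mod_cast hij
    rw [add_comm, ← Finset.sum_Ico_consecutive _ (Nat.zero_le _) hij']
    gcongr
    simpa only [hpi] using G.cost_le_sum_path p hij'
  · intro i j hij
    have hij' : (σ.symm i : ℕ) ≤ (σ.symm j : ℕ) := by exact_mod_cast hij
    rw [← Finset.sum_Ico_consecutive _ hij' (hle j)]
    gcongr
    simpa only [hpi] using G.cost_le_sum_path p hij'

/-- Every Hamiltonian path contains a path between any two given arms. -/
theorem maxCost_le_hamiltonianWeight [NeZero k] : G.maxCost ≤ G.hamiltonianWeight := by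
  refine le_iInf fun σ => iSup₂_le fun i j => ?_
  let p : ℕ → Fin k := fun t => if ht : t < k then σ ⟨t, ht⟩ else 0
  have hp : ∀ t : Fin k, p t = σ t := fun t => by simp [p]
  have hpi : ∀ i, p (σ.symm i) = i := fun i => by rw [hp, σ.apply_symm_apply]
  rw [G.pathCost_eq_sum_range σ p hp]
  wlog hij : (σ.symm i : ℕ) ≤ (σ.symm j : ℕ) generalizing i j
  · rw [G.cost_symm]
    exact this j i (le_of_not_ge hij)
  have := G.cost_le_sum_path p hij
  rw [hpi, hpi] at this
  refine this.trans (Finset.sum_le_sum_of_subset fun t ht => ?_)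
  rw [Finset.mem_Ico] at ht
  rw [Finset.mem_range]
  omega

theorem threshold_mono : Monotone G.threshold :=
  monotone_nat_of_le_succ fun m => le_add_self.trans (G.hamiltonianWeight_add_threshold_le m)

theorem mul_hamiltonianWeight_le_threshold (m : ℕ) :
    m * G.hamiltonianWeight ≤ G.threshold m := by
  induction m with
  | zero => simp
  | succ m ih =>
    calc _ = G.hamiltonianWeight + m * G.hamiltonianWeight := by push_cast; ring
      _ ≤ G.hamiltonianWeight + G.threshold m := by gcongr
      _ ≤ _ := G.hamiltonianWeight_add_threshold_le m

/-! ### The index function and its critical points. -/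

/-- The number of stages of the elimination game that the budget `S` allows. -/
noncomputable def stages (S : ℝ≥0) : ℕ := sSup {m | G.threshold m ≤ S}

/-- Thresholds grow at least like `m * H` with `H > 0`, so the supremum is a maximum. -/
theorem le_stages_iff [NeZero k] (hH : G.hamiltonianWeight ≠ 0) {S : ℝ≥0} {m : ℕ} :
    m ≤ G.stages S ↔ G.threshold m ≤ S := by
  have hbdd : BddAbove {m | G.threshold m ≤ S} := by
    obtain ⟨n, hn⟩ := ENNReal.exists_nat_mul_gt hH (ENNReal.coe_ne_top (r := S))
    refine ⟨n, fun m hm => ?_⟩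
    by_contra! hmn
    refine (hn.trans_le ?_).not_ge (show G.threshold m ≤ S from hm)
    exact (G.mul_hamiltonianWeight_le_threshold n).trans (G.threshold_mono hmn.le)
  constructor
  · intro h
    have hne : {m | G.threshold m ≤ S}.Nonempty := ⟨0, by simp [threshold_zero]⟩
    exact (G.threshold_mono h).trans (Nat.sSup_mem hne hbdd)
  · exact fun h => le_csSup hbdd h

/-- The infimum is attained at the threshold itself, which is why the intervals between critical
points are closed on the left. -/
theorem criticalPoint_stages [NeZero k] (hH : G.hamiltonianWeight ≠ 0) (j : ℕ) :
    criticalPoint G.stages j = G.threshold j := by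
  simp only [criticalPoint, G.le_stages_iff hH]
  refine le_antisymm ?_ (le_iInf₂ fun S h => h)
  by_cases h : G.threshold j = ∞
  · simp [h]
  · refine (iInf₂_le (G.threshold j).toNNReal ?_).trans ?_ <;> rw [ENNReal.coe_toNNReal h]

/-- For finite `H` the bounds on the thresholds give `mU ≤ stages ≤ mL`, and `maxCost ≤ H` gives `mL
≤ mU + 1`. For `H = ∞` no stage is affordable. -/
theorem stages_eq_or [NeZero k] (hk : 2 ≤ k) (hH : G.hamiltonianWeight ≠ 0) (S : ℝ≥0) :
    G.stages S = G.mU S ∨ G.stages S = G.mL S := by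
  by_cases hT : G.hamiltonianWeight = ∞
  · left
    have h0 : G.mU S = 0 := by simp [mU, hT]
    rw [h0]
    by_contra h
    have := (G.le_stages_iff hH).1 (Nat.one_le_iff_ne_zero.2 h)
    refine ENNReal.coe_ne_top (r := S) (top_le_iff.1 (le_trans ?_ this))
    simpa [hT] using G.mul_hamiltonianWeight_le_threshold 1
  have hMT : G.maxCost ≠ ∞ := ne_top_of_le_ne_top hT G.maxCost_le_hamiltonianWeight
  have hdiv : ∀ c : ℝ≥0∞, (S - c) / G.hamiltonianWeight ≠ ∞ := fun c =>
    ENNReal.div_ne_top (ne_top_of_le_ne_top ENNReal.coe_ne_top tsub_le_self) hH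
  -- The case `m = 0` must be excluded: the truncated subtraction makes the left side true even if
  -- `c > S`.
  have hfloor : ∀ (c : ℝ≥0∞) (m : ℕ), m ≠ 0 →
      (m ≤ ⌊((S - c) / G.hamiltonianWeight).toReal⌋₊ ↔ m * G.hamiltonianWeight + c ≤ S) := by
    intro c m hm
    rw [Nat.le_floor_iff' hm, ← ENNReal.ofReal_le_iff_le_toReal (hdiv c), ENNReal.ofReal_natCast,
      ENNReal.le_div_iff_mul_le (Or.inl hH) (Or.inl hT)]
    constructor
    · intro h
      have hpos : 0 < (S : ℝ≥0∞) - c := lt_of_lt_of_le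
        (ENNReal.mul_pos (by exact_mod_cast hm) hH) h
      calc _ ≤ S - c + c := by gcongr
        _ = S := tsub_add_cancel_of_le (tsub_pos_iff_lt.1 hpos).le
    · intro h
      by_cases hc : c = ∞
      · simp [hc] at h
      · exact ENNReal.le_sub_of_add_le_right hc h
  have hU : G.mU S ≤ G.stages S := by
    by_cases h0 : G.mU S = 0
    · omega
    · exact (G.le_stages_iff hH).2 ((G.threshold_le _).trans ((hfloor _ _ h0).1 le_rfl))
  have hL : G.stages S ≤ G.mL S := by
    by_cases h0 : G.stages S = 0
    · omega
    · refine (hfloor _ _ h0).2 ((G.le_threshold hk (Nat.one_le_iff_ne_zero.2 h0)).trans ?_)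
      exact (G.le_stages_iff hH).1 le_rfl
  have hLU : G.mL S ≤ G.mU S + 1 := by
    by_cases h0 : G.mL S - 1 = 0
    · omega
    · have h1 := (hfloor G.maxMinCost (G.mL S) (by omega)).1 le_rfl
      have : G.mL S - 1 ≤ G.mU S := by
        refine (hfloor _ _ h0).2 (le_trans ?_ (le_self_add.trans h1))
        calc _ ≤ ((G.mL S - 1 : ℕ) : ℝ≥0∞) * G.hamiltonianWeight + G.hamiltonianWeight := by
              gcongr; exact G.maxCost_le_hamiltonianWeight
          _ = ((G.mL S - 1 + 1 : ℕ) : ℝ≥0∞) * G.hamiltonianWeight := by push_cast; ring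
          _ = _ := by rw [Nat.sub_add_cancel (by omega)]
      omega
  omega

theorem strictMono_threshold [NeZero k] (hH : G.hamiltonianWeight ≠ 0)
    (hT : G.hamiltonianWeight ≠ ∞) : StrictMono G.threshold := by
  refine strictMono_nat_of_lt_succ fun m => ?_
  refine lt_of_lt_of_le ?_ (G.hamiltonianWeight_add_threshold_le m)
  have : G.threshold m ≠ ∞ := by
    refine ne_top_of_le_ne_top ?_ (G.threshold_le m)
    exact ENNReal.add_ne_top.2 ⟨ENNReal.mul_ne_top (ENNReal.natCast_ne_top m) hT,
      ne_top_of_le_ne_top hT G.maxCost_le_hamiltonianWeight⟩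
  rw [add_comm]
  exact ENNReal.lt_add_right this hH

end SwitchingGraph
end BwSC

/-! ### The law of the history: prefixes, change of environment, exponential moments. -/

namespace BwSC

variable {k : ℕ}

/-- A history as an infinite sequence, with dummy values after its end. -/
noncomputable def extend [NeZero k] {t : ℕ} (h : History k t) : ℕ → Fin k × ℝ :=
  fun s => if hs : s < t then h ⟨s, hs⟩ else (0, 0)

section Extend

variable [NeZero k] {t : ℕ}

theorem extend_of_lt (h : History k t) {s : ℕ} (hs : s < t) : extend h s = h ⟨s, hs⟩ := by
  simp [extend, hs]

@[simp] theorem extend_fin (h : History k t) (s : Fin t) : extend h s = h s := by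
  simp [extend]

theorem extend_snocHistory_of_lt (h : History k t) (p : Fin k × ℝ) {s : ℕ} (hs : s < t) :
    extend (Policy.snocHistory k t (h, p)) s = extend h s := by
  rw [extend_of_lt _ (hs.trans (Nat.lt_succ_self t)), extend_of_lt _ hs]
  exact Fin.snoc_castSucc (α := fun _ => Fin k × ℝ) p h ⟨s, hs⟩

theorem extend_snocHistory_self (h : History k t) (p : Fin k × ℝ) :
    extend (Policy.snocHistory k t (h, p)) t = p := by
  rw [extend_of_lt _ (Nat.lt_succ_self t)]
  exact Fin.snoc_last (α := fun _ => Fin k × ℝ) p h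

@[fun_prop]
theorem measurable_extend : Measurable (extend : History k t → ℕ → Fin k × ℝ) := by
  refine measurable_pi_lambda _ fun s => ?_
  unfold extend
  split_ifs <;> fun_prop

end Extend

namespace Policy

variable (π : Policy k) (D : Environment k)

theorem lintegral_histLaw_succ (t : ℕ) {f : History k (t + 1) → ℝ≥0∞} (hf : Measurable f) :
    ∫⁻ h, f h ∂(π.histLaw D (t + 1)) =
      ∫⁻ h, ∫⁻ a, ∫⁻ x, f (snocHistory k t (h, (a, x))) ∂(D.law a) ∂(π.act t h)
        ∂(π.histLaw D t) := by
  have hs := measurable_snocHistory k t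
  rw [histLaw, lintegral_map hf hs, Measure.lintegral_compProd (f := fun p => f (snocHistory k t p)) (hf.comp hs)]
  refine lintegral_congr fun h => ?_
  rw [step, Kernel.lintegral_compProd (f := fun p => f (snocHistory k t (h, p))) _ _ _
        ((hf.comp hs).comp measurable_prodMk_left)]
  rfl

/-- The law of a prefix of the history. -/
theorem lintegral_extend_eq [NeZero k] {t T : ℕ} (htT : t ≤ T) {f : (ℕ → Fin k × ℝ) → ℝ≥0∞}
    (hf : Measurable f) (hdep : DependsOn f (Set.Iio t)) :
    ∫⁻ h, f (extend h) ∂(π.histLaw D T) = ∫⁻ h, f (extend h) ∂(π.histLaw D t) := by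
  induction T, htT using Nat.le_induction with
  | base => rfl
  | succ T hT ih =>
    rw [lintegral_histLaw_succ (f := fun h => f (extend h)) _ _ _ (hf.comp measurable_extend), ← ih]
    refine lintegral_congr fun h => ?_
    have : ∀ p, f (extend (snocHistory k T (h, p))) = f (extend h) := fun p =>
      hdep fun s hs => extend_snocHistory_of_lt h p (lt_of_lt_of_le hs hT)
    have hp := D.isProb
    simp [this]

/-- An event decided by the first `t` rounds may be measured at time `t`. This lets a change of
measure be made at a stopping time instead of at the horizon. -/
theorem histLaw_extend_preimage [NeZero k] {t T : ℕ} (htT : t ≤ T) {U : Set (ℕ → Fin k × ℝ)}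
    (hU : MeasurableSet U) (hdep : ∀ ω ω' : ℕ → Fin k × ℝ, (∀ s < t, ω s = ω' s) → (ω ∈ U ↔ ω' ∈ U)) :
    π.histLaw D T (extend ⁻¹' U) = π.histLaw D t (extend ⁻¹' U) := by
  have h := π.lintegral_extend_eq D htT (f := U.indicator 1) (measurable_one.indicator hU)
    (fun ω ω' h => by
      have := hdep ω ω' h
      by_cases h1 : ω ∈ U
      · simp [h1, this.1 h1]
      · simp [h1, mt this.2 h1])
  have key : ∀ n, ∫⁻ h : History k n, U.indicator 1 (extend h) ∂(π.histLaw D n) =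
      π.histLaw D n (extend ⁻¹' U) := fun n => by
    rw [← lintegral_indicator_one (measurable_extend hU)]
    rfl
  rwa [key, key] at h

/-- Change of the environment by densities. -/
theorem lintegral_histLaw_of_withDensity [NeZero k] {D D' : Environment k}
    {g : Fin k → ℝ → ℝ≥0∞} (hg : ∀ a, Measurable (g a))
    (hD : ∀ a, D'.law a = (D.law a).withDensity (g a)) (t : ℕ) {f : History k t → ℝ≥0∞}
    (hf : Measurable f) :
    ∫⁻ h, f h ∂(π.histLaw D' t) =
      ∫⁻ h, f h * ∏ s ∈ Finset.range t, g (extend h s).1 (extend h s).2 ∂(π.histLaw D t) := by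
  have hg' : Measurable fun p : Fin k × ℝ => g p.1 p.2 := measurable_from_prod_countable_right hg
  have hL : ∀ n, Measurable fun h : History k n =>
      ∏ s ∈ Finset.range n, g (extend h s).1 (extend h s).2 := fun n =>
    Finset.measurable_prod _ fun s _ =>
      hg'.comp ((measurable_pi_apply s).comp measurable_extend)
  induction t with
  | zero => simp [histLaw]
  | succ t ih =>
    have hs := measurable_snocHistory k t
    have hp := D.isProb
    have hp' := D'.isProb
    rw [lintegral_histLaw_succ _ _ _ hf, lintegral_histLaw_succ (f := fun h => f h *
      ∏ s ∈ Finset.range (t + 1), g (extend h s).1 (extend h s).2) _ _ _ (hf.mul (hL _)), ih]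
    · refine lintegral_congr fun h => ?_
      have h1 : Measurable fun p : Fin k × ℝ => f (snocHistory k t (h, p)) :=
        (hf.comp hs).comp measurable_prodMk_left
      rw [← lintegral_mul_const _ (Measurable.of_discrete)]
      refine lintegral_congr fun a => ?_
      have h2 : Measurable fun x => f (snocHistory k t (h, (a, x))) := h1.comp measurable_prodMk_left
      rw [hD, lintegral_withDensity_eq_lintegral_mul _ (hg a) h2,
        ← lintegral_mul_const _ ((hg a).mul h2)]
      refine lintegral_congr fun x => ?_
      have h3 : ∏ s ∈ Finset.range t, g (extend (snocHistory k t (h, (a, x))) s).1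
          (extend (snocHistory k t (h, (a, x))) s).2 =
          ∏ s ∈ Finset.range t, g (extend h s).1 (extend h s).2 :=
        Finset.prod_congr rfl fun s hs => by
          rw [extend_snocHistory_of_lt h (a, x) (Finset.mem_range.1 hs)]
      rw [Finset.prod_range_succ, extend_snocHistory_self, h3]
      simp only [Pi.mul_apply]
      ring
    · have : Measurable fun h => ∫⁻ p, f (snocHistory k t (h, p)) ∂(π.step D' t h) :=
        Measurable.lintegral_kernel_prod_right' (hf.comp hs)
      convert this using 2 with h
      rw [step, Kernel.lintegral_compProd (f := fun p => f (snocHistory k t (h, p))) _ _ _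
        ((hf.comp hs).comp measurable_prodMk_left)]
      rfl

/-- Exponential supermartingale of the centred rewards, weighted by round and action. -/
theorem lintegral_exp_le_one [NeZero k] (lam : ℕ → Fin k → ℝ) (t : ℕ) :
    ∫⁻ h, ENNReal.ofReal (Real.exp (∑ s ∈ Finset.range t,
      (lam s (extend h s).1 * ((extend h s).2 - D.mean (extend h s).1)
        - lam s (extend h s).1 ^ 2 / 2))) ∂(π.histLaw D t) ≤ 1 := by
  have hmeas : ∀ s n, Measurable fun h : History k n =>
      (lam s (extend h s).1 * ((extend h s).2 - D.mean (extend h s).1)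
        - lam s (extend h s).1 ^ 2 / 2) := fun s n => by
    have h1 : Measurable fun h : History k n => (extend h s) :=
      (measurable_pi_apply s).comp measurable_extend
    have h2 : Measurable (lam s) := Measurable.of_discrete
    have h3 : Measurable D.mean := Measurable.of_discrete
    have h4 := h2.comp (measurable_fst.comp h1)
    have h5 := h3.comp (measurable_fst.comp h1)
    exact (h4.mul ((measurable_snd.comp h1).sub h5)).sub ((h4.pow_const 2).div_const 2)
  induction t with
  | zero => simp [histLaw]
  | succ t ih =>
    rw [lintegral_histLaw_succ]
    swap
    · exact (Real.measurable_exp.comp (Finset.measurable_sum _ fun s _ => hmeas s _)).ennreal_ofReal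
    refine le_trans (lintegral_mono fun h => ?_) ih
    set c := ENNReal.ofReal (Real.exp (∑ s ∈ Finset.range t,
      (lam s (extend h s).1 * ((extend h s).2 - D.mean (extend h s).1)
        - lam s (extend h s).1 ^ 2 / 2))) with hc
    have key : ∀ a, ∫⁻ x, ENNReal.ofReal (Real.exp (∑ s ∈ Finset.range (t + 1),
        (lam s (extend (snocHistory k t (h, (a, x))) s).1 *
          ((extend (snocHistory k t (h, (a, x))) s).2 -
            D.mean (extend (snocHistory k t (h, (a, x))) s).1)
        - lam s (extend (snocHistory k t (h, (a, x))) s).1 ^ 2 / 2))) ∂(D.law a) ≤ c := by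
      intro a
      have hp := D.isProb a
      have hint := (D.subG a).integrable_exp_mul (lam t a)
      have hmgf := (D.subG a).mgf_le (lam t a)
      have : ∀ x, ENNReal.ofReal (Real.exp (∑ s ∈ Finset.range (t + 1),
        (lam s (extend (snocHistory k t (h, (a, x))) s).1 *
          ((extend (snocHistory k t (h, (a, x))) s).2 -
            D.mean (extend (snocHistory k t (h, (a, x))) s).1)
        - lam s (extend (snocHistory k t (h, (a, x))) s).1 ^ 2 / 2))) =
        c * (ENNReal.ofReal (Real.exp (-(lam t a ^ 2 / 2))) *
          ENNReal.ofReal (Real.exp (lam t a * (x - D.mean a)))) := by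
        intro x
        rw [Finset.sum_range_succ, extend_snocHistory_self, Finset.sum_congr rfl fun s hs => by
          rw [extend_snocHistory_of_lt h (a, x) (Finset.mem_range.1 hs)], Real.exp_add,
          ENNReal.ofReal_mul (Real.exp_pos _).le, hc]
        congr 1
        rw [← ENNReal.ofReal_mul (Real.exp_pos _).le, ← Real.exp_add]
        congr 2
        ring
      simp_rw [this]
      have hm : Measurable fun x => ENNReal.ofReal (Real.exp (lam t a * (x - D.mean a))) := by
        fun_prop
      rw [lintegral_const_mul _ (hm.const_mul _), lintegral_const_mul _ hm]
      refine mul_le_of_le_one_right' ?_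
      unfold Environment.mean
      rw [← ofReal_integral_eq_lintegral_ofReal hint
        (Filter.Eventually.of_forall fun x => (Real.exp_pos _).le),
        ← ENNReal.ofReal_mul (Real.exp_pos _).le]
      refine ENNReal.ofReal_le_one.2 ?_
      rw [mgf] at hmgf
      -- The compensator `lam ^ 2 / 2` cancels the sub-Gaussian bound of the moment generating
      -- function exactly.
      calc _ ≤ Real.exp (-(lam t a ^ 2 / 2)) * Real.exp ((1 : ℝ≥0) * lam t a ^ 2 / 2) := by
            gcongr
        _ = 1 := by rw [← Real.exp_add]; simp
    calc _ ≤ ∫⁻ a, c ∂(π.act t h) := lintegral_mono key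
      _ = c := by simp

/-- Markov's inequality for the supermartingale. The weights select either a fixed block of rounds
or the plays of one arm. The set `A` need not be measurable. -/
theorem measure_exp_le [NeZero k] (lam : ℕ → Fin k → ℝ) (t : ℕ) (u : ℝ) {A : Set (History k t)}
    (hA : ∀ h ∈ A, u ≤ ∑ s ∈ Finset.range t,
      (lam s (extend h s).1 * ((extend h s).2 - D.mean (extend h s).1)
        - lam s (extend h s).1 ^ 2 / 2)) :
    π.histLaw D t A ≤ ENNReal.ofReal (Real.exp (-u)) := by
  have h1 : π.histLaw D t A * ENNReal.ofReal (Real.exp u) ≤ 1 := by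
    refine le_trans ?_ (π.lintegral_exp_le_one D lam t)
    rw [mul_comm]
    refine le_trans ?_ (mul_meas_ge_le_lintegral₀ ?_ (ENNReal.ofReal (Real.exp u)))
    · gcongr
      intro h hh
      exact ENNReal.ofReal_le_ofReal (Real.exp_le_exp.2 (hA h hh))
    · refine (Real.measurable_exp.comp
        (Finset.measurable_sum _ fun s _ => ?_)).ennreal_ofReal.aemeasurable
      have h1 : Measurable fun h : History k t => (extend h s) :=
        (measurable_pi_apply s).comp measurable_extend
      have h2 : Measurable (lam s) := Measurable.of_discrete
      have h3 : Measurable D.mean := Measurable.of_discrete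
      have h4 := h2.comp (measurable_fst.comp h1)
      have h5 := h3.comp (measurable_fst.comp h1)
      exact (h4.mul ((measurable_snd.comp h1).sub h5)).sub ((h4.pow_const 2).div_const 2)
  rw [Real.exp_neg, ENNReal.ofReal_inv_of_pos (Real.exp_pos u)]
  rw [← one_div, ENNReal.le_div_iff_mul_le]
  · exact h1
  · left; simp [Real.exp_pos]
  · right; simp

end Policy
end BwSC

/-! ### Regret as an expected sum of gaps, and concentration on blocks of rounds. -/

namespace BwSC

variable {k : ℕ}

namespace Environment

variable (D : Environment k)

theorem mean_le_bestMean (a : Fin k) : D.mean a ≤ D.bestMean :=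
  le_ciSup (Set.finite_range D.mean).bddAbove a

theorem exists_bestMean_eq [NeZero k] : ∃ b, D.mean b = D.bestMean :=
  exists_eq_ciSup_of_finite

theorem bestMean_sub_mean_le_one [NeZero k] (a : Fin k) : D.bestMean - D.mean a ≤ 1 := by
  obtain ⟨b, hb⟩ := D.exists_bestMean_eq
  rw [← hb]
  exact (le_abs_self _).trans (D.gap_le b a)

theorem sum_gap_nonneg {T : ℕ} (ω : ℕ → Fin k × ℝ) :
    0 ≤ ∑ s ∈ Finset.range T, (D.bestMean - D.mean (ω s).1) :=
  Finset.sum_nonneg fun _ _ => sub_nonneg.2 (D.mean_le_bestMean _)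

end Environment

namespace Policy

variable [NeZero k] (π : Policy k) (D : Environment k)

theorem integrable_mean (T s : ℕ) :
    Integrable (fun h => D.mean (extend h s).1) (π.histLaw D T) := by
  have h1 : Measurable fun h : History k T => (extend h s) :=
    (measurable_pi_apply s).comp measurable_extend
  have h3 : Measurable D.mean := Measurable.of_discrete
  refine Integrable.of_bound (h3.comp (measurable_fst.comp h1)).aestronglyMeasurable
    (∑ i, ‖D.mean i‖) (Filter.Eventually.of_forall fun h => ?_)
  exact Finset.single_le_sum (f := fun i => ‖D.mean i‖) (fun i _ => norm_nonneg _)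
    (Finset.mem_univ _)

theorem integrable_sum_gap (T : ℕ) :
    Integrable (fun h => ∑ s ∈ Finset.range T, (D.bestMean - D.mean (extend h s).1))
      (π.histLaw D T) :=
  integrable_finsetSum _ fun s _ => (integrable_const _).sub (π.integrable_mean D T s)

theorem regretIn_eq (T : ℕ) :
    π.regretIn D T =
      ∫ h, ∑ s ∈ Finset.range T, (D.bestMean - D.mean (extend h s).1) ∂(π.histLaw D T) := by
  have h1 : ∀ h : History k T, ∑ s ∈ Finset.range T, (D.bestMean - D.mean (extend h s).1) =
      T * D.bestMean - ∑ s : Fin T, D.mean (h s).1 := by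
    intro h
    rw [Finset.sum_sub_distrib, Finset.sum_const, Finset.card_range, nsmul_eq_mul,
      ← Fin.sum_univ_eq_sum_range (fun s => D.mean (extend h s).1)]
    simp
  simp_rw [h1]
  rw [regretIn, integral_sub (integrable_const _)]
  · simp
  · refine integrable_finsetSum _ fun s _ => ?_
    simpa using π.integrable_mean D T s

theorem le_regretIn {T : ℕ} {A : Set (History k T)} (hA : MeasurableSet A) {r : ℝ}
    (hr : ∀ h ∈ A, r ≤ ∑ s ∈ Finset.range T, (D.bestMean - D.mean (extend h s).1)) :
    (π.histLaw D T).real A * r ≤ π.regretIn D T := by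
  rw [regretIn_eq, ← smul_eq_mul, ← integral_indicator_const r hA]
  refine integral_mono ((integrable_const r).indicator hA) (π.integrable_sum_gap D T) fun h => ?_
  by_cases hh : h ∈ A
  · simpa [hh] using hr h hh
  · simpa [hh] using D.sum_gap_nonneg (T := T) (extend h)

/-- On the exceptional set every round costs at most `1`, since means differ by at most `1`. -/
theorem regretIn_le {T : ℕ} {A : Set (History k T)} {δ ρ : ℝ} (hδ : 0 ≤ δ) (hρ : 0 ≤ ρ)
    (hA : π.histLaw D T A ≤ ENNReal.ofReal δ)
    (hr : ∀ᵐ h ∂(π.histLaw D T), h ∉ A →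
      ∑ s ∈ Finset.range T, (D.bestMean - D.mean (extend h s).1) ≤ ρ) :
    π.regretIn D T ≤ ρ + T * δ := by
  -- The exceptional set is only given with its outer measure.
  set B := toMeasurable (π.histLaw D T) A
  have hB : MeasurableSet B := measurableSet_toMeasurable _ _
  have hBδ : (π.histLaw D T).real B ≤ δ := by
    rw [Measure.real, measure_toMeasurable]
    exact ENNReal.toReal_le_of_le_ofReal hδ hA
  calc π.regretIn D T ≤ ∫ h, ρ + B.indicator (fun _ => (T : ℝ)) h ∂(π.histLaw D T) := by
        rw [regretIn_eq]
        refine integral_mono_ae (π.integrable_sum_gap D T)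
          ((integrable_const ρ).add ((integrable_const _).indicator hB)) ?_
        filter_upwards [hr] with h hh
        by_cases hhB : h ∈ B
        · simp only [hhB, Set.indicator_of_mem]
          have : ∑ s ∈ Finset.range T, (D.bestMean - D.mean (extend h s).1) ≤
              ∑ s ∈ Finset.range T, (1 : ℝ) :=
            Finset.sum_le_sum fun s _ => D.bestMean_sub_mean_le_one _
          simp at this
          simp only [Finset.sum_sub_distrib, Finset.sum_const, Finset.card_range,
            nsmul_eq_mul]
          linarith
        · simp only [hhB, not_false_eq_true, Set.indicator_of_notMem, add_zero]
          exact hh fun hA => hhB (subset_toMeasurable _ _ hA)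
    _ = ρ + (π.histLaw D T).real B * T := by
        rw [integral_add (integrable_const ρ) ((integrable_const _).indicator hB),
          integral_indicator_const _ hB]
        simp
    _ ≤ ρ + T * δ := by
        rw [mul_comm (T : ℝ)]
        gcongr

/-- Concentration of the rewards of a fixed block of rounds. -/
theorem measure_block_le {T a b : ℕ} (hab : a < b) (hbT : b ≤ T) {L : ℝ} (hL : 0 ≤ L) :
    π.histLaw D T {h | √(2 * (b - a : ℕ) * L) <
      |∑ s ∈ Finset.Ico a b, ((extend h s).2 - D.mean (extend h s).1)|} ≤
      ENNReal.ofReal (2 * Real.exp (-L)) := by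
  have hn : (0 : ℝ) < (b - a : ℕ) := by
    exact_mod_cast Nat.sub_pos_of_lt hab
  set n : ℝ := ((b - a : ℕ) : ℝ) with hn'
  have key : ∀ c : ℝ, (c = 1 ∨ c = -1) → π.histLaw D T {h | √(2 * n * L) <
      c * ∑ s ∈ Finset.Ico a b, ((extend h s).2 - D.mean (extend h s).1)} ≤
      ENNReal.ofReal (Real.exp (-L)) := by
    intro c hc
    have hc2 : c ^ 2 = 1 := by rcases hc with rfl | rfl <;> norm_num
    -- The weight `√(2L/n)` is the optimiser of the Chernoff bound: times the deviation `√(2nL)` it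
    -- gives `2L`, and the compensator takes away `L`.
    refine π.measure_exp_le D (fun s _ => if s ∈ Finset.Ico a b then c * √(2 * L / n) else 0) T L ?_
    intro h hh
    have hsub : Finset.Ico a b ⊆ Finset.range T := fun s hs => by
      rw [Finset.mem_Ico] at hs
      rw [Finset.mem_range]
      omega
    have : ∑ s ∈ Finset.range T,
        ((if s ∈ Finset.Ico a b then c * √(2 * L / n) else 0) *
          ((extend h s).2 - D.mean (extend h s).1)
        - (if s ∈ Finset.Ico a b then c * √(2 * L / n) else 0) ^ 2 / 2) =
        √(2 * L / n) * (c * ∑ s ∈ Finset.Ico a b, ((extend h s).2 - D.mean (extend h s).1)) - L := by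
      rw [← Finset.sum_subset hsub fun s _ hs => by simp [hs]]
      rw [Finset.sum_congr rfl fun s hs => by rw [if_pos hs]]
      rw [Finset.sum_sub_distrib, ← Finset.mul_sum, Finset.sum_const, Nat.card_Ico, nsmul_eq_mul,
        ← hn', mul_pow, hc2, Real.sq_sqrt (by positivity)]
      field_simp
    rw [this]
    have h2 : √(2 * L / n) * √(2 * n * L) = 2 * L := by
      rw [← Real.sqrt_mul (by positivity), show 2 * L / n * (2 * n * L) = (2 * L) ^ 2 by
        field_simp, Real.sqrt_sq (by positivity)]
    have h3 := mul_le_mul_of_nonneg_left (le_of_lt hh) (Real.sqrt_nonneg (2 * L / n))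
    rw [h2] at h3
    linarith
  calc _ ≤ π.histLaw D T ({h | √(2 * n * L) <
      1 * ∑ s ∈ Finset.Ico a b, ((extend h s).2 - D.mean (extend h s).1)} ∪ {h | √(2 * n * L) <
      (-1) * ∑ s ∈ Finset.Ico a b, ((extend h s).2 - D.mean (extend h s).1)}) := by
        refine measure_mono fun h hh => ?_
        rcases lt_abs.1 (Set.mem_ofPred.1 hh) with h1 | h1
        · left; simpa using h1
        · right; simpa using h1
    _ ≤ _ := measure_union_le _ _
    _ ≤ ENNReal.ofReal (Real.exp (-L)) + ENNReal.ofReal (Real.exp (-L)) :=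
        add_le_add (key 1 (Or.inl rfl)) (key (-1) (Or.inr rfl))
    _ = _ := by rw [← ENNReal.ofReal_add (Real.exp_pos _).le (Real.exp_pos _).le, two_mul]

/-- Simultaneous concentration of the rewards of all blocks of rounds. -/
theorem measure_exists_block_le (T : ℕ) {L : ℝ} (hL : 0 ≤ L) :
    π.histLaw D T {h | ∃ a b, a < b ∧ b ≤ T ∧ √(2 * (b - a : ℕ) * L) <
      |∑ s ∈ Finset.Ico a b, ((extend h s).2 - D.mean (extend h s).1)|} ≤
      ENNReal.ofReal (T ^ 2 * (2 * Real.exp (-L))) := by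
  calc _ ≤ π.histLaw D T (⋃ a ∈ Finset.range T, ⋃ b ∈ Finset.Ioc 0 T,
        {h | a < b ∧ b ≤ T ∧ √(2 * (b - a : ℕ) * L) <
          |∑ s ∈ Finset.Ico a b, ((extend h s).2 - D.mean (extend h s).1)|}) := by
        refine measure_mono ?_
        rintro h ⟨a, b, hab, hbT, hh⟩
        simp only [Set.mem_iUnion, Finset.mem_range, Finset.mem_Ioc]
        exact ⟨a, by omega, b, ⟨by omega, hbT⟩, hab, hbT, hh⟩
    _ ≤ ∑ a ∈ Finset.range T, ∑ b ∈ Finset.Ioc 0 T, ENNReal.ofReal (2 * Real.exp (-L)) := by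
        refine (measure_biUnion_finset_le _ _).trans (Finset.sum_le_sum fun a _ => ?_)
        refine (measure_biUnion_finset_le _ _).trans (Finset.sum_le_sum fun b _ => ?_)
        by_cases hab : a < b ∧ b ≤ T
        · simpa [hab.1, hab.2] using π.measure_block_le D hab.1 hab.2 hL
        · refine le_trans (le_of_eq ?_) zero_le
          convert measure_empty (μ := π.histLaw D T)
          ext h
          simp only [Set.mem_ofPred_eq, Set.mem_empty_iff_false, iff_false]
          exact fun hh => hab ⟨hh.1, hh.2.1⟩
    _ = _ := by
        simp only [Finset.sum_const, Finset.card_range, Nat.card_Ioc, Nat.sub_zero, nsmul_eq_mul]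
        rw [ENNReal.ofReal_mul (p := (T : ℝ) ^ 2) (by positivity), ENNReal.ofReal_pow (by positivity),
          ENNReal.ofReal_natCast]
        ring

end Policy

/-! ### Policies given by machines -/

/-- The state of a machine after `t` rounds with rewards `x`. -/
def machineRun {Q : Type*} (q₀ : Q) (next : Q → ℝ → Q) (x : ℕ → ℝ) : ℕ → Q
  | 0 => q₀
  | t + 1 => next (machineRun q₀ next x t) (x t)

theorem machineRun_congr {Q : Type*} {q₀ : Q} {next : Q → ℝ → Q} {x x' : ℕ → ℝ} {t : ℕ}
    (h : ∀ s < t, x s = x' s) : machineRun q₀ next x t = machineRun q₀ next x' t := by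
  induction t with
  | zero => rfl
  | succ t ih =>
    rw [machineRun, machineRun, ih fun s hs => h s (hs.trans (Nat.lt_succ_self t)),
      h t (Nat.lt_succ_self t)]

theorem measurable_machineRun {Q : Type*} [MeasurableSpace Q] {q₀ : Q} {next : Q → ℝ → Q}
    (hnext : Measurable fun p : Q × ℝ => next p.1 p.2) (t : ℕ) :
    Measurable fun x : ℕ → ℝ => machineRun q₀ next x t := by
  induction t with
  | zero => exact measurable_const
  | succ t ih => exact hnext.comp (ih.prodMk (measurable_pi_apply t))

/-- The deterministic policy that plays the output of a machine. -/
noncomputable def machinePolicy [NeZero k] {Q : Type*} [MeasurableSpace Q] (q₀ : Q)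
    (next : Q → ℝ → Q) (out : Q → Fin k) (hnext : Measurable fun p : Q × ℝ => next p.1 p.2)
    (hout : Measurable out) : Policy k where
  act t := Kernel.deterministic
    (fun h => out (machineRun q₀ next (fun s => (extend h s).2) t))
    (hout.comp ((measurable_machineRun hnext t).comp (measurable_pi_lambda _ fun s =>
      measurable_snd.comp ((measurable_pi_apply s).comp measurable_extend))))
  isMarkov _ := inferInstance

/-- The actions are almost surely functions of the rewards, so cost and regret can be bounded for
each reward sequence separately. -/
theorem ae_histLaw_machinePolicy [NeZero k] {Q : Type*} [MeasurableSpace Q] (q₀ : Q)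
    (next : Q → ℝ → Q) (out : Q → Fin k) (hnext : Measurable fun p : Q × ℝ => next p.1 p.2)
    (hout : Measurable out) (D : Environment k) (T : ℕ) :
    ∀ᵐ h ∂((machinePolicy q₀ next out hnext hout).histLaw D T), ∀ t < T,
      (extend h t).1 = out (machineRun q₀ next (fun s => (extend h s).2) t) := by
  have hrun : ∀ n t, Measurable fun h : History k n =>
      out (machineRun q₀ next (fun s => (extend h s).2) t) := fun n t =>
    hout.comp ((measurable_machineRun hnext t).comp (measurable_pi_lambda _ fun s =>
      measurable_snd.comp ((measurable_pi_apply s).comp measurable_extend)))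
  have hset : ∀ n m, MeasurableSet {h : History k n | ∀ t < m,
      (extend h t).1 = out (machineRun q₀ next (fun s => (extend h s).2) t)} := fun n m => by
    simp only [Set.ofPred_forall]
    exact MeasurableSet.iInter fun t => MeasurableSet.iInter fun _ => measurableSet_eq_fun
      (measurable_fst.comp ((measurable_pi_apply t).comp measurable_extend)) (hrun n t)
  induction T with
  | zero => simp
  | succ T ih =>
    set π := machinePolicy q₀ next out hnext hout with hπ
    have hm : Measurable ({h : History k (T + 1) | ∀ t < T + 1, (extend h t).1 =
      out (machineRun q₀ next (fun s => (extend h s).2) t)}ᶜ.indicator (1 : History k (T + 1) → ℝ≥0∞)) :=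
      measurable_one.indicator (hset _ _).compl
    rw [ae_iff, show {h : History k (T + 1) | ¬ ∀ t < T + 1, (extend h t).1 =
      out (machineRun q₀ next (fun s => (extend h s).2) t)} = {h | ∀ t < T + 1, (extend h t).1 =
      out (machineRun q₀ next (fun s => (extend h s).2) t)}ᶜ from rfl,
      ← lintegral_indicator_one (hset _ _).compl, π.lintegral_histLaw_succ D T hm]
    refine (lintegral_congr_ae ?_).trans lintegral_zero
    filter_upwards [ih] with h hh
    have hact : π.act T h = Measure.dirac (out (machineRun q₀ next (fun s => (extend h s).2) T)) := by
      rw [hπ, machinePolicy, Kernel.deterministic_apply]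
    rw [hact, lintegral_dirac]
    refine (lintegral_congr fun x => ?_).trans lintegral_zero
    rw [Set.indicator_of_notMem]
    simp only [Set.mem_compl_iff, Set.mem_ofPred_eq, not_not]
    intro t ht
    have hrun' : machineRun q₀ next (fun s => (extend (Policy.snocHistory k T
        (h, (out (machineRun q₀ next (fun s => (extend h s).2) T), x))) s).2) t =
        machineRun q₀ next (fun s => (extend h s).2) t :=
      machineRun_congr fun s hs => by rw [extend_snocHistory_of_lt _ _ (by omega)]
    rw [hrun']
    rcases Nat.lt_succ_iff_lt_or_eq.1 ht with h1 | rfl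
    · rw [extend_snocHistory_of_lt _ _ h1, hh t h1]
    · rw [extend_snocHistory_self]

end BwSC

namespace BwSC

variable {k : ℕ}

/-! ### Successive elimination along an optimal play of the elimination game -/

/-- The discrete part of the state of the elimination policy. -/
structure EliminationState (k : ℕ) where
  /-- The number of remaining stages. -/
  stage : ℕ
  /-- The arms that are to be visited in the current stage. -/
  toVisit : Finset (Fin k)
  /-- The leading arms of the current stage. -/
  leaders : Finset (Fin k)
  /-- The current arm. -/
  arm : Fin k
  /-- The number of plays in the current visit. -/
  plays : ℕ

namespace EliminationState

instance : MeasurableSpace (EliminationState k) := ⊤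

instance : DiscreteMeasurableSpace (EliminationState k) := ⟨fun _ => trivial⟩

instance : Countable (EliminationState k) := by
  refine Function.Injective.countable (f := fun s : EliminationState k =>
    (s.stage, s.toVisit, s.leaders, s.arm, s.plays)) fun s s' h => ?_
  cases s
  cases s'
  simp_all

end EliminationState

/-- The comparison of an arm with estimate `est` with the leading arms, which have level `M`. -/
noncomputable def compareArm (w : ℝ) (C : Finset (Fin k)) (M : ℝ) (i : Fin k) (est : ℝ) :
    Finset (Fin k) × ℝ :=
  if C = ∅ then ({i}, est)
  else if est < M - w then (C, M)
  else if M + w < est then ({i}, est)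
  else (insert i C, max M est)

theorem isAnswer_compareArm (w : ℝ) (C : Finset (Fin k)) (M : ℝ) (i : Fin k) (est : ℝ) :
    SwitchingGraph.IsAnswer C i (compareArm w C M i est).1 := by
  unfold compareArm SwitchingGraph.IsAnswer
  split_ifs with h1 h2 h3
  · exact Or.inr (Or.inl rfl)
  · exact Or.inr (Or.inr ⟨rfl, Finset.nonempty_iff_ne_empty.2 h1⟩)
  · exact Or.inr (Or.inl rfl)
  · exact Or.inl rfl

/-- The means of the leading arms `C` agree with their level `M` up to the error `e` and `n`
widths `w`. -/
structure IsLevel (mean : Fin k → ℝ) (e w n : ℝ) (C : Finset (Fin k)) (M : ℝ) : Prop where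
  exists_ge : ∃ c ∈ C, M - e ≤ mean c
  ge : ∀ c ∈ C, M - n * w - e ≤ mean c
  le : ∀ c ∈ C, mean c ≤ M + e

/-- The level `M` is the largest estimate among the leaders. A tie raises it by at most one width,
so a leader of long standing may fall behind by one width per comparison. -/
theorem isLevel_compareArm {mean : Fin k → ℝ} {e n : ℝ} {C : Finset (Fin k)} {M : ℝ} {i : Fin k}
    {est : ℝ} (he : 0 ≤ e) (hn : 0 ≤ n) (hest : |est - mean i| ≤ e)
    (hC : C ≠ ∅ → IsLevel mean e (2 * e) n C M) :
    IsLevel mean e (2 * e) (n + 1) (compareArm (2 * e) C M i est).1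
      (compareArm (2 * e) C M i est).2 := by
  obtain ⟨h1, h2⟩ := abs_le.1 hest
  have hne : 0 ≤ n * (2 * e) := by positivity
  have hsing : IsLevel mean e (2 * e) (n + 1) {i} est :=
    ⟨⟨i, by simp, by linarith⟩, fun c hc => by
      rw [Finset.mem_singleton.1 hc]; linarith, fun c hc => by
      rw [Finset.mem_singleton.1 hc]; linarith⟩
  unfold compareArm
  split_ifs with hC0 h3 h4
  · exact hsing
  · obtain ⟨h5, h6, h7⟩ := hC hC0
    exact ⟨h5, fun c hc => by linarith [h6 c hc], h7⟩
  · exact hsing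
  · obtain ⟨⟨c₀, hc₀, h5⟩, h6, h7⟩ := hC hC0
    push Not at h3 h4
    refine ⟨?_, fun c hc => ?_, fun c hc => ?_⟩
    · rcases le_total M est with h | h
      · exact ⟨i, Finset.mem_insert_self _ _, by rw [max_eq_right h]; linarith⟩
      · exact ⟨c₀, Finset.mem_insert_of_mem hc₀, by rwa [max_eq_left h]⟩
    · have hmax : max M est ≤ M + 2 * e := max_le (by linarith) h4
      rcases Finset.mem_insert.1 hc with rfl | hc
      · have : max M est ≤ est + 2 * e := max_le (by linarith) (by linarith)
        show max M est - (n + 1) * (2 * e) - e ≤ mean c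
        linarith
      · show max M est - (n + 1) * (2 * e) - e ≤ mean c
        linarith [h6 c hc]
    · rcases Finset.mem_insert.1 hc with rfl | hc
      · show mean c ≤ max M est + e
        linarith [le_max_right M est]
      · show mean c ≤ max M est + e
        linarith [le_max_left M est, h7 c hc]

/-- The best arm is not eliminated. -/
theorem best_mem_compareArm {mean : Fin k → ℝ} {e n : ℝ} {B C : Finset (Fin k)} {M : ℝ}
    {i b : Fin k} {est : ℝ} (hest : |est - mean i| ≤ e)
    (hC : C ≠ ∅ → IsLevel mean e (2 * e) n C M) (hb : ∀ a, mean a ≤ mean b)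
    (hbm : b ∈ B ∪ C) : b ∈ B.erase i ∪ (compareArm (2 * e) C M i est).1 := by
  obtain ⟨h1, h2⟩ := abs_le.1 hest
  rcases eq_or_ne b i with rfl | hbi
  · refine Finset.mem_union_right _ ?_
    unfold compareArm
    split_ifs with hC0 h3 h4
    · simp
    · obtain ⟨⟨c, hc, h5⟩, h6, h7⟩ := hC hC0
      have := hb c
      -- The best arm cannot lose to the level: its estimate is at least `mean b - e ≥ mean c - e ≥
      -- M - 2 * e`, and the width is `2 * e`.
      linarith
    · simp
    · simp
  · rcases Finset.mem_union.1 hbm with hbB | hbC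
    · exact Finset.mem_union_left _ (Finset.mem_erase.2 ⟨hbi, hbB⟩)
    · refine Finset.mem_union_right _ ?_
      have hC0 : C ≠ ∅ := Finset.ne_empty_of_mem hbC
      obtain ⟨-, -, h7⟩ := hC hC0
      unfold compareArm
      rw [if_neg hC0]
      split_ifs with h3 h4
      · exact hbC
      · have h8 := hb i
        have h9 := h7 b hbC
        -- If `i` wins by more than `2 * e`, its mean exceeds `M + e`, hence that of every leader;
        -- then no leader was best.
        linarith
      · exact Finset.mem_insert_of_mem hbC

namespace SwitchingGraph

variable (G : SwitchingGraph k)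

/-- The next arm of an optimal play. -/
noncomputable def nextArm (q : ℕ) (B C C' : Finset (Fin k)) (i : Fin k) : Fin k :=
  open Classical in
  if h : i ∈ B ∧ IsAnswer C i C' then (G.exists_move (q := q) h.1 h.2).choose else i

theorem nextArm_spec {q : ℕ} {B C C' : Finset (Fin k)} {i : Fin k} (h : i ∈ B)
    (hC : IsAnswer C i C') : G.nextArm q B C C' i ∈ nextToVisit B C' i ∧
      G.cost i (G.nextArm q B C C' i) + G.gameValue (nextStage q B i) (nextToVisit B C' i)
        (nextLeaders B C' i) (G.nextArm q B C C' i) ≤ G.gameValue (q + 1) B C i := by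
  rw [nextArm, dif_pos ⟨h, hC⟩]
  exact (G.exists_move (q := q) h hC).choose_spec

/-- The state after a visit that results in the answer `C'`. -/
noncomputable def advance (s : EliminationState k) (C' : Finset (Fin k)) : EliminationState k where
  stage := nextStage (s.stage - 1) s.toVisit s.arm
  toVisit := nextToVisit s.toVisit C' s.arm
  leaders := nextLeaders s.toVisit C' s.arm
  arm := G.nextArm (s.stage - 1) s.toVisit s.leaders C' s.arm
  plays := 0

/-- The transition of the elimination policy. The two real registers hold the sum of the rewards of
the current visit and the level of the leading arms. A visit in stage `q` has `len q` rounds. -/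
noncomputable def eliminationNext (len : ℕ → ℕ) (e : ℕ → ℝ) (s : EliminationState k × ℝ × ℝ)
    (x : ℝ) : EliminationState k × ℝ × ℝ :=
  -- The reward `x` belongs to the round numbered `plays + 1` of the visit, so the comparison uses
  -- exactly `len` rewards. In stage `0` the arm is kept forever.
  if s.1.stage = 0 ∨ s.1.plays + 1 < len s.1.stage then
    ({ s.1 with plays := s.1.plays + 1 }, s.2.1 + x, s.2.2)
  else
    (G.advance s.1 (compareArm (2 * e s.1.stage) s.1.leaders s.2.2 s.1.arm
      ((s.2.1 + x) / len s.1.stage)).1, 0,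
      (compareArm (2 * e s.1.stage) s.1.leaders s.2.2 s.1.arm ((s.2.1 + x) / len s.1.stage)).2)

theorem measurable_eliminationNext (len : ℕ → ℕ) (e : ℕ → ℝ) :
    Measurable fun p : (EliminationState k × ℝ × ℝ) × ℝ => G.eliminationNext len e p.1 p.2 := by
  have h1 : Measurable fun p : EliminationState k × (ℝ × ℝ) × ℝ =>
      G.eliminationNext len e (p.1, p.2.1) p.2.2 := by
    refine measurable_from_prod_countable_right fun s => ?_
    unfold eliminationNext
    dsimp only
    split_ifs
    · fun_prop
    · have hest : Measurable fun p : (ℝ × ℝ) × ℝ => (p.1.1 + p.2) / (len s.stage : ℝ) := by fun_prop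
      have hc : Measurable fun p : (ℝ × ℝ) × ℝ => (((G.advance s (compareArm (2 * e s.stage)
          s.leaders p.1.2 s.arm ((p.1.1 + p.2) / len s.stage)).1, (0 : ℝ),
          (compareArm (2 * e s.stage) s.leaders p.1.2 s.arm
            ((p.1.1 + p.2) / len s.stage)).2)) : EliminationState k × ℝ × ℝ) := by
        unfold compareArm
        by_cases hC : s.leaders = ∅
        · simp only [hC, if_true]
          fun_prop
        · simp only [hC, if_false]
          have hlt1 : MeasurableSet {p : (ℝ × ℝ) × ℝ | (p.1.1 + p.2) / (len s.stage : ℝ) <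
              p.1.2 - 2 * e s.stage} := measurableSet_lt hest (by fun_prop)
          have hlt2 : MeasurableSet {p : (ℝ × ℝ) × ℝ | p.1.2 + 2 * e s.stage <
              (p.1.1 + p.2) / (len s.stage : ℝ)} := measurableSet_lt (by fun_prop) hest
          -- For fixed discrete state the transition is a case distinction by two measurable
          -- inequalities; the conditional is moved outside.
          have : (fun p : (ℝ × ℝ) × ℝ => if (p.1.1 + p.2) / (len s.stage : ℝ) <
              p.1.2 - 2 * e s.stage then (G.advance s s.leaders, (0 : ℝ), p.1.2) else
              if p.1.2 + 2 * e s.stage < (p.1.1 + p.2) / (len s.stage : ℝ) then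
                (G.advance s {s.arm}, (0 : ℝ), (p.1.1 + p.2) / (len s.stage : ℝ)) else
                (G.advance s (insert s.arm s.leaders), (0 : ℝ),
                  max p.1.2 ((p.1.1 + p.2) / (len s.stage : ℝ)))) =
              (fun p : (ℝ × ℝ) × ℝ => ((G.advance s (if (p.1.1 + p.2) / (len s.stage : ℝ) <
              p.1.2 - 2 * e s.stage then (s.leaders, p.1.2) else
              if p.1.2 + 2 * e s.stage < (p.1.1 + p.2) / (len s.stage : ℝ) then
                ({s.arm}, (p.1.1 + p.2) / (len s.stage : ℝ)) else
                (insert s.arm s.leaders, max p.1.2 ((p.1.1 + p.2) / (len s.stage : ℝ)))).1, (0 : ℝ),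
              (if (p.1.1 + p.2) / (len s.stage : ℝ) <
              p.1.2 - 2 * e s.stage then (s.leaders, p.1.2) else
              if p.1.2 + 2 * e s.stage < (p.1.1 + p.2) / (len s.stage : ℝ) then
                ({s.arm}, (p.1.1 + p.2) / (len s.stage : ℝ)) else
                (insert s.arm s.leaders, max p.1.2 ((p.1.1 + p.2) / (len s.stage : ℝ)))).2) :
              EliminationState k × ℝ × ℝ)) := by
            funext p
            split_ifs <;> rfl
          rw [← this]
          exact Measurable.ite hlt1 (by fun_prop) (Measurable.ite hlt2 (by fun_prop) (by fun_prop))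
      exact hc
  exact h1.comp ((measurable_fst.comp measurable_fst).prodMk
    ((measurable_snd.comp measurable_fst).prodMk measurable_snd))

/-- The initial state of the elimination policy. -/
def eliminationInit (m : ℕ) (i : Fin k) : EliminationState k × ℝ × ℝ :=
  (⟨m, Finset.univ, ∅, i, 0⟩, 0, 0)

/-- The state of the elimination policy. -/
noncomputable def eliminationRun (len : ℕ → ℕ) (e : ℕ → ℝ) (m : ℕ) (i : Fin k) (x : ℕ → ℝ) (t : ℕ) :
    EliminationState k × ℝ × ℝ :=
  machineRun (eliminationInit m i) (G.eliminationNext len e) x t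

/-- The elimination policy. -/
noncomputable def eliminationPolicy [NeZero k] (len : ℕ → ℕ) (e : ℕ → ℝ) (m : ℕ) (i : Fin k) :
    Policy k :=
  machinePolicy (eliminationInit m i) (G.eliminationNext len e) (fun s => s.1.arm)
    (G.measurable_eliminationNext len e) ((Measurable.of_discrete
      (f := fun s : EliminationState k => s.arm)).comp measurable_fst)

theorem eliminationRun_succ (len : ℕ → ℕ) (e : ℕ → ℝ) (m : ℕ) (i : Fin k) (x : ℕ → ℝ) (t : ℕ) :
    G.eliminationRun len e m i x (t + 1) =
      G.eliminationNext len e (G.eliminationRun len e m i x t) (x t) := rfl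

/-- Invariants of the elimination policy that hold for all rewards. -/
structure PlayInvariant (len : ℕ → ℕ) (W : ℝ≥0∞) (x : ℕ → ℝ) (t : ℕ)
    (run : ℕ → EliminationState k × ℝ × ℝ) : Prop where
  arm_mem : (run t).1.arm ∈ (run t).1.toVisit
  cost_le : ∑ r ∈ Finset.range t, G.cost (run r).1.arm (run (r + 1)).1.arm +
    G.gameValue (run t).1.stage (run t).1.toVisit (run t).1.leaders (run t).1.arm ≤ W
  plays_le : (run t).1.plays ≤ t
  arm_eq : ∀ r, t - (run t).1.plays ≤ r → r ≤ t → (run r).1.arm = (run t).1.arm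
  sum_eq : (run t).2.1 = ∑ r ∈ Finset.Ico (t - (run t).1.plays) t, x r
  plays_lt : (run t).1.stage ≠ 0 → (run t).1.plays < len (run t).1.stage

/-- The cost paid so far plus the remaining game value never increases: each switch is an optimal
move against the answer just given, whether or not that answer is statistically correct. -/
theorem playInvariant (len : ℕ → ℕ) (hlen : ∀ q, 1 ≤ len q) (e : ℕ → ℝ) (m : ℕ) (i : Fin k)
    (x : ℕ → ℝ) (t : ℕ) :
    G.PlayInvariant len (G.gameValue m Finset.univ ∅ i) x t (G.eliminationRun len e m i x) := by
  induction t with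
  | zero =>
    refine ⟨Finset.mem_univ _, by simp [eliminationRun, machineRun, eliminationInit], le_rfl,
      fun r _ hr => by rw [Nat.le_zero.1 hr], by simp [eliminationRun, machineRun, eliminationInit],
      fun _ => hlen _⟩
  | succ t ih =>
    have hsucc := G.eliminationRun_succ len e m i x t
    set run := G.eliminationRun len e m i x
    obtain ⟨h1, h2, h3, h4, h5, h6⟩ := ih
    by_cases hcase : (run t).1.stage = 0 ∨ (run t).1.plays + 1 < len (run t).1.stage
    · rw [eliminationNext, if_pos hcase] at hsucc
      have harm : (run (t + 1)).1.arm = (run t).1.arm := by rw [hsucc]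
      have hplays : (run (t + 1)).1.plays = (run t).1.plays + 1 := by rw [hsucc]
      have hstage : (run (t + 1)).1.stage = (run t).1.stage := by rw [hsucc]
      refine ⟨by rw [hsucc]; exact h1, ?_, by omega, fun r hr hrt => ?_, ?_, fun h0 => ?_⟩
      · rw [Finset.sum_range_succ, harm, G.cost_self, add_zero, hsucc]
        exact h2
      · rcases Nat.le_succ_iff.1 hrt with h | rfl
        · rw [harm, h4 r (by omega) h]
        · rfl
      · rw [hplays, Nat.add_sub_add_right, Finset.sum_Ico_succ_top (by omega), ← h5, hsucc]
      · rw [hstage] at h0 ⊢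
        rw [hplays]
        exact hcase.resolve_left h0
    · rw [eliminationNext, if_neg hcase] at hsucc
      push Not at hcase
      have hans := isAnswer_compareArm (2 * e (run t).1.stage) (run t).1.leaders (run t).2.2
        (run t).1.arm (((run t).2.1 + x t) / len (run t).1.stage)
      generalize compareArm (2 * e (run t).1.stage) (run t).1.leaders (run t).2.2
        (run t).1.arm (((run t).2.1 + x t) / len (run t).1.stage) = c at hans hsucc
      have hspec := G.nextArm_spec (q := (run t).1.stage - 1) h1 hans
      rw [Nat.sub_add_cancel (Nat.one_le_iff_ne_zero.2 hcase.1)] at hspec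
      refine ⟨by rw [hsucc]; exact hspec.1, ?_, by rw [hsucc]; exact Nat.zero_le _,
        fun r hr hrt => ?_, ?_, fun _ => ?_⟩
      · rw [Finset.sum_range_succ]
        refine le_trans ?_ h2
        rw [add_assoc]
        gcongr
        rw [hsucc]
        exact hspec.2
      · have : r = t + 1 := by
          rw [hsucc] at hr
          exact le_antisymm hrt hr
        rw [this]
      · rw [hsucc]
        simp [advance]
      · rw [hsucc]
        exact hlen _

end SwitchingGraph
end BwSC

/-! ### Cost and regret of the elimination policy. -/

namespace BwSC

variable {k : ℕ}

namespace SwitchingGraph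

variable (G : SwitchingGraph k)

/-- Parameters of the elimination policy with `m` stages and horizon `T`: lengths of visits, errors
of estimates, gaps of surviving arms, the confidence parameter and the regret per visit. -/
structure EliminationParameters (k m T : ℕ) where
  len : ℕ → ℕ
  err : ℕ → ℝ
  gap : ℕ → ℝ
  conf : ℝ
  reg : ℝ
  one_le_len : ∀ q, 1 ≤ len q
  le_len_zero : T ≤ len 0
  err_nonneg : ∀ q, 0 ≤ err q
  conf_nonneg : 0 ≤ conf
  sqrt_le : ∀ q, √(2 * len q * conf) ≤ err q * len q
  one_le_gap : 1 ≤ gap m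
  gap_nonneg : ∀ q, 0 ≤ gap q
  err_le_gap : ∀ q, (2 * k + 2) * err (q + 1) ≤ gap q
  len_mul_gap_le : ∀ q ≤ m, len q * gap q ≤ reg

/-- Invariants of the elimination policy that hold as long as the estimates are accurate. -/
structure EstimateInvariant {m T : ℕ} (p : EliminationParameters k m T) (mean : Fin k → ℝ)
    (b : Fin k) (t : ℕ) (run : ℕ → EliminationState k × ℝ × ℝ) : Prop where
  best_mem : b ∈ (run t).1.toVisit ∪ (run t).1.leaders
  gap_le : ∀ a ∈ (run t).1.toVisit ∪ (run t).1.leaders, mean b - mean a ≤ p.gap (run t).1.stage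
  level : (run t).1.leaders ≠ ∅ → IsLevel mean (p.err (run t).1.stage)
    (2 * p.err (run t).1.stage) (k - (run t).1.toVisit.card) (run t).1.leaders (run t).2.2
  stage_le : (run t).1.stage ≤ m
  regret_le : ∑ r ∈ Finset.range t, (mean b - mean (run r).1.arm) ≤
    ((m - (run t).1.stage) * k + (k - (run t).1.toVisit.card)) * p.reg +
      (run t).1.plays * p.gap (run t).1.stage

/-- With accurate estimates the best arm always survives, and the survivors of a stage have small
gaps. Every completed visit costs at most `reg`, and at most `k` visits are made per stage. -/
theorem estimateInvariant {m T : ℕ} (p : EliminationParameters k m T) {mean : Fin k → ℝ}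
    {b : Fin k} (hb : ∀ a, mean a ≤ mean b) (hb1 : ∀ a, mean b - mean a ≤ 1) (i : Fin k)
    (x : ℕ → ℝ)
    (hgood : ∀ s t, s < t → t ≤ T →
      |∑ r ∈ Finset.Ico s t, (x r - mean (G.eliminationRun p.len p.err m i x r).1.arm)| ≤
        √(2 * (t - s : ℕ) * p.conf)) (t : ℕ) (ht : t ≤ T) :
    EstimateInvariant p mean b t (G.eliminationRun p.len p.err m i x) := by
  induction t with
  | zero =>
    refine ⟨by simp [eliminationRun, machineRun, eliminationInit],
      fun a _ => (hb1 a).trans p.one_le_gap,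
      fun h => absurd rfl h, le_rfl, ?_⟩
    simp [eliminationRun, machineRun, eliminationInit]
  | succ t ih =>
    have hplay := G.playInvariant p.len p.one_le_len p.err m i x t
    have hsucc := G.eliminationRun_succ p.len p.err m i x t
    set run := G.eliminationRun p.len p.err m i x
    obtain ⟨h1, h2, h3, h4, h5⟩ := ih (by omega)
    have hreg : mean b - mean (run t).1.arm ≤ p.gap (run t).1.stage :=
      h2 _ (Finset.mem_union_left _ hplay.arm_mem)
    by_cases hcase : (run t).1.stage = 0 ∨ (run t).1.plays + 1 < p.len (run t).1.stage
    · rw [eliminationNext, if_pos hcase] at hsucc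
      refine ⟨by rw [hsucc]; exact h1, by rw [hsucc]; exact h2, by rw [hsucc]; exact h3,
        by rw [hsucc]; exact h4, ?_⟩
      rw [Finset.sum_range_succ, hsucc]
      push_cast
      linarith
    · rw [eliminationNext, if_neg hcase] at hsucc
      push Not at hcase
      have hlen : (run t).1.plays + 1 = p.len (run t).1.stage :=
        le_antisymm (hplay.plays_lt hcase.1) hcase.2
      obtain ⟨q, hq⟩ := Nat.exists_eq_succ_of_ne_zero hcase.1
      rw [Nat.succ_eq_add_one] at hq
      set ℓ : ℝ := (p.len (run t).1.stage : ℝ) with hℓ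
      have hℓpos : 0 < ℓ := by
        rw [hℓ]; exact_mod_cast p.one_le_len _
      have hest : |((run t).2.1 + x t) / ℓ - mean (run t).1.arm| ≤ p.err (run t).1.stage := by
        have hle := hplay.plays_le
        -- The visit occupies the block of rounds from `t - plays` to `t`. Its start depends on the
        -- rewards, which is why concentration on all blocks at once is required.
        have h6 := hgood (t - (run t).1.plays) (t + 1) (by omega) ht
        have h7 : ∑ r ∈ Finset.Ico (t - (run t).1.plays) (t + 1), (x r - mean (run r).1.arm) =
            (run t).2.1 + x t - ℓ * mean (run t).1.arm := by
          rw [Finset.sum_congr rfl fun r hr => by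
            rw [hplay.arm_eq r (Finset.mem_Ico.1 hr).1
              (Nat.lt_succ_iff.1 (Finset.mem_Ico.1 hr).2)],
            Finset.sum_sub_distrib, Finset.sum_Ico_succ_top (by omega), ← hplay.sum_eq,
            Finset.sum_const, Nat.card_Ico, nsmul_eq_mul,
            show t + 1 - (t - (run t).1.plays) = p.len (run t).1.stage by omega]
        rw [h7, show t + 1 - (t - (run t).1.plays) = p.len (run t).1.stage by omega] at h6
        have h8 : ((run t).2.1 + x t) / ℓ - mean (run t).1.arm =
            ((run t).2.1 + x t - ℓ * mean (run t).1.arm) / ℓ := by field_simp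
        rw [h8, abs_div, abs_of_pos hℓpos, div_le_iff₀ hℓpos]
        exact h6.trans (p.sqrt_le _)
      have hcard : ((run t).1.toVisit.card : ℝ) ≤ k := by
        exact_mod_cast (Finset.card_le_univ _).trans (Fintype.card_fin k).le
      have hlevel := isLevel_compareArm (p.err_nonneg _) (sub_nonneg.2 hcard) hest h3
      have hbest := best_mem_compareArm hest h3 hb h1
      have hans := isAnswer_compareArm (2 * p.err (run t).1.stage) (run t).1.leaders (run t).2.2
        (run t).1.arm (((run t).2.1 + x t) / ℓ)
      generalize compareArm (2 * p.err (run t).1.stage) (run t).1.leaders (run t).2.2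
        (run t).1.arm (((run t).2.1 + x t) / ℓ) = c at hans hsucc hlevel hbest
      have hcardE : (((run t).1.toVisit.erase (run t).1.arm).card : ℝ) =
          (run t).1.toVisit.card - 1 := by
        rw [Finset.card_erase_of_mem hplay.arm_mem, Nat.cast_sub]
        · simp
        · exact Finset.card_pos.2 ⟨_, hplay.arm_mem⟩
      have hlenq : (((run t).1.plays : ℝ) + 1) * p.gap (run t).1.stage ≤ p.reg := by
        have h9 := p.len_mul_gap_le _ h4
        rw [← hlen] at h9
        exact_mod_cast h9
      have hreg0 : 0 ≤ p.reg :=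
        le_trans (mul_nonneg (by positivity) (p.gap_nonneg (run t).1.stage)) hlenq
      have htotal : ∑ r ∈ Finset.range (t + 1), (mean b - mean (run r).1.arm) ≤
          ((m - (run t).1.stage) * k + (k - ((run t).1.toVisit.card - 1))) * p.reg := by
        rw [Finset.sum_range_succ]
        linarith
      by_cases hE : (run t).1.toVisit.erase (run t).1.arm = ∅
      · rw [hE, Finset.empty_union] at hbest
        have hst : (run (t + 1)).1.stage = q := by
          rw [hsucc]
          simp [advance, nextStage, hE, hq]
        have htv : (run (t + 1)).1.toVisit = c.1 := by
          rw [hsucc]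
          simp [advance, nextToVisit, hE]
        have hld : (run (t + 1)).1.leaders = ∅ := by
          rw [hsucc]
          simp [advance, nextLeaders, hE]
        refine ⟨by rw [htv]; exact Finset.mem_union_left _ hbest, ?_, fun h => absurd hld h,
          by omega, ?_⟩
        · rw [htv, hld, Finset.union_empty, hst]
          intro a ha
          -- The best arm is at most `M + e`. A survivor is at least `M - 2 * k * e - e`, with one
          -- width for each of at most `k` comparisons. The difference is `(2 * k + 2) * e`.
          refine le_trans ?_ (p.err_le_gap q)
          rw [hq] at hlevel
          have h10 := hlevel.le b hbest
          have h11 := hlevel.ge a ha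
          have h12 : ((k : ℝ) - (run t).1.toVisit.card + 1) * (2 * p.err (q + 1)) ≤
              k * (2 * p.err (q + 1)) := by
            have : (1 : ℝ) ≤ (run t).1.toVisit.card := by
              exact_mod_cast Finset.card_pos.2 ⟨_, hplay.arm_mem⟩
            have h13 := p.err_nonneg (q + 1)
            gcongr
            linarith
          linarith
        · refine htotal.trans ?_
          rw [hst, htv, show (run (t + 1)).1.plays = 0 by rw [hsucc]; rfl]
          rw [hE, Finset.card_empty, Nat.cast_zero] at hcardE
          rw [← hcardE, hq]
          have hcc : (c.1.card : ℝ) ≤ k := by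
            exact_mod_cast (Finset.card_le_univ _).trans (Fintype.card_fin k).le
          push_cast
          have := mul_nonneg (sub_nonneg.2 hcc) hreg0
          linarith
      · have hst : (run (t + 1)).1.stage = (run t).1.stage := by
          rw [hsucc]
          simp [advance, nextStage, hE, hq]
        have htv : (run (t + 1)).1.toVisit = (run t).1.toVisit.erase (run t).1.arm := by
          rw [hsucc]
          simp [advance, nextToVisit, hE]
        have hld : (run (t + 1)).1.leaders = c.1 := by
          rw [hsucc]
          simp [advance, nextLeaders, hE]
        have hM : (run (t + 1)).2.2 = c.2 := by rw [hsucc]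
        refine ⟨by rw [htv, hld]; exact hbest, ?_, fun _ => ?_, by omega, ?_⟩
        · rw [htv, hld, hst]
          intro a ha
          refine h2 a ?_
          rcases Finset.mem_union.1 ha with ha | ha
          · exact Finset.mem_union_left _ (Finset.mem_of_mem_erase ha)
          · rcases Finset.mem_insert.1 (hans.subset ha) with rfl | ha
            · exact Finset.mem_union_left _ hplay.arm_mem
            · exact Finset.mem_union_right _ ha
        · rw [htv, hld, hst, hM, hcardE]
          convert hlevel using 1
          ring
        · refine htotal.trans ?_
          rw [hst, htv, hcardE, show (run (t + 1)).1.plays = 0 by rw [hsucc]; rfl]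
          simp

theorem isBudgeted_eliminationPolicy [NeZero k] {len : ℕ → ℕ} (hlen : ∀ q, 1 ≤ len q)
    (e : ℕ → ℝ) {m : ℕ} {i : Fin k} {S : ℝ≥0} (hS : G.gameValue m Finset.univ ∅ i ≤ S) (T : ℕ) :
    (G.eliminationPolicy len e m i).IsBudgeted G S T := by
  intro D
  filter_upwards [ae_histLaw_machinePolicy (eliminationInit m i) (G.eliminationNext len e)
    (fun s => s.1.arm) (G.measurable_eliminationNext len e) ((Measurable.of_discrete
      (f := fun s : EliminationState k => s.arm)).comp measurable_fst) D T] with h hh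
  rw [G.pathCost_eq_sum_range (fun t => (h t).1) (fun t => (extend h t).1) fun t => by simp]
  refine le_trans ?_ ((G.playInvariant len hlen e m i (fun s => (extend h s).2)
    (T - 1)).cost_le.trans hS)
  refine le_trans (le_of_eq ?_) le_self_add
  refine Finset.sum_congr rfl fun t ht => ?_
  rw [Finset.mem_range] at ht
  rw [hh t (by omega), hh (t + 1) (by omega)]
  rfl

/-- The summand `k` allows for the visits already made in an unfinished stage, and `1` for the
current visit. The last term is the union bound over all blocks. -/
theorem regretIn_eliminationPolicy_le [NeZero k] {m T : ℕ} (p : EliminationParameters k m T)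
    (i : Fin k) (D : Environment k) :
    (G.eliminationPolicy p.len p.err m i).regretIn D T ≤
      (m * k + k + 1) * p.reg + T * (T ^ 2 * (2 * Real.exp (-p.conf))) := by
  have hreg0 : 0 ≤ p.reg :=
    le_trans (mul_nonneg (by positivity) (p.gap_nonneg m)) (p.len_mul_gap_le m le_rfl)
  refine Policy.regretIn_le _ D (by positivity) (by positivity)
    (Policy.measure_exists_block_le _ D T p.conf_nonneg) ?_
  filter_upwards [ae_histLaw_machinePolicy (eliminationInit m i) (G.eliminationNext p.len p.err)
    (fun s => s.1.arm) (G.measurable_eliminationNext p.len p.err) ((Measurable.of_discrete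
      (f := fun s : EliminationState k => s.arm)).comp measurable_fst) D T] with h hh hgood
  have hrun : ∀ t < T, (extend h t).1 =
      (G.eliminationRun p.len p.err m i (fun s => (extend h s).2) t).1.arm := hh
  simp only [not_exists, not_and, not_lt] at hgood
  obtain ⟨b, hb⟩ := D.exists_bestMean_eq
  have hbest : ∀ a, D.mean a ≤ D.mean b := fun a => hb ▸ D.mean_le_bestMean a
  have hb1 : ∀ a, D.mean b - D.mean a ≤ 1 := fun a => hb ▸ D.bestMean_sub_mean_le_one a
  have hinv := G.estimateInvariant p hbest hb1 i (fun s => (extend h s).2)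
    (fun s t hst htT => by
      refine (congrArg abs (Finset.sum_congr rfl fun r hr => ?_)).trans_le (hgood s t hst htT)
      rw [hrun r ((Finset.mem_Ico.1 hr).2.trans_le htT)]) T le_rfl
  have hplay := G.playInvariant p.len p.one_le_len p.err m i (fun s => (extend h s).2) T
  rw [← hb, Finset.sum_congr rfl fun r hr => by rw [hrun r (Finset.mem_range.1 hr)]]
  refine hinv.regret_le.trans ?_
  set s := (G.eliminationRun p.len p.err m i (fun s => (extend h s).2) T).1
  have hplays : (s.plays : ℝ) * p.gap s.stage ≤ p.reg := by
    refine le_trans ?_ (p.len_mul_gap_le _ hinv.stage_le)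
    have := p.gap_nonneg s.stage
    gcongr
    by_cases h0 : s.stage = 0
    · rw [h0]
      exact hplay.plays_le.trans p.le_len_zero
    · exact (hplay.plays_lt h0).le
  have h1 : ((m - s.stage : ℝ) * k + (k - s.toVisit.card)) * p.reg ≤ (m * k + k) * p.reg := by
    gcongr <;> simp
  linarith

end SwitchingGraph
end BwSC

namespace BwSC

variable {k : ℕ}

/-! ### Gaussian environments -/

theorem hasSubgaussianMGF_gaussianReal (m : ℝ) :
    HasSubgaussianMGF (fun x => x - m) 1 (gaussianReal m 1) := by
  have hmap : (gaussianReal m 1).map (fun x => x - m) = gaussianReal 0 1 := by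
    rw [gaussianReal_map_sub_const, sub_self]
  refine ⟨fun t => ?_, fun t => ?_⟩
  · have h := integrable_exp_mul_gaussianReal (μ := 0) (v := 1) t
    rw [← hmap] at h
    exact h.comp_measurable (by fun_prop)
  · rw [mgf_gaussianReal hmap]
    simp

/-- The environment with Gaussian rewards of variance `1`. -/
noncomputable def gaussianEnv (μ : Fin k → ℝ) (hμ : ∀ i j, |μ i - μ j| ≤ 1) : Environment k where
  law i := gaussianReal (μ i) 1
  isProb i := inferInstance
  subG i := by
    rw [integral_id_gaussianReal]
    exact hasSubgaussianMGF_gaussianReal (μ i)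
  gap_le i j := by
    rw [integral_id_gaussianReal, integral_id_gaussianReal]
    exact hμ i j

@[simp] theorem mean_gaussianEnv (μ : Fin k → ℝ) (hμ : ∀ i j, |μ i - μ j| ≤ 1) (i : Fin k) :
    (gaussianEnv μ hμ).mean i = μ i :=
  integral_id_gaussianReal

theorem gaussianReal_add_eq_withDensity (m δ : ℝ) :
    gaussianReal (m + δ) 1 = (gaussianReal m 1).withDensity
      (fun x => ENNReal.ofReal (Real.exp (δ * (x - m) - δ ^ 2 / 2))) := by
  rw [gaussianReal_of_var_ne_zero _ one_ne_zero, gaussianReal_of_var_ne_zero _ one_ne_zero,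
    ← withDensity_mul _ (measurable_gaussianPDF _ _) (by fun_prop)]
  congr 1
  ext x
  rw [Pi.mul_apply, gaussianPDF, gaussianPDF, ← ENNReal.ofReal_mul (gaussianPDFReal_nonneg _ _ _),
    gaussianPDFReal, gaussianPDFReal, mul_assoc (√(2 * Real.pi * (1 : ℝ≥0)))⁻¹, ← Real.exp_add]
  congr 3
  simp only [NNReal.coe_one]
  ring

/-- The number of plays of the arm `i` in the first `t` rounds. -/
def playCount (a : ℕ → Fin k) (i : Fin k) (t : ℕ) : ℕ := ((Finset.range t).filter (a · = i)).card

theorem playCount_succ (a : ℕ → Fin k) (i : Fin k) (t : ℕ) :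
    playCount a i (t + 1) = playCount a i t + if a t = i then 1 else 0 := by
  rw [playCount, playCount, Finset.range_add_one, Finset.filter_insert]
  split_ifs
  · rw [Finset.card_insert_of_notMem (by simp)]
  · rfl

theorem playCount_mono (a : ℕ → Fin k) (i : Fin k) : Monotone (playCount a i) := fun _ _ h =>
  Finset.card_le_card (Finset.filter_subset_filter _ (Finset.range_mono h))

theorem sum_playCount (a : ℕ → Fin k) (t : ℕ) : ∑ i, playCount a i t = t := by
  have := Finset.card_eq_sum_card_fiberwise (f := a) (s := Finset.range t) (t := Finset.univ)
    (fun _ _ => Finset.mem_coe.2 (Finset.mem_univ _))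
  rw [Finset.card_range] at this
  exact this.symm

theorem sum_ite_eq_playCount (a : ℕ → Fin k) (i : Fin k) (t : ℕ) (c : ℝ) :
    ∑ s ∈ Finset.range t, (if a s = i then c else 0) = playCount a i t * c := by
  rw [← Finset.sum_filter, Finset.sum_const, nsmul_eq_mul, playCount]

/-! ### Undetectable changes of one Gaussian mean. -/

namespace Policy

variable [NeZero k] (π : Policy k)

/-- The mean of an arm that is rarely played can be changed without a large effect on the
probabilities of events. -/
theorem histLaw_gaussianEnv_le {μ μ' : Fin k → ℝ} (hμ : ∀ i j, |μ i - μ j| ≤ 1)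
    (hμ' : ∀ i j, |μ' i - μ' j| ≤ 1) {i : Fin k} (hne : ∀ j, j ≠ i → μ' j = μ j)
    {t : ℕ} {n Λ : ℝ} (hn : 0 ≤ n) (hΛ : 1 ≤ Λ) (hδ : 8 * (μ' i - μ i) ^ 2 * n * Λ ≤ 1)
    {A : Set (History k t)} (hA : MeasurableSet A)
    (hcount : ∀ h ∈ A, (playCount (fun s => (extend h s).1) i t : ℝ) ≤ n) :
    π.histLaw (gaussianEnv μ hμ) t A ≤ ENNReal.ofReal (Real.exp 1) *
      π.histLaw (gaussianEnv μ' hμ') t A + ENNReal.ofReal (Real.exp (-Λ)) := by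
  set δ := μ' i - μ i with hδdef
  set D := gaussianEnv μ hμ with hD
  set D' := gaussianEnv μ' hμ' with hD'
  -- The logarithm of the likelihood ratio is `Z` minus `δ ^ 2 / 2` per play of `i`. On `good` it is
  -- at least `-1`, which gives the factor `e`.
  set Z : History k t → ℝ := fun h => ∑ s ∈ Finset.range t,
    (if (extend h s).1 = i then δ * ((extend h s).2 - μ i) else 0) with hZ
  set good : Set (History k t) := {h | -(1 / 2) ≤ Z h} with hgood
  let g : Fin k → ℝ → ℝ≥0∞ := fun a x =>
    ENNReal.ofReal (Real.exp (if a = i then δ * (x - μ i) - δ ^ 2 / 2 else 0))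
  have hg : ∀ a, Measurable (g a) := fun a => by
    by_cases h : a = i
    · simp only [g, h, if_true]
      fun_prop
    · simp only [g, h, if_false]
      fun_prop
  have hdens : ∀ a, D'.law a = (D.law a).withDensity (g a) := fun a => by
    by_cases h : a = i
    · subst h
      simp only [g, if_true]
      show gaussianReal (μ' a) 1 = (gaussianReal (μ a) 1).withDensity _
      rw [← gaussianReal_add_eq_withDensity, hδdef, add_sub_cancel]
    · simp only [g, h, if_false, Real.exp_zero, ENNReal.ofReal_one]
      show gaussianReal (μ' a) 1 = (gaussianReal (μ a) 1).withDensity _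
      rw [hne a h]
      exact withDensity_one.symm
  have hprod : ∀ h : History k t, ∏ s ∈ Finset.range t, g (extend h s).1 (extend h s).2 =
      ENNReal.ofReal (Real.exp (Z h - playCount (fun s => (extend h s).1) i t * (δ ^ 2 / 2))) := by
    intro h
    rw [← ENNReal.ofReal_prod_of_nonneg fun _ _ => (Real.exp_pos _).le, ← Real.exp_sum,
      ← sum_ite_eq_playCount, ← Finset.sum_sub_distrib]
    congr 2
    refine Finset.sum_congr rfl fun s _ => ?_
    split_ifs <;> simp
  have h1 : π.histLaw D t (A ∩ good) ≤ ENNReal.ofReal (Real.exp 1) * π.histLaw D' t A := by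
    have hA' : Measurable (A.indicator (1 : History k t → ℝ≥0∞)) := measurable_one.indicator hA
    rw [← lintegral_indicator_one hA, π.lintegral_histLaw_of_withDensity hg hdens t hA',
      ← lintegral_const_mul']
    swap
    · simp
    calc π.histLaw D t (A ∩ good) ≤ ∫⁻ h, (A ∩ good).indicator 1 h ∂(π.histLaw D t) := by
          refine le_of_eq ?_
          rw [lintegral_indicator_one]
          refine hA.inter (measurableSet_le measurable_const ?_)
          refine Finset.measurable_sum _ fun s _ => ?_
          have hs : Measurable fun h : History k t => extend h s :=
            (measurable_pi_apply s).comp measurable_extend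
          exact Measurable.ite (measurableSet_eq_fun (measurable_fst.comp hs) measurable_const)
            (((measurable_snd.comp hs).sub_const _).const_mul _) measurable_const
      _ ≤ _ := by
          refine lintegral_mono fun h => ?_
          by_cases hh : h ∈ A ∩ good
          · rw [Set.indicator_of_mem hh, Set.indicator_of_mem hh.1, hprod, Pi.one_apply, one_mul,
              ← ENNReal.ofReal_mul (Real.exp_pos _).le, ← Real.exp_add,
              ← ENNReal.ofReal_one]
            refine ENNReal.ofReal_le_ofReal (Real.one_le_exp ?_)
            have h3 := hcount h hh.1
            have h4 : -(1 / 2) ≤ Z h := hh.2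
            have h5 : (playCount (fun s => (extend h s).1) i t : ℝ) * (δ ^ 2 / 2) ≤
                n * (δ ^ 2 / 2) := by gcongr
            have h6 : 0 ≤ 8 * δ ^ 2 * n := by positivity
            nlinarith
          · rw [Set.indicator_of_notMem hh]
            exact zero_le
  have h2 : π.histLaw D t (A ∩ goodᶜ) ≤ ENNReal.ofReal (Real.exp (-Λ)) := by
    -- With weight `-4 * Λ * δ` the linear part exceeds `2 * Λ` off `good`, while the compensator `8
    -- * Λ ^ 2 * δ ^ 2 * n` is at most `Λ`.
    refine π.measure_exp_le D (fun _ a => if a = i then -(4 * Λ * δ) else 0) t Λ fun h hh => ?_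
    have h3 := hcount h hh.1
    have h4 : Z h < -(1 / 2) := not_le.1 hh.2
    have h5 : ∑ s ∈ Finset.range t, ((if (extend h s).1 = i then -(4 * Λ * δ) else 0) *
        ((extend h s).2 - D.mean (extend h s).1) -
        (if (extend h s).1 = i then -(4 * Λ * δ) else 0) ^ 2 / 2) =
        -(4 * Λ) * Z h - playCount (fun s => (extend h s).1) i t * (8 * Λ ^ 2 * δ ^ 2) := by
      rw [hZ, ← sum_ite_eq_playCount, Finset.mul_sum, ← Finset.sum_sub_distrib]
      refine Finset.sum_congr rfl fun s _ => ?_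
      split_ifs with hs
      · rw [hs, mean_gaussianEnv]
        ring
      · simp
    rw [h5]
    have h6 : (playCount (fun s => (extend h s).1) i t : ℝ) * (8 * Λ ^ 2 * δ ^ 2) ≤
        n * (8 * Λ ^ 2 * δ ^ 2) := by gcongr
    have h7 : n * (8 * Λ ^ 2 * δ ^ 2) ≤ Λ := by
      calc n * (8 * Λ ^ 2 * δ ^ 2) = Λ * (8 * δ ^ 2 * n * Λ) := by ring
        _ ≤ Λ * 1 := by gcongr
        _ = Λ := mul_one Λ
    nlinarith
  calc _ ≤ π.histLaw D t (A ∩ good ∪ A ∩ goodᶜ) := by rw [Set.inter_union_compl]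
    _ ≤ _ := measure_union_le _ _
    _ ≤ _ := add_le_add h1 h2

end Policy

/-! ### Milestones -/

/-- The list of the arms in the order in which they reach their milestones, newest first: the
milestone `j` of an arm is its `s j`-th play. -/
def milestones (s : ℕ → ℕ) (a : ℕ → Fin k) : ℕ → List (Fin k)
  | 0 => []
  | t + 1 =>
    if playCount a (a t) (t + 1) = s ((milestones s a t).count (a t)) then
      a t :: milestones s a t
    else milestones s a t

section Milestones

variable {s : ℕ → ℕ} {a : ℕ → Fin k}

theorem playCount_congr {a' : ℕ → Fin k} {t : ℕ} (h : ∀ r < t, a r = a' r) (i : Fin k) :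
    playCount a i t = playCount a' i t := by
  rw [playCount, playCount]
  congr 1
  refine Finset.filter_congr fun r hr => ?_
  rw [h r (Finset.mem_range.1 hr)]

theorem milestones_congr {a' : ℕ → Fin k} {t : ℕ} (h : ∀ r < t, a r = a' r) :
    milestones s a t = milestones s a' t := by
  induction t with
  | zero => rfl
  | succ t ih =>
    rw [milestones, milestones, ih fun r hr => h r (by omega), h t (by omega),
      playCount_congr h]

theorem playCount_lt (hs : StrictMono s) (h0 : s 0 = 1) (i : Fin k) (t : ℕ) :
    playCount a i t < s ((milestones s a t).count i) := by
  induction t with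
  | zero => simp [milestones, playCount, h0]
  | succ t ih =>
    rw [milestones]
    rcases eq_or_ne (a t) i with rfl | hi
    · split_ifs with h
      · rw [h, List.count_cons_self]
        exact hs (Nat.lt_succ_self _)
      · rw [playCount_succ, if_pos rfl] at h ⊢
        omega
    · rw [playCount_succ, if_neg hi]
      split_ifs
      · rwa [List.count_cons_of_ne hi]
      · exact ih

theorem le_playCount {i : Fin k} {t j : ℕ} (h : (milestones s a t).count i = j + 1) :
    s j ≤ playCount a i t := by
  induction t with
  | zero => simp [milestones] at h
  | succ t ih =>
    rw [milestones] at h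
    split_ifs at h with hc
    · rcases eq_or_ne (a t) i with rfl | hi
      · rw [List.count_cons_self, Nat.succ_inj] at h
        rw [hc, h]
      · rw [List.count_cons_of_ne hi] at h
        exact (ih h).trans (playCount_mono a i (Nat.le_succ t))
    · exact (ih h).trans (playCount_mono a i (Nat.le_succ t))

/-- At most one milestone is reached per round, so the list cannot change without passing through an
extension by one arm. -/
theorem exists_milestones_cons {t T : ℕ} (htT : t ≤ T)
    (hne : milestones s a T ≠ milestones s a t) :
    ∃ t' ≤ T, ∃ i, milestones s a t' = i :: milestones s a t := by
  induction T, htT using Nat.le_induction with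
  | base => exact absurd rfl hne
  | succ T hT ih =>
    by_cases h : milestones s a T = milestones s a t
    · rw [milestones] at hne
      split_ifs at hne with hc
      · exact ⟨T + 1, le_rfl, a T, by rw [milestones, if_pos hc, h]⟩
      · exact absurd h hne
    · obtain ⟨t', ht', i, hi⟩ := ih h
      exact ⟨t', by omega, i, hi⟩

/-- At the moment the list is extended, the arm `i` has just reached its milestone and no other arm
has reached its next one. These play counts bound the information available to the policy. -/
theorem playCount_le_of_first (hs : StrictMono s) (h0 : s 0 = 1) {i : Fin k} {ℓ : List (Fin k)}
    {t : ℕ} (ht : milestones s a t = i :: ℓ) (hfirst : ∀ t' < t, milestones s a t' ≠ i :: ℓ)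
    (j : Fin k) : playCount a j t ≤ s (ℓ.count j) := by
  obtain _ | t := t
  · simp [milestones] at ht
  have hne := hfirst t (Nat.lt_succ_self t)
  have hlt := playCount_lt (a := a) hs h0 j (t + 1)
  rw [milestones] at ht
  split_ifs at ht with hc
  · obtain ⟨rfl, rfl⟩ := List.cons.inj ht
    rcases eq_or_ne (a t) j with rfl | hj
    · exact hc.le
    · rw [milestones, if_pos hc, List.count_cons_of_ne hj] at hlt
      exact hlt.le
  · exact absurd ht hne

/-- The milestone walk takes shortcuts through the sequence of actions. The term `cost v (a t)` is
the debt from the newest milestone to the current action, carried along by the triangle inequality.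
-/
theorem walkCost_milestones_le (G : SwitchingGraph k) (h0 : s 0 = 1) (t : ℕ) :
    ∃ v ℓ, milestones s a (t + 1) = v :: ℓ ∧ G.walkCost (v :: ℓ) + G.cost v (a t) ≤
      ∑ r ∈ Finset.range t, G.cost (a r) (a (r + 1)) := by
  induction t with
  | zero =>
    refine ⟨a 0, [], ?_, by simp [G.cost_self]⟩
    rw [milestones, if_pos]
    · rfl
    · rw [playCount_succ, if_pos rfl]
      simp [milestones, h0, playCount]
  | succ t ih =>
    obtain ⟨v, ℓ, hv, hle⟩ := ih
    have htri : G.walkCost (v :: ℓ) + G.cost v (a (t + 1)) ≤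
        ∑ r ∈ Finset.range (t + 1), G.cost (a r) (a (r + 1)) := by
      rw [Finset.sum_range_succ]
      calc _ ≤ G.walkCost (v :: ℓ) + (G.cost v (a t) + G.cost (a t) (a (t + 1))) := by
            gcongr
            exact G.cost_triangle _ _ _
        _ ≤ _ := by
            rw [← add_assoc]
            gcongr
    rw [milestones, hv]
    split_ifs
    · refine ⟨_, _, rfl, ?_⟩
      rw [G.walkCost_cons_cons, G.cost_self, add_zero, add_comm]
      exact htri
    · exact ⟨v, ℓ, rfl, htri⟩

theorem walkCost_le_of_milestones (G : SwitchingGraph k) (h0 : s 0 = 1) {t T : ℕ} (htT : t ≤ T)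
    {ℓ : List (Fin k)} (hℓ : milestones s a t = ℓ) :
    G.walkCost ℓ ≤ ∑ r ∈ Finset.range (T - 1), G.cost (a r) (a (r + 1)) := by
  obtain _ | t := t
  · rw [← hℓ]
    simp [milestones]
  · obtain ⟨v, ℓ', hv, hle⟩ := walkCost_milestones_le (a := a) G h0 t
    rw [← hℓ, hv]
    refine le_self_add.trans (hle.trans (Finset.sum_le_sum_of_subset ?_))
    exact Finset.range_mono (by omega)

end Milestones

/-! ### Milestone events and their probabilities. -/

/-- The event that at some time up to `T` the list of milestones is `ℓ`. -/
def milestoneEvent (s : ℕ → ℕ) (ℓ : List (Fin k)) (T : ℕ) : Set (ℕ → Fin k × ℝ) :=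
  {ω | ∃ t ≤ T, milestones s (fun r => (ω r).1) t = ℓ}

/-- The event that `t` is the first time at which the list of milestones is `ℓ`. -/
def firstMilestoneEvent (s : ℕ → ℕ) (ℓ : List (Fin k)) (t : ℕ) : Set (ℕ → Fin k × ℝ) :=
  {ω | milestones s (fun r => (ω r).1) t = ℓ ∧
    ∀ t' < t, milestones s (fun r => (ω r).1) t' ≠ ℓ}

theorem measurableSet_of_actions [NeZero k] (t : ℕ) {Φ : (ℕ → Fin k) → Prop}
    (hΦ : ∀ a a' : ℕ → Fin k, (∀ r < t, a r = a' r) → (Φ a ↔ Φ a')) :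
    MeasurableSet {ω : ℕ → Fin k × ℝ | Φ fun r => (ω r).1} := by
  let Ψ : Set (Fin t → Fin k) := {w | Φ fun r => if hr : r < t then w ⟨r, hr⟩ else 0}
  have hmeas : Measurable fun (ω : ℕ → Fin k × ℝ) (r : Fin t) => (ω r).1 := by fun_prop
  have : {ω : ℕ → Fin k × ℝ | Φ fun r => (ω r).1} =
      (fun (ω : ℕ → Fin k × ℝ) (r : Fin t) => (ω r).1) ⁻¹' Ψ := by
    ext ω
    exact hΦ _ _ fun r hr => by simp [hr]
  rw [this]
  exact hmeas (MeasurableSet.of_discrete)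

theorem firstMilestoneEvent_congr {s : ℕ → ℕ} {ℓ : List (Fin k)} {t : ℕ} {a a' : ℕ → Fin k}
    (h : ∀ r < t, a r = a' r) :
    (milestones s a t = ℓ ∧ ∀ t' < t, milestones s a t' ≠ ℓ) ↔
      (milestones s a' t = ℓ ∧ ∀ t' < t, milestones s a' t' ≠ ℓ) := by
  have : ∀ t' ≤ t, milestones s a t' = milestones s a' t' := fun t' ht' =>
    milestones_congr fun r hr => h r (by omega)
  rw [this t le_rfl]
  refine and_congr_right fun _ => forall₂_congr fun t' ht' => ?_
  rw [this t' ht'.le]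

theorem measurableSet_firstMilestoneEvent [NeZero k] (s : ℕ → ℕ) (ℓ : List (Fin k)) (t : ℕ) :
    MeasurableSet (firstMilestoneEvent s ℓ t) :=
  measurableSet_of_actions t fun _ _ h => firstMilestoneEvent_congr h

theorem milestoneEvent_eq_iUnion (s : ℕ → ℕ) (ℓ : List (Fin k)) (T : ℕ) :
    milestoneEvent s ℓ T = ⋃ t ∈ Finset.range (T + 1), firstMilestoneEvent s ℓ t := by
  classical
  ext ω
  simp only [milestoneEvent, firstMilestoneEvent, Set.mem_iUnion, Finset.mem_range,
    Set.mem_ofPred_eq]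
  constructor
  · rintro ⟨t, ht, h⟩
    have hex : ∃ t, milestones s (fun r => (ω r).1) t = ℓ := ⟨t, h⟩
    exact ⟨Nat.find hex, Nat.lt_succ_of_le ((Nat.find_min' hex h).trans ht), Nat.find_spec hex,
      fun t' ht' => Nat.find_min hex ht'⟩
  · rintro ⟨t, ht, h, -⟩
    exact ⟨t, by omega, h⟩

theorem measurableSet_milestoneEvent [NeZero k] (s : ℕ → ℕ) (ℓ : List (Fin k)) (T : ℕ) :
    MeasurableSet (milestoneEvent s ℓ T) := by
  rw [milestoneEvent_eq_iUnion]
  exact Finset.measurableSet_biUnion _ fun t _ => measurableSet_firstMilestoneEvent s ℓ t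

theorem disjoint_firstMilestoneEvent (s : ℕ → ℕ) (ℓ : List (Fin k)) {t t' : ℕ} (h : t ≠ t') :
    Disjoint (firstMilestoneEvent s ℓ t) (firstMilestoneEvent s ℓ t') := by
  rw [Set.disjoint_left]
  rintro ω ⟨h1, h2⟩ ⟨h3, h4⟩
  rcases lt_or_gt_of_ne h with h | h
  · exact h4 t h h1
  · exact h2 t' h h3

namespace Policy

variable [NeZero k] (π : Policy k)

/-- Decomposition by the first time the list is reached. Each piece is measured at that time, when
play counts are still controlled; at the horizon they are not. -/
theorem histLaw_milestoneEvent (D : Environment k) (s : ℕ → ℕ) (ℓ : List (Fin k)) (T : ℕ) :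
    π.histLaw D T (extend ⁻¹' milestoneEvent s ℓ T) =
      ∑ t ∈ Finset.range (T + 1), π.histLaw D t (extend ⁻¹' firstMilestoneEvent s ℓ t) := by
  rw [milestoneEvent_eq_iUnion, Set.preimage_iUnion₂, measure_biUnion_finset]
  · refine Finset.sum_congr rfl fun t ht => ?_
    rw [Finset.mem_range] at ht
    refine π.histLaw_extend_preimage D (by omega) (measurableSet_firstMilestoneEvent s ℓ t) ?_
    exact fun ω ω' h => firstMilestoneEvent_congr fun r hr => by rw [h r hr]
  · exact fun t _ t' _ h => (disjoint_firstMilestoneEvent s ℓ h).preimage _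
  · exact fun t _ => measurable_extend (measurableSet_firstMilestoneEvent s ℓ t)

/-- Change of the mean of one arm in the probability of reaching a milestone. -/
theorem real_milestoneEvent_le {μ μ' : Fin k → ℝ} (hμ : ∀ i j, |μ i - μ j| ≤ 1)
    (hμ' : ∀ i j, |μ' i - μ' j| ≤ 1) {j : Fin k} (hne : ∀ j', j' ≠ j → μ' j' = μ j')
    {s : ℕ → ℕ} (hs : StrictMono s) (h0 : s 0 = 1) {Λ : ℝ} (hΛ : 1 ≤ Λ) {i : Fin k}
    {ℓ : List (Fin k)} (hδ : 8 * (μ' j - μ j) ^ 2 * s (ℓ.count j) * Λ ≤ 1) (T : ℕ) :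
    (π.histLaw (gaussianEnv μ hμ) T).real (extend ⁻¹' milestoneEvent s (i :: ℓ) T) ≤
      3 * (π.histLaw (gaussianEnv μ' hμ') T).real (extend ⁻¹' milestoneEvent s (i :: ℓ) T) +
        (T + 1) * Real.exp (-Λ) := by
  have key : π.histLaw (gaussianEnv μ hμ) T (extend ⁻¹' milestoneEvent s (i :: ℓ) T) ≤
      ENNReal.ofReal (Real.exp 1) *
        π.histLaw (gaussianEnv μ' hμ') T (extend ⁻¹' milestoneEvent s (i :: ℓ) T) +
        (T + 1) * ENNReal.ofReal (Real.exp (-Λ)) := by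
    rw [histLaw_milestoneEvent, histLaw_milestoneEvent]
    calc _ ≤ ∑ t ∈ Finset.range (T + 1), (ENNReal.ofReal (Real.exp 1) *
          π.histLaw (gaussianEnv μ' hμ') t (extend ⁻¹' firstMilestoneEvent s (i :: ℓ) t) +
          ENNReal.ofReal (Real.exp (-Λ))) := by
          refine Finset.sum_le_sum fun t _ => ?_
          refine π.histLaw_gaussianEnv_le hμ hμ' hne (Nat.cast_nonneg _) hΛ hδ
            (measurable_extend (measurableSet_firstMilestoneEvent s _ t)) ?_
          rintro h ⟨h1, h2⟩
          exact_mod_cast playCount_le_of_first hs h0 h1 h2 j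
      _ = _ := by
          rw [Finset.sum_add_distrib, Finset.mul_sum, Finset.sum_const, Finset.card_range,
            nsmul_eq_mul]
          push_cast
          rfl
  have h3 := ENNReal.toReal_mono (by finiteness) key
  rw [ENNReal.toReal_add (by finiteness) (by finiteness), ENNReal.toReal_mul, ENNReal.toReal_mul,
    ENNReal.toReal_ofReal (Real.exp_pos _).le, ENNReal.toReal_ofReal (Real.exp_pos _).le] at h3
  have h4 : ((T : ℝ≥0∞) + 1).toReal = T + 1 := by
    rw [ENNReal.toReal_add (by simp) (by simp)]
    simp
  rw [h4] at h3
  refine h3.trans ?_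
  have : Real.exp 1 ≤ 3 := Real.exp_one_lt_d9.le.trans (by norm_num)
  simp only [Measure.real]
  gcongr

/-- On this event the arm `i` has been played at least `s (ℓ.count i)` times, each at a cost of at
least `gap`. -/
theorem le_regretIn_of_milestoneEvent (D : Environment k) {s : ℕ → ℕ} {ℓ : List (Fin k)}
    {i : Fin k} {T : ℕ} {gap : ℝ} (hgap : 0 ≤ gap) (hi : gap ≤ D.bestMean - D.mean i) :
    (π.histLaw D T).real (extend ⁻¹' milestoneEvent s (i :: ℓ) T) * (s (ℓ.count i) * gap) ≤
      π.regretIn D T := by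
  refine π.le_regretIn D (measurable_extend (measurableSet_milestoneEvent s _ T)) ?_
  rintro h ⟨t, ht, hm⟩
  have h1 : s (ℓ.count i) ≤ playCount (fun r => (extend h r).1) i T := by
    refine le_trans (le_playCount ?_) (playCount_mono _ i ht)
    rw [hm, List.count_cons_self]
  calc (s (ℓ.count i) : ℝ) * gap ≤ playCount (fun r => (extend h r).1) i T * gap := by gcongr
    _ = ∑ r ∈ Finset.range T, if (extend h r).1 = i then gap else 0 :=
        (sum_ite_eq_playCount _ i T gap).symm
    _ ≤ _ := by
        refine Finset.sum_le_sum fun r _ => ?_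
        split_ifs with hr
        · rw [hr]
          exact hi
        · exact sub_nonneg.2 (D.mean_le_bestMean _)

end Policy

end BwSC

namespace BwSC

variable {k : ℕ}

/-! ### The adversary -/

/-- Parameters of the adversary in the elimination game with `m` stages: the numbers of plays at the
milestones, the differences of the means in each stage, a bound for these differences, the
confidence parameter and the regret that is enforced. -/
structure AdversaryParameters (k m T : ℕ) where
  count : ℕ → ℕ
  diff : ℕ → ℝ
  bound : ℝ
  conf : ℝ
  reg : ℝ
  strictMono_count : StrictMono count
  count_zero : count 0 = 1
  mul_count_le : k * count m ≤ T
  diff_nonneg : ∀ j, 0 ≤ diff j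
  diff_le : ∀ j, diff j ≤ bound
  bound_le : (m * k + k + 1) * bound ≤ 1
  one_le_conf : 1 ≤ conf
  conf_le : ∀ j < m, 8 * (k * diff j) ^ 2 * count j * conf ≤ 1
  reg_nonneg : 0 ≤ reg
  reg_le : ∀ j < m, reg ≤ count (j + 1) * diff j
  exp_le : 2 * k * ((T + 1) * Real.exp (-conf)) ≤ (1 / (6 * k : ℝ)) ^ (m * k + k)

/-- A position in the elimination game after the milestones `ℓ`, with `q` remaining stages and means
`μ` of the arms: `u` is the mean of the arms `B` that are yet to be compared in the current stage,
and the leading arms exceed it by `h` times the difference of the stage. -/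
structure ChainNode {m T : ℕ} (p : AdversaryParameters k m T) (G : SwitchingGraph k) (S : ℝ≥0)
    (q : ℕ) (B C : Finset (Fin k)) (ℓ : List (Fin k)) (μ : Fin k → ℝ) (u : ℝ) (h : ℕ) : Prop where
  stage_le : q ≤ m
  nonempty : B.Nonempty
  disjoint : Disjoint B C
  leaders_eq : q = 0 → C = ∅
  eq_zero : C = ∅ → h = 0
  add_card_le : h + B.card ≤ k
  count_toVisit : ∀ i ∈ B, ℓ.count i = m - q
  count_leaders : ∀ i ∈ C, ℓ.count i = m - q + 1
  mean_toVisit : ∀ i ∈ B, μ i = u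
  mean_leaders : ∀ i ∈ C, μ i = u + h * p.diff (m - q)
  -- Here `d` is the stage in which `i` lost. A further milestone of `i` therefore costs `count (d +
  -- 1) * diff d`.
  beaten : ∀ i, i ∉ B → i ∉ C → ∃ d < m, ℓ.count i = d + 1 ∧
    μ i ≤ u + h * p.diff (m - q) - p.diff d
  nonneg : 0 ≤ u
  top_le : u + h * p.diff (m - q) ≤ ((m - q : ℕ) * k + h) * p.bound
  le_mean : ∀ i, -p.bound ≤ μ i
  mean_le : ∀ i, μ i ≤ u + h * p.diff (m - q)
  budget : ∀ i ∈ B, S < G.walkCost (i :: ℓ) + G.gameValue q B C i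

namespace ChainNode

variable {m T : ℕ} {p : AdversaryParameters k m T} {G : SwitchingGraph k} {S : ℝ≥0} {q : ℕ}
  {B C : Finset (Fin k)} {ℓ : List (Fin k)} {μ : Fin k → ℝ} {u : ℝ} {h : ℕ}

theorem _root_.BwSC.AdversaryParameters.bound_nonneg (p : AdversaryParameters k m T) :
    0 ≤ p.bound :=
  (p.diff_nonneg 0).trans (p.diff_le 0)

theorem top_le_bound (nd : ChainNode p G S q B C ℓ μ u h) :
    u + h * p.diff (m - q) ≤ (m * k + k) * p.bound := by
  refine nd.top_le.trans ?_
  have h1 : ((m - q : ℕ) : ℝ) ≤ m := by exact_mod_cast Nat.sub_le m q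
  have h2 : (h : ℝ) ≤ k := by exact_mod_cast (Nat.le_add_right _ _).trans nd.add_card_le
  have := p.bound_nonneg
  gcongr

theorem abs_sub_le_one_of_bounds (p : AdversaryParameters k m T) {ν : Fin k → ℝ}
    (h1 : ∀ i, -p.bound ≤ ν i) (h2 : ∀ i, ν i ≤ (m * k + k) * p.bound) (i j : Fin k) :
    |ν i - ν j| ≤ 1 := by
  have h3 := p.bound_le
  rw [abs_le]
  constructor <;> linarith [h1 i, h1 j, h2 i, h2 j]

theorem abs_sub_le_one (nd : ChainNode p G S q B C ℓ μ u h) (i j : Fin k) : |μ i - μ j| ≤ 1 :=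
  abs_sub_le_one_of_bounds p nd.le_mean (fun i => (nd.mean_le i).trans nd.top_le_bound) i j

theorem exists_mean_eq_top (nd : ChainNode p G S q B C ℓ μ u h) :
    ∃ b, μ b = u + h * p.diff (m - q) := by
  rcases C.eq_empty_or_nonempty with hC | ⟨c, hc⟩
  · obtain ⟨b, hb⟩ := nd.nonempty
    exact ⟨b, by rw [nd.mean_toVisit b hb, nd.eq_zero hC]; simp⟩
  · exact ⟨c, nd.mean_leaders c hc⟩

/-- The transition to the next node after a comparison, once the new mean `v` of the arm `i` and the
new height `h'` of the leading arms are known to fit the answer `C'`. -/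
theorem next_of_mean (nd : ChainNode p G S (q + 1) B C ℓ μ u h) {i : Fin k} (hi : i ∈ B)
    {C' : Finset (Fin k)} (hans : SwitchingGraph.IsAnswer C i C')
    (hbudget : ∀ j ∈ SwitchingGraph.nextToVisit B C' i, S < G.walkCost (i :: ℓ) + G.cost i j +
      G.gameValue (SwitchingGraph.nextStage q B i) (SwitchingGraph.nextToVisit B C' i)
        (SwitchingGraph.nextLeaders B C' i) j)
    {v : ℝ} {h' : ℕ} (hh : h ≤ h') (hh' : h' ≤ h + 1)
    (hC' : ∀ c ∈ C', Function.update μ i v c = u + h' * p.diff (m - (q + 1)))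
    (hbeaten : ∀ c, (c ∈ C ∨ c = i) → c ∉ C' →
      Function.update μ i v c ≤ u + h' * p.diff (m - (q + 1)) - p.diff (m - (q + 1)))
    (hv : -p.bound ≤ v) (hv' : v ≤ u + h' * p.diff (m - (q + 1))) :
    ∃ u' h'', ChainNode p G S (SwitchingGraph.nextStage q B i) (SwitchingGraph.nextToVisit B C' i)
      (SwitchingGraph.nextLeaders B C' i) (i :: ℓ) (Function.update μ i v) u' h'' := by
  set j₀ := m - (q + 1) with hj₀
  have hqm := nd.stage_le
  have hdiff := p.diff_nonneg j₀
  have htop : u + h * p.diff j₀ ≤ u + h' * p.diff j₀ := by gcongr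
  have hcardB : (B.erase i).card + 1 = B.card := Finset.card_erase_add_one hi
  have hadd := nd.add_card_le
  have htop' : u + h' * p.diff j₀ ≤ (j₀ * k + h') * p.bound := by
    have h1 := nd.top_le
    rw [← hj₀] at h1
    obtain rfl | rfl : h' = h ∨ h' = h + 1 := by omega
    · exact h1
    · push_cast
      have := p.diff_le j₀
      linarith
  have hiC : i ∉ C := Finset.disjoint_left.1 nd.disjoint hi
  have hcountC : ∀ c ∈ C', (i :: ℓ).count c = j₀ + 1 := fun c hc => by
    rcases Finset.mem_insert.1 (hans.subset hc) with rfl | hcC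
    · rw [List.count_cons_self, nd.count_toVisit c hi]
    · rw [List.count_cons_of_ne (ne_of_mem_of_not_mem hcC hiC).symm, nd.count_leaders c hcC]
  have hcountB : ∀ j ∈ B.erase i, (i :: ℓ).count j = j₀ := fun j hj => by
    rw [List.count_cons_of_ne (Finset.ne_of_mem_erase hj).symm,
      nd.count_toVisit j (Finset.mem_of_mem_erase hj)]
  have hmeanB : ∀ j ∈ B.erase i, Function.update μ i v j = u := fun j hj => by
    rw [Function.update_of_ne (Finset.ne_of_mem_erase hj),
      nd.mean_toVisit j (Finset.mem_of_mem_erase hj)]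
  have hbeaten' : ∀ j, j ∉ B.erase i → j ∉ C' → ∃ d < m, (i :: ℓ).count j = d + 1 ∧
      Function.update μ i v j ≤ u + h' * p.diff j₀ - p.diff d := by
    intro j hjB hjC'
    by_cases hjC : j ∈ C ∨ j = i
    · refine ⟨j₀, by omega, ?_, hbeaten j hjC hjC'⟩
      rcases hjC with hjC | rfl
      · rw [List.count_cons_of_ne (ne_of_mem_of_not_mem hjC hiC).symm, nd.count_leaders j hjC]
      · rw [List.count_cons_self, nd.count_toVisit j hi]
    · push Not at hjC
      obtain ⟨d, hd, h1, h2⟩ := nd.beaten j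
        (fun hj => hjB (Finset.mem_erase.2 ⟨hjC.2, hj⟩)) hjC.1
      refine ⟨d, hd, ?_, ?_⟩
      · rw [List.count_cons_of_ne hjC.2.symm, h1]
      · rw [Function.update_of_ne hjC.2]
        rw [← hj₀] at h2
        linarith
  have hle : ∀ j, -p.bound ≤ Function.update μ i v j := fun j => by
    rcases eq_or_ne j i with rfl | hj
    · rwa [Function.update_self]
    · rw [Function.update_of_ne hj]
      exact nd.le_mean j
  have hge : ∀ j, Function.update μ i v j ≤ u + h' * p.diff j₀ := fun j => by
    rcases eq_or_ne j i with rfl | hj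
    · rwa [Function.update_self]
    · rw [Function.update_of_ne hj]
      exact (nd.mean_le j).trans htop
  have hbudget' : ∀ j ∈ SwitchingGraph.nextToVisit B C' i, S < G.walkCost (j :: i :: ℓ) +
      G.gameValue (SwitchingGraph.nextStage q B i) (SwitchingGraph.nextToVisit B C' i)
        (SwitchingGraph.nextLeaders B C' i) j := fun j hj => by
    rw [G.walkCost_cons_cons, add_comm (G.cost i j)]
    exact hbudget j hj
  have hnonempty := SwitchingGraph.nextToVisit_nonempty (B := B) hans
  by_cases hE : B.erase i = ∅
  · have hstage : SwitchingGraph.nextStage q B i = q := by simp [SwitchingGraph.nextStage, hE]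
    have hvisit : SwitchingGraph.nextToVisit B C' i = C' := by
      simp [SwitchingGraph.nextToVisit, hE]
    have hlead : SwitchingGraph.nextLeaders B C' i = ∅ := by simp [SwitchingGraph.nextLeaders, hE]
    rw [hstage, hvisit, hlead] at hbudget' ⊢
    rw [hvisit] at hnonempty
    have hmq : m - q = j₀ + 1 := by omega
    have hcardC : C'.card ≤ k := (Finset.card_le_univ _).trans (Fintype.card_fin k).le
    -- At the end of a stage the leaders share the top mean; this becomes the base level of the next
    -- stage, with height `0`.
    refine ⟨u + h' * p.diff j₀, 0, by omega, hnonempty, Finset.disjoint_empty_right _,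
      fun _ => rfl, fun _ => rfl, by omega, fun c hc => by rw [hmq, hcountC c hc], by simp,
      hC', by simp, fun j hj _ => ?_, ?_, ?_, hle, fun j => by simpa using hge j, hbudget'⟩
    · simpa using hbeaten' j (by simp [hE]) hj
    · have := nd.nonneg
      positivity
    · rw [hmq]
      push_cast
      have : (h' : ℝ) ≤ k := by
        have : h' ≤ k := by omega
        exact_mod_cast this
      have h2 := mul_le_mul_of_nonneg_right this p.bound_nonneg
      linarith
  · have hstage : SwitchingGraph.nextStage q B i = q + 1 := by simp [SwitchingGraph.nextStage, hE]
    have hvisit : SwitchingGraph.nextToVisit B C' i = B.erase i := by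
      simp [SwitchingGraph.nextToVisit, hE]
    have hlead : SwitchingGraph.nextLeaders B C' i = C' := by simp [SwitchingGraph.nextLeaders, hE]
    rw [hstage, hvisit, hlead] at hbudget' ⊢
    rw [hvisit] at hnonempty
    refine ⟨u, h', hqm, hnonempty, ?_, fun h0 => absurd h0 (Nat.succ_ne_zero q),
      fun h0 => absurd h0 hans.nonempty.ne_empty, by omega, hcountB, hcountC, hmeanB, hC',
      hbeaten', nd.nonneg, htop', hle, hge, hbudget'⟩
    refine Finset.disjoint_left.2 fun j hj hjC' => ?_
    rcases Finset.mem_insert.1 (hans.subset hjC') with rfl | hjC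
    · exact Finset.notMem_erase j B hj
    · exact Finset.disjoint_left.1 nd.disjoint (Finset.mem_of_mem_erase hj) hjC

/-- The answer of the adversary to a legal move. -/
theorem exists_next (nd : ChainNode p G S (q + 1) B C ℓ μ u h) {i : Fin k} (hi : i ∈ B) :
    ∃ (B' C' : Finset (Fin k)) (q' : ℕ) (v u' : ℝ) (h' : ℕ),
      q' * k + B'.card < (q + 1) * k + B.card ∧
      |v - μ i| ≤ k * p.diff (m - (q + 1)) ∧
      ChainNode p G S q' B' C' (i :: ℓ) (Function.update μ i v) u' h' := by
  obtain ⟨C', hans, hbudget⟩ := G.exists_answer hi (nd.budget i hi)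
  have hcardB : (B.erase i).card + 1 = B.card := Finset.card_erase_add_one hi
  have hmeasure : SwitchingGraph.nextStage q B i * k + (SwitchingGraph.nextToVisit B C' i).card <
      (q + 1) * k + B.card := by
    unfold SwitchingGraph.nextStage SwitchingGraph.nextToVisit
    have hcardC : C'.card ≤ k := (Finset.card_le_univ _).trans (Fintype.card_fin k).le
    split_ifs
    · rw [Nat.succ_mul]
      omega
    · omega
  have hiC : i ∉ C := Finset.disjoint_left.1 nd.disjoint hi
  have hμi := nd.mean_toVisit i hi
  have hadd := nd.add_card_le
  have hdiff := p.diff_nonneg (m - (q + 1))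
  have hdiffle := p.diff_le (m - (q + 1))
  have hbound := p.bound_nonneg
  have hu := nd.nonneg
  have hhk : (h : ℝ) + 1 ≤ k := by
    have : h + 1 ≤ k := by omega
    exact_mod_cast this
  have h0 : (0 : ℝ) ≤ h := Nat.cast_nonneg h
  have hhd : 0 ≤ h * p.diff (m - (q + 1)) := by positivity
  have hkd : (h + 1) * p.diff (m - (q + 1)) ≤ k * p.diff (m - (q + 1)) := by gcongr
  have hCi : ∀ c ∈ C, c ≠ i := fun c hc => ne_of_mem_of_not_mem hc hiC
  -- The new mean of `i` equals the level of the leaders for a tie, lies one `diff` above it for a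
  -- win and one below it for a loss. All three are within `k * diff` of the old mean because `h + 1
  -- ≤ k`.
  have key : ∃ v u' h'', |v - μ i| ≤ k * p.diff (m - (q + 1)) ∧
      ChainNode p G S (SwitchingGraph.nextStage q B i) (SwitchingGraph.nextToVisit B C' i)
        (SwitchingGraph.nextLeaders B C' i) (i :: ℓ) (Function.update μ i v) u' h'' := by
    rcases id hans with rfl | rfl | ⟨rfl, hne⟩
    · obtain ⟨u', h'', hnd⟩ := nd.next_of_mean hi hans hbudget (v := u + h * p.diff (m - (q + 1)))
        le_rfl (Nat.le_succ h) (fun c hc => by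
          rcases eq_or_ne c i with rfl | hci
          · rw [Function.update_self]
          · rw [Function.update_of_ne hci,
              nd.mean_leaders c (Finset.mem_of_mem_insert_of_ne hc hci)])
        (fun c hc hc' => by
          rcases hc with hc | rfl
          · exact absurd (Finset.mem_insert_of_mem hc) hc'
          · exact absurd (Finset.mem_insert_self _ _) hc')
        (by linarith) le_rfl
      exact ⟨_, u', h'', by rw [hμi, abs_le]; constructor <;> linarith, hnd⟩
    · obtain ⟨u', h'', hnd⟩ := nd.next_of_mean hi hans hbudget
        (v := u + (h + 1 : ℕ) * p.diff (m - (q + 1)))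
        (Nat.le_succ h) le_rfl (fun c hc => by
          rw [Finset.mem_singleton.1 hc, Function.update_self])
        (fun c hc hc' => by
          rcases hc with hc | rfl
          · rw [Function.update_of_ne (hCi c hc), nd.mean_leaders c hc]
            push_cast
            linarith
          · exact absurd (Finset.mem_singleton_self _) hc')
        (by push_cast; linarith) le_rfl
      refine ⟨_, u', h'', ?_, hnd⟩
      rw [hμi, abs_le]
      push_cast
      constructor <;> linarith
    · obtain ⟨u', h'', hnd⟩ := nd.next_of_mean hi hans hbudget
        (v := u + h * p.diff (m - (q + 1)) - p.diff (m - (q + 1)))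
        le_rfl (Nat.le_succ h) (fun c hc => by
          rw [Function.update_of_ne (hCi c hc), nd.mean_leaders c hc])
        (fun c hc hc' => by
          rcases hc with hc | rfl
          · exact absurd hc hc'
          · rw [Function.update_self])
        (by linarith) (by linarith)
      exact ⟨_, u', h'', by rw [hμi, abs_le]; constructor <;> linarith, hnd⟩
  obtain ⟨v, u', h'', hv, hnd⟩ := key
  exact ⟨_, _, _, v, u', h'', hmeasure, hv, hnd⟩

/-- From a position without a legal move within the budget, the adversary enforces regret. -/
theorem exists_le_regretIn [NeZero k] (π : Policy k) (hπ : π.IsBudgeted G S T) (n : ℕ)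
    (nd : ChainNode p G S q B C ℓ μ u h) (hn : q * k + B.card ≤ n) {P : ℝ}
    (hP : 2 * k * ((T + 1) * Real.exp (-p.conf)) ≤ P * (1 / (6 * k : ℝ)) ^ n)
    (hPℓ : P ≤ (π.histLaw (gaussianEnv μ nd.abs_sub_le_one) T).real
      (extend ⁻¹' milestoneEvent p.count ℓ T)) :
    ∃ D : Environment k, P * (1 / (6 * k : ℝ)) ^ n * p.reg ≤ π.regretIn D T := by
  have hk : (0 : ℝ) < k := by exact_mod_cast Nat.pos_of_ne_zero (NeZero.ne k)
  have hk1 : (1 : ℝ) ≤ k := by exact_mod_cast Nat.pos_of_ne_zero (NeZero.ne k)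
  induction n generalizing q B C ℓ μ u h P with
  | zero =>
    have := Finset.card_pos.2 nd.nonempty
    omega
  | succ n ih =>
    set D := gaussianEnv μ nd.abs_sub_le_one with hD
    set c : ℝ := 1 / (6 * k) with hc
    have hc0 : 0 < c := by positivity
    have hc1 : c ≤ 1 := by
      rw [hc, div_le_one (by positivity)]
      linarith
    have hP0 : 0 < P := by
      have h1 : 0 < P * c ^ (n + 1) := lt_of_lt_of_le (by positivity) hP
      exact pos_of_mul_pos_left h1 (by positivity)
    have hcn : c ^ (n + 1) ≤ c := by
      calc c ^ (n + 1) ≤ c ^ 1 := pow_le_pow_of_le_one hc0.le hc1 (by omega)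
        _ = c := pow_one c
    -- the next milestone
    have hcover : extend ⁻¹' milestoneEvent p.count ℓ T ⊆
        ⋃ i ∈ (Finset.univ : Finset (Fin k)),
          (extend (t := T) ⁻¹' milestoneEvent p.count (i :: ℓ) T) := by
      rintro ω ⟨t, ht, hω⟩
      simp only [Finset.mem_univ, Set.iUnion_true, Set.mem_iUnion]
      have hne : milestones p.count (fun r => (extend ω r).1) T ≠
          milestones p.count (fun r => (extend ω r).1) t := by
        intro heq
        rw [hω] at heq
        -- If no further milestone were reached, every arm would have fewer than `count m` plays;
        -- together these are fewer than `k * count m ≤ T` rounds.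
        have hlt : ∀ i, playCount (fun r => (extend ω r).1) i T < p.count m := fun i => by
          have h1 := playCount_lt (a := fun r => (extend ω r).1) p.strictMono_count p.count_zero i T
          rw [heq] at h1
          refine h1.trans_le (p.strictMono_count.monotone ?_)
          by_cases hiB : i ∈ B
          · rw [nd.count_toVisit i hiB]
            omega
          by_cases hiC : i ∈ C
          · rw [nd.count_leaders i hiC]
            have : q ≠ 0 := fun h0 => by
              rw [nd.leaders_eq h0] at hiC
              exact Finset.notMem_empty i hiC
            have := nd.stage_le
            omega
          · obtain ⟨d, hd, h2, -⟩ := nd.beaten i hiB hiC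
            omega
        have hsum := sum_playCount (fun r => (extend ω r).1) T
        have hne : (Finset.univ : Finset (Fin k)).Nonempty := Finset.univ_nonempty
        have := Finset.sum_lt_sum_of_nonempty hne fun i _ => hlt i
        rw [hsum, Finset.sum_const, Finset.card_univ, Fintype.card_fin, smul_eq_mul] at this
        exact this.not_ge p.mul_count_le
      obtain ⟨t', ht', i, hi⟩ := exists_milestones_cons ht hne
      exact ⟨i, t', ht', by rw [hi, hω]⟩
    obtain ⟨i, hPi⟩ : ∃ i, P / k ≤
        (π.histLaw D T).real (extend ⁻¹' milestoneEvent p.count (i :: ℓ) T) := by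
      by_contra! hcon
      have h1 := (measureReal_mono hcover (measure_ne_top _ _)).trans
        (measureReal_biUnion_finset_le (μ := π.histLaw D T) Finset.univ
          fun i => extend (t := T) ⁻¹' milestoneEvent p.count (i :: ℓ) T)
      have h2 := Finset.sum_lt_sum_of_nonempty (Finset.univ_nonempty (α := Fin k))
        fun i _ => hcon i
      rw [Finset.sum_const, Finset.card_univ, Fintype.card_fin, nsmul_eq_mul,
        mul_div_cancel₀ _ hk.ne'] at h2
      linarith
    -- a shift of the mean of one arm that is not yet compared
    have hshift : ∀ (j : Fin k) (v : ℝ), j ∈ B → q ≠ 0 →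
        |v - μ j| ≤ k * p.diff (m - q) →
        ∀ hμ' : ∀ a b, |Function.update μ j v a - Function.update μ j v b| ≤ 1,
        P * c ≤ (π.histLaw (gaussianEnv (Function.update μ j v) hμ') T).real
          (extend ⁻¹' milestoneEvent p.count (i :: ℓ) T) := by
      intro j v hj hq hv hμ'
      have hqm := nd.stage_le
      have h1 := π.real_milestoneEvent_le nd.abs_sub_le_one hμ' (j := j)
        (fun j' hj' => Function.update_of_ne hj' _ _) p.strictMono_count p.count_zero
        p.one_le_conf (i := i) (ℓ := ℓ) (by
          rw [Function.update_self, nd.count_toVisit j hj]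
          refine le_trans ?_ (p.conf_le (m - q) (by omega))
          have h2 : (v - μ j) ^ 2 ≤ (k * p.diff (m - q)) ^ 2 := by
            rw [← sq_abs (v - μ j)]
            gcongr
          have := p.one_le_conf
          gcongr) T
      rw [← hD] at h1
      have h3 : (T + 1) * Real.exp (-p.conf) ≤ P * (1 / (2 * k)) := by
        have h4 : 2 * k * ((T + 1) * Real.exp (-p.conf)) ≤ P := by
          refine hP.trans (mul_le_of_le_one_right hP0.le (hcn.trans hc1))
        rw [mul_one_div, le_div_iff₀ (by positivity)]
        linarith
      -- The source of `6 * k`: a factor `k` for the most likely next arm, `2` for absorbing the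
      -- error term, and `3 ≥ e` for the change of measure.
      have h5 : P * c = (P / k - P * (1 / (2 * k))) / 3 := by
        rw [hc]
        field_simp
        ring
      rw [h5, div_le_iff₀ (by norm_num)]
      linarith
    have hreg := p.reg_nonneg
    by_cases hiB : i ∈ B
    · obtain _ | q := q
      · -- the budget is exceeded
        exfalso
        have hb := hπ D
        have hzero : π.histLaw D T (extend ⁻¹' milestoneEvent p.count (i :: ℓ) T) = 0 := by
          refine measure_mono_null ?_ (ae_iff.1 hb)
          rintro ω ⟨t, ht, hω⟩
          have h1 := walkCost_le_of_milestones G p.count_zero ht hω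
          have h2 := nd.budget i hiB
          rw [G.gameValue_zero, add_zero] at h2
          rw [Set.mem_ofPred_eq, not_le,
            G.pathCost_eq_sum_range (fun t => (ω t).1) (fun t => (extend ω t).1) fun t => by simp]
          exact h2.trans_le h1
        rw [Measure.real, hzero, ENNReal.toReal_zero] at hPi
        have : 0 < P / k := by positivity
        linarith
      · obtain ⟨B', C', q', v, u', h', hmeas, hv, hnd⟩ := nd.exists_next hiB
        have h1 := hshift i v hiB (Nat.succ_ne_zero q) hv hnd.abs_sub_le_one
        obtain ⟨D', hD'⟩ := ih hnd (by omega) (P := P * c) (by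
          rw [mul_assoc P c, ← pow_succ']
          exact hP) h1
        exact ⟨D', by rwa [mul_assoc P c, ← pow_succ'] at hD'⟩
    · by_cases hiC : i ∈ C
      · -- an arm is played too often before another one is compared
        have hq : q ≠ 0 := fun h0 => by
          rw [nd.leaders_eq h0] at hiC
          exact Finset.notMem_empty i hiC
        have hqm := nd.stage_le
        obtain ⟨j, hj⟩ := nd.nonempty
        have hij : i ≠ j := fun h => hiB (h ▸ hj)
        have hdiff := p.diff_nonneg (m - q)
        have hdiffle := p.diff_le (m - q)
        have hcard := Finset.card_pos.2 nd.nonempty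
        have hadd := nd.add_card_le
        have hhk : (h : ℝ) + 1 ≤ k := by
          have : h + 1 ≤ k := by omega
          exact_mod_cast this
        have hu := nd.nonneg
        have hhd : 0 ≤ h * p.diff (m - q) := by positivity
        have hbound := p.bound_nonneg
        -- The uncompared arm `j` is secretly raised one `diff` above the leaders, so the surplus
        -- plays of the leader `i` become regret.
        set v := u + h * p.diff (m - q) + p.diff (m - q) with hv
        have hvtop : v ≤ (m * k + k) * p.bound := by
          have h1 := nd.top_le
          have h2 : ((m - q : ℕ) : ℝ) ≤ m := by exact_mod_cast Nat.sub_le m q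
          calc v ≤ ((m - q : ℕ) * k + h) * p.bound + p.bound := by linarith
            _ = ((m - q : ℕ) * k + (h + 1)) * p.bound := by ring
            _ ≤ _ := by gcongr
        have hμ' : ∀ a b, |Function.update μ j v a - Function.update μ j v b| ≤ 1 := by
          refine abs_sub_le_one_of_bounds p (fun a => ?_) fun a => ?_
          · rcases eq_or_ne a j with rfl | ha
            · rw [Function.update_self]
              linarith
            · rw [Function.update_of_ne ha]
              exact nd.le_mean a
          · rcases eq_or_ne a j with rfl | ha
            · rwa [Function.update_self]
            · rw [Function.update_of_ne ha]
              exact (nd.mean_le a).trans nd.top_le_bound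
        have h1 := hshift j v hj hq (by
          have : (h + 1) * p.diff (m - q) ≤ k * p.diff (m - q) := by gcongr
          rw [nd.mean_toVisit j hj, abs_le]
          constructor <;> linarith) hμ'
        refine ⟨gaussianEnv (Function.update μ j v) hμ', le_trans ?_
          (π.le_regretIn_of_milestoneEvent (gaussianEnv (Function.update μ j v) hμ')
            (s := p.count) (ℓ := ℓ) (i := i) hdiff ?_)⟩
        · rw [nd.count_leaders i hiC]
          have h2 := p.reg_le (m - q) (by omega)
          gcongr
          refine le_trans ?_ h1
          gcongr
        · have h3 := (gaussianEnv (Function.update μ j v) hμ').mean_le_bestMean j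
          rw [mean_gaussianEnv, Function.update_self] at h3
          rw [mean_gaussianEnv, Function.update_of_ne hij, nd.mean_leaders i hiC]
          linarith
      · -- an arm that is beaten is played too often
        obtain ⟨d, hd, hcount, hmean⟩ := nd.beaten i hiB hiC
        refine ⟨D, le_trans ?_ (π.le_regretIn_of_milestoneEvent D (s := p.count) (ℓ := ℓ) (i := i)
          (p.diff_nonneg d) ?_)⟩
        · rw [hcount]
          have h2 := p.reg_le d hd
          gcongr
          refine le_trans ?_ hPi
          rw [div_eq_mul_one_div]
          gcongr
          refine hcn.trans ?_
          rw [hc]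
          gcongr
          linarith
        · obtain ⟨b, hb⟩ := nd.exists_mean_eq_top
          have h3 := D.mean_le_bestMean b
          rw [hD, mean_gaussianEnv, hb] at h3
          rw [hD, mean_gaussianEnv]
          linarith

end ChainNode

/-- A policy whose budget does not suffice for `m` stages of the elimination game has large
regret. -/
theorem exists_le_regretIn_of_lt_threshold [NeZero k] {G : SwitchingGraph k} {S : ℝ≥0} {m T : ℕ}
    (p : AdversaryParameters k m T) (hS : S < G.threshold m) (π : Policy k)
    (hπ : π.IsBudgeted G S T) :
    ∃ D : Environment k, (1 / (6 * k : ℝ)) ^ (m * k + k) * p.reg ≤ π.regretIn D T := by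
  have nd : ChainNode p G S m Finset.univ ∅ [] (fun _ => 0) 0 0 :=
    ⟨le_rfl, Finset.univ_nonempty, Finset.disjoint_empty_right _, fun _ => rfl, fun _ => rfl,
      by simp, by simp, by simp, by simp, by simp, by simp, le_rfl, by simp,
      fun _ => by simpa using p.bound_nonneg, by simp, fun i _ => by
        simpa using hS.trans_le (iInf_le _ i)⟩
  obtain ⟨D, hD⟩ := nd.exists_le_regretIn π hπ (m * k + k) (by simp) (P := 1)
    (by rw [one_mul]; exact p.exp_le) (by
      have : extend ⁻¹' milestoneEvent p.count [] T = (Set.univ : Set (History k T)) :=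
        Set.eq_univ_of_forall fun ω => ⟨0, Nat.zero_le _, rfl⟩
      rw [this]
      simp)
  exact ⟨D, by simpa using hD⟩

/-- The regret of any policy is at least of order `√T`, up to logarithmic factors. -/
theorem exists_le_regretIn_of_two_le [NeZero k] (hk : 2 ≤ k) {T : ℕ} {Λ gap : ℝ} (hΛ : 1 ≤ Λ)
    (hexp : Real.exp (-Λ) ≤ 1 / 4) (hgap : 0 ≤ gap) (hgap1 : gap ≤ 1)
    (hδ : 8 * gap ^ 2 * (T / 2) * Λ ≤ 1) (π : Policy k) :
    ∃ D : Environment k, 1 / 12 * (T / 2 * gap) ≤ π.regretIn D T := by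
  have h0 : ∀ i j : Fin k, |(fun _ => (0 : ℝ)) i - (fun _ => (0 : ℝ)) j| ≤ 1 := by simp
  let A : Fin k → Set (ℕ → Fin k × ℝ) := fun i =>
    {ω | (playCount (fun r => (ω r).1) i T : ℝ) ≤ T / 2}
  have hA : ∀ i, MeasurableSet (A i) := fun i => measurableSet_of_actions T
    (Φ := fun a => (playCount a i T : ℝ) ≤ T / 2) fun a a' h => by rw [playCount_congr h]
  have hAe : ∀ i, MeasurableSet (extend (t := T) ⁻¹' A i) := fun i => measurable_extend (hA i)
  let i₀ : Fin k := ⟨0, by omega⟩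
  let i₁ : Fin k := ⟨1, by omega⟩
  have hne : i₀ ≠ i₁ := by simp [i₀, i₁]
  have hcover : (extend (t := T) ⁻¹' A i₀) ∪ (extend ⁻¹' A i₁) = Set.univ := by
    refine Set.eq_univ_of_forall fun ω => ?_
    by_contra hcon
    simp only [Set.mem_union, Set.mem_preimage, A, Set.mem_ofPred_eq, not_or, not_le] at hcon
    have h1 := sum_playCount (fun r => (extend ω r).1) T
    have h2 : playCount (fun r => (extend ω r).1) i₀ T + playCount (fun r => (extend ω r).1) i₁ T ≤
        T := by
      rw [← Finset.sum_pair (f := fun i => playCount (fun r => (extend ω r).1) i T) hne]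
      exact (Finset.sum_le_sum_of_subset (Finset.subset_univ _)).trans_eq h1
    have h3 : ((playCount (fun r => (extend ω r).1) i₀ T : ℝ) +
      playCount (fun r => (extend ω r).1) i₁ T) ≤ T := by exact_mod_cast h2
    linarith
  -- With all means zero, one of two arms is, with probability at least one half, played at most `T
  -- / 2` times. Raising its mean by `gap` goes unnoticed.
  obtain ⟨i, hi⟩ : ∃ i, 1 / 2 ≤ (π.histLaw (gaussianEnv _ h0) T).real (extend ⁻¹' A i) := by
    by_contra! hcon
    have h1 := measureReal_union_le (μ := π.histLaw (gaussianEnv _ h0) T)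
      (extend ⁻¹' A i₀) (extend ⁻¹' A i₁)
    rw [hcover, probReal_univ] at h1
    linarith [hcon i₀, hcon i₁]
  have h1 : ∀ a b, |Function.update (fun _ : Fin k => (0 : ℝ)) i gap a -
      Function.update (fun _ : Fin k => (0 : ℝ)) i gap b| ≤ 1 := fun a b => by
    simp only [Function.update_apply]
    split_ifs <;> simp [abs_of_nonneg hgap, hgap1]
  set D' := gaussianEnv _ h1 with hD'
  have hkey := π.histLaw_gaussianEnv_le h0 h1 (i := i)
    (fun j hj => Function.update_of_ne hj _ _) (n := T / 2) (by positivity) hΛ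
    (by simpa using hδ) (hAe i) (fun h hh => hh)
  have hkey' := ENNReal.toReal_mono (by finiteness) hkey
  rw [ENNReal.toReal_add (by finiteness) (by finiteness), ENNReal.toReal_mul,
    ENNReal.toReal_ofReal (Real.exp_pos _).le, ENNReal.toReal_ofReal (Real.exp_pos _).le] at hkey'
  rw [Measure.real] at hi
  have h3 : Real.exp 1 ≤ 3 := Real.exp_one_lt_d9.le.trans (by norm_num)
  have h4 : Real.exp 1 * (π.histLaw D' T (extend ⁻¹' A i)).toReal ≤
      3 * (π.histLaw D' T (extend ⁻¹' A i)).toReal := by gcongr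
  -- From `1 / 2 ≤ 3 * x + 1 / 4`.
  have h5 : 1 / 12 ≤ (π.histLaw D' T).real (extend ⁻¹' A i) := by
    rw [Measure.real]
    linarith
  refine ⟨D', le_trans ?_ (π.le_regretIn D' (hAe i) (r := T / 2 * gap) fun h hh => ?_)⟩
  · gcongr
  · have h6 : (playCount (fun r => (extend h r).1) i T : ℝ) ≤ T / 2 := hh
    have hb := D'.mean_le_bestMean i
    rw [hD', mean_gaussianEnv, Function.update_self] at hb
    calc T / 2 * gap ≤ (T - playCount (fun r => (extend h r).1) i T) * gap := by
          gcongr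
          linarith
      _ = ∑ r ∈ Finset.range T, (gap - if (extend h r).1 = i then gap else 0) := by
          rw [Finset.sum_sub_distrib, sum_ite_eq_playCount, Finset.sum_const, Finset.card_range,
            nsmul_eq_mul]
          ring
      _ ≤ _ := by
          refine Finset.sum_le_sum fun r _ => ?_
          rw [hD', mean_gaussianEnv]
          split_ifs with hr
          · rw [hr, Function.update_self]
            linarith
          · rw [Function.update_of_ne hr]
            linarith

end BwSC

namespace BwSC

variable {k : ℕ}

/-! ### Rates -/

/-- The exponents of the lengths of the stages. -/
noncomputable def stageExponent (m j : ℕ) : ℝ := (2 - 2 * ((2 : ℝ) ^ j)⁻¹) / (2 - ((2 : ℝ) ^ m)⁻¹)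

theorem inv_two_pow_le_one (m : ℕ) : ((2 : ℝ) ^ m)⁻¹ ≤ 1 :=
  inv_le_one_of_one_le₀ (one_le_pow₀ (by norm_num))

theorem two_sub_pos (m : ℕ) : (0 : ℝ) < 2 - ((2 : ℝ) ^ m)⁻¹ := by
  linarith [inv_two_pow_le_one m]

theorem rate_eq (m T : ℕ) : rate m T = (T : ℝ) ^ (1 / (2 - ((2 : ℝ) ^ m)⁻¹)) := by
  rw [rate, zpow_neg, zpow_natCast]

@[simp] theorem stageExponent_zero (m : ℕ) : stageExponent m 0 = 0 := by
  simp [stageExponent]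

theorem stageExponent_self_add_one (m : ℕ) : stageExponent m (m + 1) = 1 := by
  rw [stageExponent, div_eq_one_iff_eq (two_sub_pos m).ne', pow_succ, mul_inv]
  ring

/-- The recursion that balances the stages: the length `T ^ a_{j+1}` of a visit times the gap `T ^
(-a_j / 2)` left by the preceding stage is the same for all `j`. -/
theorem stageExponent_succ_sub (m j : ℕ) :
    stageExponent m (j + 1) - stageExponent m j / 2 = 1 / (2 - ((2 : ℝ) ^ m)⁻¹) := by
  have := (two_sub_pos m).ne'
  rw [stageExponent, stageExponent, pow_succ, mul_inv, div_div, mul_comm _ (2 : ℝ), ← div_div,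
    ← sub_div]
  congr 1
  ring

theorem stageExponent_nonneg (m j : ℕ) : 0 ≤ stageExponent m j :=
  div_nonneg (by linarith [inv_two_pow_le_one j]) (two_sub_pos m).le

theorem stageExponent_mono (m : ℕ) : Monotone (stageExponent m) := fun i j h => by
  have := two_sub_pos m
  unfold stageExponent
  gcongr
  norm_num

theorem rpow_stageExponent_mul {T : ℕ} (hT : 1 ≤ T) (m j : ℕ) :
    (T : ℝ) ^ stageExponent m (j + 1) * (T : ℝ) ^ (-(stageExponent m j / 2)) = rate m T := by
  rw [← Real.rpow_add (by exact_mod_cast hT), rate_eq, ← stageExponent_succ_sub m j, sub_eq_add_neg]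

theorem rate_pos {T : ℕ} (hT : 1 ≤ T) (m : ℕ) : 0 < rate m T :=
  Real.rpow_pos_of_pos (by exact_mod_cast hT) _

theorem one_le_rate {T : ℕ} (hT : 1 ≤ T) (m : ℕ) : 1 ≤ rate m T := by
  rw [rate_eq]
  exact Real.one_le_rpow (by exact_mod_cast hT) (one_div_pos.2 (two_sub_pos m)).le

theorem sqrt_le_rate {T : ℕ} (hT : 1 ≤ T) (m : ℕ) : √T ≤ rate m T := by
  rw [Real.sqrt_eq_rpow, rate_eq]
  refine Real.rpow_le_rpow_of_exponent_le (by exact_mod_cast hT) ?_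
  refine one_div_le_one_div_of_le (two_sub_pos m) ?_
  have : (0 : ℝ) < ((2 : ℝ) ^ m)⁻¹ := by positivity
  linarith

/-- After logarithmically many stages the rate is of order `√T`. -/
theorem rate_le_sqrt {T : ℕ} (hT : 1 ≤ T) {m : ℕ} (hm : Real.log T ≤ 2 ^ m) :
    rate m T ≤ 2 * √T := by
  have hT0 : (0 : ℝ) < T := by exact_mod_cast hT
  have h2 : (0 : ℝ) < 2 ^ m := by positivity
  set x : ℝ := ((2 : ℝ) ^ m)⁻¹ with hx
  have hx0 : 0 < x := by positivity
  have hx1 : x ≤ 1 := inv_two_pow_le_one m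
  have h1 : 1 / (2 - x) ≤ 1 / 2 + x / 2 := by
    rw [div_le_iff₀ (by linarith)]
    nlinarith
  calc rate m T ≤ (T : ℝ) ^ (1 / 2 + x / 2) := by
        rw [rate_eq]
        exact Real.rpow_le_rpow_of_exponent_le (by exact_mod_cast hT) h1
    _ = √T * Real.exp (Real.log T * (x / 2)) := by
        rw [Real.rpow_add hT0, ← Real.sqrt_eq_rpow, Real.rpow_def_of_pos hT0]
    _ ≤ √T * Real.exp (1 / 2) := by
        gcongr
        have : Real.log T * x ≤ 1 := by
          rw [hx, ← div_eq_mul_inv, div_le_one h2]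
          exact hm
        linarith
    _ ≤ √T * 2 := by
        gcongr
        have h3 : Real.exp (1 / 2) ^ 2 ≤ 2 ^ 2 := by
          rw [← Real.exp_nat_mul]
          norm_num
          exact Real.exp_one_lt_d9.le.trans (by norm_num)
        exact le_of_sq_le_sq h3 (by norm_num)
    _ = _ := mul_comm _ _

/-- The number of stages after which the rate does not improve. -/
noncomputable def maxStages (T : ℕ) : ℕ := Nat.clog 2 ⌈Real.log T⌉₊

theorem log_le_two_pow_maxStages (T : ℕ) : Real.log T ≤ 2 ^ maxStages T := by
  refine (Nat.le_ceil _).trans ?_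
  exact_mod_cast Nat.le_pow_clog (by norm_num) _

theorem two_pow_maxStages_le {T : ℕ} (hT : 1 ≤ Real.log T) :
    (2 : ℝ) ^ maxStages T ≤ 4 * Real.log T := by
  have hceil : (⌈Real.log T⌉₊ : ℝ) ≤ 2 * Real.log T := by
    linarith [Nat.ceil_lt_add_one (zero_le_one.trans hT)]
  rcases Nat.lt_or_ge 1 ⌈Real.log T⌉₊ with h | h
  · have h1 := Nat.pow_pred_clog_lt_self (b := 2) (by norm_num) h
    have h2 : 0 < maxStages T := Nat.clog_pos (by norm_num) h
    have h3 : (2 : ℝ) ^ (maxStages T - 1) ≤ ⌈Real.log T⌉₊ := by exact_mod_cast h1.le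
    calc (2 : ℝ) ^ maxStages T = 2 ^ (maxStages T - 1) * 2 := by
          rw [← pow_succ, Nat.sub_add_cancel h2]
      _ ≤ _ := by linarith
  · rw [maxStages, Nat.clog_of_right_le_one h]
    linarith

theorem maxStages_le {T : ℕ} (hT : 1 ≤ Real.log T) : (maxStages T : ℝ) ≤ 2 * Real.log T := by
  have h : maxStages T ≤ ⌈Real.log T⌉₊ := Nat.clog_le_of_le_pow Nat.lt_two_pow_self.le
  have h1 := Nat.ceil_lt_add_one (zero_le_one.trans hT)
  have : (maxStages T : ℝ) ≤ ⌈Real.log T⌉₊ := by exact_mod_cast h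
  linarith

/-! ### The upper bound -/

/-- The parameters of the elimination policy. -/
noncomputable def eliminationParameters (k m : ℕ) {T : ℕ} (hT : 1 ≤ Real.log T) :
    SwitchingGraph.EliminationParameters k m T :=
  have hT1 : 1 ≤ T := Nat.one_le_iff_ne_zero.2 fun h => by
    rw [h] at hT
    norm_num at hT
  have hT1' : (1 : ℝ) ≤ T := by exact_mod_cast hT1
  have hlen : ∀ q, 1 ≤ ⌈(T : ℝ) ^ stageExponent m (m + 1 - q)⌉₊ := fun q =>
    Nat.one_le_ceil_iff.2 (Real.rpow_pos_of_pos (by linarith) _)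
  { len := fun q => ⌈(T : ℝ) ^ stageExponent m (m + 1 - q)⌉₊
    -- Stages are counted down, so the stage with `q` remaining has exponent index `m + 1 - q`, and
    -- stage `0` has length `T`. The confidence `4 * log T` makes the failure term `T * T ^ 2 * 2 *
    -- T ^ (-4) ≤ 2`.
    err := fun q => √(2 * (4 * Real.log T) / ⌈(T : ℝ) ^ stageExponent m (m + 1 - q)⌉₊)
    gap := fun q => (2 * k + 2) * (√(2 * (4 * Real.log T)) *
      (T : ℝ) ^ (-(stageExponent m (m - q) / 2)))
    conf := 4 * Real.log T
    reg := 2 * (2 * k + 2) * √(2 * (4 * Real.log T)) * rate m T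
    one_le_len := hlen
    le_len_zero := by
      rw [Nat.sub_zero, stageExponent_self_add_one, Real.rpow_one, Nat.ceil_natCast]
    err_nonneg := fun q => Real.sqrt_nonneg _
    conf_nonneg := by linarith
    sqrt_le := fun q => by
      have h : (0 : ℝ) < ⌈(T : ℝ) ^ stageExponent m (m + 1 - q)⌉₊ := by exact_mod_cast hlen q
      set n : ℝ := ((⌈(T : ℝ) ^ stageExponent m (m + 1 - q)⌉₊ : ℕ) : ℝ)
      have h1 : 2 * n * (4 * Real.log T) = 2 * (4 * Real.log T) / n * n ^ 2 := by
        field_simp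
      rw [h1, Real.sqrt_mul (by positivity), Real.sqrt_sq h.le]
    one_le_gap := by
      rw [Nat.sub_self, stageExponent_zero, zero_div, neg_zero, Real.rpow_zero, mul_one]
      have h1 : 1 ≤ √(2 * (4 * Real.log T)) := Real.one_le_sqrt.2 (by linarith)
      have h2 : (0 : ℝ) ≤ k := Nat.cast_nonneg k
      nlinarith
    gap_nonneg := fun q => by positivity
    err_le_gap := fun q => by
      rw [Nat.add_sub_add_right]
      gcongr
      have hpos : (0 : ℝ) < (T : ℝ) ^ stageExponent m (m - q) := Real.rpow_pos_of_pos (by linarith) _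
      calc √(2 * (4 * Real.log T) / ⌈(T : ℝ) ^ stageExponent m (m - q)⌉₊) ≤
            √(2 * (4 * Real.log T) / (T : ℝ) ^ stageExponent m (m - q)) := by
            gcongr
            exact Nat.le_ceil _
        _ = _ := by
            rw [Real.sqrt_div (by positivity), div_eq_mul_inv, Real.rpow_neg (by linarith),
              Real.sqrt_eq_rpow ((T : ℝ) ^ stageExponent m (m - q)), ← Real.rpow_mul (by linarith),
              mul_one_div]
    len_mul_gap_le := fun q hq => by
      have hone : (1 : ℝ) ≤ (T : ℝ) ^ stageExponent m (m + 1 - q) :=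
        Real.one_le_rpow hT1' (stageExponent_nonneg _ _)
      have hle : (⌈(T : ℝ) ^ stageExponent m (m + 1 - q)⌉₊ : ℝ) ≤
          2 * (T : ℝ) ^ stageExponent m (m + 1 - q) := by
        linarith [Nat.ceil_lt_add_one (zero_le_one.trans hone)]
      calc _ ≤ 2 * (T : ℝ) ^ stageExponent m (m + 1 - q) * ((2 * k + 2) *
            (√(2 * (4 * Real.log T)) * (T : ℝ) ^ (-(stageExponent m (m - q) / 2)))) := by gcongr
        _ = 2 * (2 * k + 2) * √(2 * (4 * Real.log T)) * ((T : ℝ) ^ stageExponent m (m - q + 1) *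
            (T : ℝ) ^ (-(stageExponent m (m - q) / 2))) := by
            rw [Nat.sub_add_comm hq]
            ring
        _ = _ := by rw [rpow_stageExponent_mul hT1] }

theorem optRegret_le_of_le_maxStages [NeZero k] (G : SwitchingGraph k) {S : ℝ≥0} {m T : ℕ}
    (hT : 1 ≤ Real.log T) (hS : G.threshold m ≤ S) (hm : m ≤ maxStages T) :
    optRegret G S T ≤
      ((((4 * k + 2) * (2 * (2 * k + 2) * 3) + 2) * rate m T * Real.log T ^ 2 : ℝ) : EReal) := by
  have hT1 : 1 ≤ T := Nat.one_le_iff_ne_zero.2 fun h => by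
    rw [h] at hT
    norm_num at hT
  have hT0 : (0 : ℝ) < T := by exact_mod_cast hT1
  have hT1' : (1 : ℝ) ≤ T := by exact_mod_cast hT1
  obtain ⟨i, hi⟩ : ∃ i, G.gameValue m Finset.univ ∅ i = G.threshold m := exists_eq_ciInf_of_finite
  set p := eliminationParameters k m hT with hp
  refine (iInf₂_le (G.eliminationPolicy p.len p.err m i)
    (G.isBudgeted_eliminationPolicy p.one_le_len p.err (hi.trans_le hS) T)).trans ?_
  refine iSup_le fun D => EReal.coe_le_coe_iff.2 ?_
  refine (G.regretIn_eliminationPolicy_le p i D).trans ?_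
  have hconf : p.conf = 4 * Real.log T := rfl
  have hreg : p.reg = 2 * (2 * k + 2) * √(2 * (4 * Real.log T)) * rate m T := rfl
  have hrate := one_le_rate hT1 m
  have hexp : T * (T ^ 2 * (2 * Real.exp (-p.conf))) ≤ 2 := by
    rw [hconf, Real.exp_neg, show 4 * Real.log T = ((4 : ℕ) : ℝ) * Real.log T by norm_num,
      Real.exp_nat_mul, Real.exp_log hT0]
    rw [show (T : ℝ) * ((T : ℝ) ^ 2 * (2 * ((T : ℝ) ^ 4)⁻¹)) = 2 / T by field_simp]
    rw [div_le_iff₀ hT0]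
    linarith
  have hsqrt : √(2 * (4 * Real.log T)) ≤ 3 * Real.log T := by
    rw [Real.sqrt_le_left (by linarith)]
    nlinarith
  have hmk : (m * k + k + 1 : ℝ) ≤ (4 * k + 2) * Real.log T := by
    have h1 : (m : ℝ) ≤ 2 * Real.log T := by
      have : (m : ℝ) ≤ maxStages T := by exact_mod_cast hm
      exact this.trans (maxStages_le hT)
    have h2 : (0 : ℝ) ≤ k := Nat.cast_nonneg k
    nlinarith [mul_le_mul_of_nonneg_right h1 h2]
  calc (m * k + k + 1 : ℝ) * p.reg + T * (T ^ 2 * (2 * Real.exp (-p.conf)))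
      ≤ ((4 * k + 2) * Real.log T) * (2 * (2 * k + 2) * (3 * Real.log T) * rate m T) +
        2 * (1 * rate m T) * Real.log T ^ 2 := by
        rw [hreg]
        refine add_le_add ?_ (hexp.trans ?_)
        · gcongr
        · have h1 : 1 ≤ Real.log T ^ 2 := one_le_pow₀ hT
          nlinarith
    _ = _ := by ring

/-- The number of stages enters the regret as a factor. Stopping at `maxStages T` keeps it
logarithmic, and the rate lost by stopping is at most a factor `2`. -/
theorem optRegret_le [NeZero k] (G : SwitchingGraph k) {S : ℝ≥0} {m T : ℕ}
    (hT : 1 ≤ Real.log T) (hS : G.threshold m ≤ S) {a : ℕ} (ha : 2 ≤ a) :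
    optRegret G S T ≤
      ((2 * ((4 * k + 2) * (2 * (2 * k + 2) * 3) + 2) * rate m T * Real.log T ^ a : ℝ) : EReal) := by
  have hT1 : 1 ≤ T := Nat.one_le_iff_ne_zero.2 fun h => by
    rw [h] at hT
    norm_num at hT
  have hpow : Real.log T ^ 2 ≤ Real.log T ^ a := pow_le_pow_right₀ hT ha
  have hrate : rate (min m (maxStages T)) T ≤ 2 * rate m T := by
    have h0 := rate_pos hT1 m
    rcases le_total m (maxStages T) with h | h
    · rw [min_eq_left h]
      linarith
    · rw [min_eq_right h]
      refine (rate_le_sqrt hT1 (log_le_two_pow_maxStages T)).trans ?_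
      linarith [sqrt_le_rate hT1 m]
  refine (optRegret_le_of_le_maxStages G hT
    ((G.threshold_mono (min_le_left m (maxStages T))).trans hS) (min_le_right _ _)).trans ?_
  refine EReal.coe_le_coe_iff.2 ?_
  calc _ ≤ ((4 * k + 2) * (2 * (2 * k + 2) * 3) + 2) * (2 * rate m T) * Real.log T ^ a := by
        have h0 := rate_pos hT1 m
        gcongr
    _ = _ := by ring

/-! ### The lower bound -/

/-- The loss of probability in the adversary argument is exponential in the number of stages, and
hence only polylogarithmic as long as `2 ^ m` is of order `log T`. -/
theorem one_div_pow_ge (hk : 1 ≤ k) {m T : ℕ} (hT : 1 ≤ Real.log T) (hm : m ≤ maxStages T) :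
    ((16 * Real.log T) ^ (6 * k ^ 2))⁻¹ ≤ (1 / (6 * k : ℝ)) ^ ((m + 1) * k + k) := by
  have hk0 : (0 : ℝ) < k := by exact_mod_cast hk
  rw [one_div, inv_pow]
  refine inv_anti₀ (by positivity) ?_
  have h6 : (6 * k : ℝ) ≤ 2 ^ (6 * k) := by
    exact_mod_cast (Nat.lt_two_pow_self (n := 6 * k)).le
  calc (6 * k : ℝ) ^ ((m + 1) * k + k) ≤ (2 ^ (6 * k)) ^ ((m + 1) * k + k) := by gcongr
    _ = (2 ^ (m + 2)) ^ (6 * k ^ 2) := by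
        rw [← pow_mul, ← pow_mul]
        congr 1
        ring
    _ ≤ (16 * Real.log T) ^ (6 * k ^ 2) := by
        gcongr
        calc (2 : ℝ) ^ (m + 2) = 2 ^ m * 4 := by rw [pow_add]; norm_num
          _ ≤ 2 ^ maxStages T * 4 := by gcongr; norm_num
          _ ≤ 4 * Real.log T * 4 := by
              have := two_pow_maxStages_le hT
              gcongr
          _ = _ := by ring

/-- The parameters of the adversary. -/
noncomputable def adversaryParameters (hk : 1 ≤ k) {m T : ℕ} (hT : 1 ≤ Real.log T)
    (hm : m ≤ maxStages T) (hT2 : 10 * k * Real.log T ≤ T)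
    (hT3 : 4 * k * (16 * Real.log T) ^ (6 * k ^ 2) ≤ T) : AdversaryParameters k (m + 1) T :=
  have hk1 : (1 : ℝ) ≤ k := by exact_mod_cast hk
  have hT1 : 1 ≤ T := Nat.one_le_iff_ne_zero.2 fun h => by
    rw [h] at hT
    norm_num at hT
  have hT1' : (1 : ℝ) ≤ T := by exact_mod_cast hT1
  have hT0 : (0 : ℝ) < T := by linarith
  have hm' : (m : ℝ) ≤ 2 * Real.log T := by
    have : (m : ℝ) ≤ maxStages T := by exact_mod_cast hm
    exact this.trans (maxStages_le hT)
  -- The summand `j` makes the counts strictly increasing, and `2 * k` leaves room for `k * count (m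
  -- + 1) ≤ T`. The exponents are those of `m`, although the game has `m + 1` stages.
  { count := fun j => ⌈(T : ℝ) ^ stageExponent m j / (2 * k)⌉₊ + j
    diff := fun j => (11 * k * Real.log T)⁻¹ * (T : ℝ) ^ (-(stageExponent m j / 2))
    bound := (11 * k * Real.log T)⁻¹
    conf := 3 * Real.log T
    reg := rate m T / (22 * k ^ 2 * Real.log T)
    strictMono_count := strictMono_nat_of_lt_succ fun j => by
      have h1 : ⌈(T : ℝ) ^ stageExponent m j / (2 * k)⌉₊ ≤
          ⌈(T : ℝ) ^ stageExponent m (j + 1) / (2 * k)⌉₊ := by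
        refine Nat.ceil_mono ?_
        gcongr
        exact stageExponent_mono m (Nat.le_succ j)
      omega
    count_zero := by
      rw [stageExponent_zero, Real.rpow_zero, add_zero, Nat.ceil_eq_iff one_ne_zero]
      constructor
      · simp only [Nat.sub_self, Nat.cast_zero]
        positivity
      · rw [div_le_iff₀ (by positivity)]
        push_cast
        linarith
    mul_count_le := by
      rw [stageExponent_self_add_one, Real.rpow_one]
      have h1 := (Nat.ceil_lt_add_one (a := (T : ℝ) / (2 * k)) (by positivity)).le
      have h2 : (k : ℝ) * (⌈(T : ℝ) / (2 * k)⌉₊ + (m + 1)) ≤ T := by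
        calc (k : ℝ) * (⌈(T : ℝ) / (2 * k)⌉₊ + (m + 1)) ≤
              k * ((T : ℝ) / (2 * k) + 1 + (2 * Real.log T + 1)) := by gcongr
          _ = T / 2 + k * (2 * Real.log T + 2) := by field_simp; ring
          _ ≤ T := by nlinarith
      exact_mod_cast h2
    diff_nonneg := fun j => by positivity
    diff_le := fun j => mul_le_of_le_one_right (by positivity)
      (Real.rpow_le_one_of_one_le_of_nonpos hT1' (by linarith [stageExponent_nonneg m j]))
    bound_le := by
      rw [← div_eq_mul_inv, div_le_one (by positivity)]
      push_cast
      nlinarith [mul_le_mul_of_nonneg_right hm' (zero_le_one.trans hk1)]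
    one_le_conf := by linarith
    conf_le := fun j hj => by
      have hone : (1 : ℝ) ≤ (T : ℝ) ^ stageExponent m j :=
        Real.one_le_rpow hT1' (stageExponent_nonneg _ _)
      set x := (T : ℝ) ^ stageExponent m j with hx
      have hsq : ((T : ℝ) ^ (-(stageExponent m j / 2))) ^ 2 = x⁻¹ := by
        rw [← Real.rpow_natCast, ← Real.rpow_mul hT0.le, hx, ← Real.rpow_neg hT0.le]
        congr 1
        push_cast
        ring
      have hcount : ((⌈x / (2 * k)⌉₊ + j : ℕ) : ℝ) ≤ 5 * Real.log T * x := by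
        have h1 := (Nat.ceil_lt_add_one (a := x / (2 * k)) (by positivity)).le
        have h2 : x / (2 * k) ≤ x := div_le_self (by linarith) (by linarith)
        have h3 : (j : ℝ) ≤ m := by exact_mod_cast Nat.lt_succ_iff.1 hj
        push_cast
        nlinarith
      calc 8 * (k * ((11 * k * Real.log T)⁻¹ * (T : ℝ) ^ (-(stageExponent m j / 2)))) ^ 2 *
            ((⌈x / (2 * k)⌉₊ + j : ℕ) : ℝ) * (3 * Real.log T)
          = 8 * (k ^ 2 * (((11 * k * Real.log T)⁻¹) ^ 2 * x⁻¹)) *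
            ((⌈x / (2 * k)⌉₊ + j : ℕ) : ℝ) * (3 * Real.log T) := by
            rw [← hsq]
            ring
        _ ≤ 8 * (k ^ 2 * (((11 * k * Real.log T)⁻¹) ^ 2 * x⁻¹)) *
            (5 * Real.log T * x) * (3 * Real.log T) := by gcongr
        -- The constant `11` in `diff` is chosen for this: `8 * 5 * 3 = 120 < 11 ^ 2`.
        _ = 120 / 121 := by field_simp; norm_num
        _ ≤ 1 := by norm_num
    reg_nonneg := by
      have := rate_pos hT1 m
      positivity
    reg_le := fun j _ => by
      calc rate m T / (22 * k ^ 2 * Real.log T) =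
            (T : ℝ) ^ stageExponent m (j + 1) / (2 * k) * ((11 * k * Real.log T)⁻¹ *
              (T : ℝ) ^ (-(stageExponent m j / 2))) := by
            rw [← rpow_stageExponent_mul hT1 m j]
            field_simp
            norm_num
        _ ≤ _ := by
            gcongr
            push_cast
            linarith [Nat.le_ceil ((T : ℝ) ^ stageExponent m (j + 1) / (2 * k)),
              Nat.cast_nonneg (α := ℝ) j]
    exp_le := by
      refine le_trans ?_ (one_div_pow_ge hk hT hm)
      rw [Real.exp_neg, show 3 * Real.log T = ((3 : ℕ) : ℝ) * Real.log T by norm_num,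
        Real.exp_nat_mul, Real.exp_log hT0, ← one_div ((16 * Real.log T) ^ (6 * k ^ 2)),
        le_div_iff₀ (by positivity)]
      calc 2 * k * ((T + 1) * ((T : ℝ) ^ 3)⁻¹) * (16 * Real.log T) ^ (6 * k ^ 2)
          ≤ 2 * k * ((T + T) * ((T : ℝ) ^ 3)⁻¹) * (16 * Real.log T) ^ (6 * k ^ 2) := by gcongr
        _ = 4 * k * (16 * Real.log T) ^ (6 * k ^ 2) / T ^ 2 := by field_simp; norm_num
        _ ≤ T / T ^ 2 := by gcongr
        _ ≤ 1 := by
            rw [div_le_one (by positivity)]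
            nlinarith }

theorem le_optRegret [NeZero k] (hk : 2 ≤ k) (G : SwitchingGraph k) {S : ℝ≥0} {m T : ℕ}
    (hT : 1 ≤ Real.log T) (hT2 : 10 * k * Real.log T ≤ T)
    (hT3 : 4 * k * (16 * Real.log T) ^ (6 * k ^ 2) ≤ T) (hS : S < G.threshold (m + 1)) :
    (((192 * (k : ℝ) ^ 2 * 16 ^ (6 * k ^ 2))⁻¹ * rate m T / Real.log T ^ (6 * k ^ 2 + 1) : ℝ) : EReal) ≤
      optRegret G S T := by
  have hk1 : (1 : ℝ) ≤ k := by exact_mod_cast (by omega : 1 ≤ k)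
  have hT1 : 1 ≤ T := Nat.one_le_iff_ne_zero.2 fun h => by
    rw [h] at hT
    norm_num at hT
  have hT0 : (0 : ℝ) < T := by exact_mod_cast hT1
  have hL0 : 0 < Real.log T := by linarith
  have hrate := rate_pos hT1 m
  refine le_iInf₂ fun π hπ => ?_
  suffices h : ∃ D : Environment k, (192 * (k : ℝ) ^ 2 * 16 ^ (6 * k ^ 2))⁻¹ * rate m T /
      Real.log T ^ (6 * k ^ 2 + 1) ≤ π.regretIn D T by
    obtain ⟨D, hD⟩ := h
    exact le_iSup_of_le D (EReal.coe_le_coe_iff.2 hD)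
  -- With few stages the game adversary applies; with many, the rate is at most `2 * √T` and the
  -- two-arm bound is enough.
  rcases le_total m (maxStages T) with hm | hm
  · obtain ⟨D, hD⟩ := exists_le_regretIn_of_lt_threshold
      (adversaryParameters (by omega) hT hm hT2 hT3) hS π hπ
    refine ⟨D, le_trans ?_ hD⟩
    have hreg : (adversaryParameters (by omega) hT hm hT2 hT3 : AdversaryParameters k (m + 1) T).reg =
      rate m T / (22 * k ^ 2 * Real.log T) := rfl
    rw [hreg]
    calc (192 * (k : ℝ) ^ 2 * 16 ^ (6 * k ^ 2))⁻¹ * rate m T / Real.log T ^ (6 * k ^ 2 + 1)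
        ≤ (22 * (k : ℝ) ^ 2 * 16 ^ (6 * k ^ 2))⁻¹ * rate m T / Real.log T ^ (6 * k ^ 2 + 1) := by
          gcongr
          norm_num
      _ = ((16 * Real.log T) ^ (6 * k ^ 2))⁻¹ * (rate m T / (22 * k ^ 2 * Real.log T)) := by
          rw [mul_pow, pow_succ]
          field_simp
          ring
      _ ≤ _ := by
          gcongr
          exact_mod_cast one_div_pow_ge (by omega) hT hm
  · have hsq := Real.sq_sqrt hT0.le
    have hsqrt : 0 < √(T : ℝ) := Real.sqrt_pos.2 hT0
    have hsqrt1 : 1 ≤ √(T : ℝ) := Real.one_le_sqrt.2 (by exact_mod_cast hT1)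
    obtain ⟨D, hD⟩ := exists_le_regretIn_of_two_le hk (T := T) (Λ := 3 * Real.log T)
      (gap := (4 * √T * Real.log T)⁻¹) (by linarith) (by
        rw [Real.exp_neg, show 3 * Real.log T = ((3 : ℕ) : ℝ) * Real.log T by norm_num,
          Real.exp_nat_mul, Real.exp_log hT0, ← one_div]
        have h2 : (2 : ℝ) ≤ T := by nlinarith
        have h4 : (2 : ℝ) ^ 3 ≤ (T : ℝ) ^ 3 := by gcongr
        exact one_div_le_one_div_of_le (by norm_num) (by linarith))
      (by positivity) (inv_le_one_of_one_le₀ (by nlinarith)) (by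
        calc 8 * ((4 * √T * Real.log T)⁻¹) ^ 2 * (T / 2) * (3 * Real.log T)
            = 8 * ((4 * Real.log T)⁻¹) ^ 2 * ((√(T : ℝ) ^ 2)⁻¹ * (T / 2)) * (3 * Real.log T) := by
              rw [mul_inv, mul_inv, mul_inv]
              ring
          _ = 3 / 4 / Real.log T := by
              rw [hsq]
              field_simp
              norm_num
          _ ≤ 1 := by
              rw [div_le_one hL0]
              linarith) π
    refine ⟨D, le_trans ?_ hD⟩
    have hr : rate m T ≤ 2 * √T := rate_le_sqrt hT1 ((log_le_two_pow_maxStages T).trans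
      (pow_le_pow_right₀ (by norm_num) hm))
    have hpow : Real.log T ≤ Real.log T ^ (6 * k ^ 2 + 1) := by
      calc Real.log T = Real.log T ^ 1 := (pow_one _).symm
        _ ≤ _ := pow_le_pow_right₀ hT (by omega)
    have h16 : (192 : ℝ) ≤ 192 * (k : ℝ) ^ 2 * 16 ^ (6 * k ^ 2) := by
      have h1 : (1 : ℝ) ≤ k ^ 2 := one_le_pow₀ hk1
      have h2 : (1 : ℝ) ≤ 16 ^ (6 * k ^ 2) := one_le_pow₀ (by norm_num)
      nlinarith [mul_le_mul h1 h2 (by norm_num) (by positivity)]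
    calc (192 * (k : ℝ) ^ 2 * 16 ^ (6 * k ^ 2))⁻¹ * rate m T / Real.log T ^ (6 * k ^ 2 + 1)
        ≤ (192 : ℝ)⁻¹ * (2 * √T) / Real.log T := by gcongr
      _ = 1 / 12 * (√(T : ℝ) ^ 2 / 2 * (4 * √T * Real.log T)⁻¹) := by
          field_simp
          norm_num
      _ = _ := by rw [hsq]

theorem eventually_log_le (k : ℕ) : ∃ T₀ : ℕ, 2 ≤ T₀ ∧ ∀ T : ℕ, T₀ ≤ T →
    1 ≤ Real.log T ∧ 10 * k * Real.log T ≤ T ∧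
      4 * k * (16 * Real.log T) ^ (6 * k ^ 2) ≤ T := by
  have hpow : ∀ (n : ℕ) (c : ℝ), 0 < c → ∀ᶠ x : ℝ in Filter.atTop, Real.log x ^ n ≤ c * x := by
    intro n c hc
    filter_upwards [(Real.isLittleO_pow_log_id_atTop (n := n)).bound hc, Filter.eventually_ge_atTop 0]
      with x hx hx0
    rw [Real.norm_eq_abs, Real.norm_eq_abs, id, abs_of_nonneg hx0] at hx
    exact (le_abs_self _).trans hx
  have h1 : ∀ᶠ x : ℝ in Filter.atTop, 1 ≤ Real.log x :=
    Real.tendsto_log_atTop.eventually_ge_atTop 1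
  have h2 := hpow 1 (1 / (10 * k + 1)) (by positivity)
  have h3 := hpow (6 * k ^ 2) (1 / (4 * k * 16 ^ (6 * k ^ 2) + 1)) (by positivity)
  obtain ⟨T₀, hT₀⟩ := Filter.eventually_atTop.1
    (tendsto_natCast_atTop_atTop.eventually ((h1.and h2).and h3))
  refine ⟨max T₀ 2, le_max_right _ _, fun T hT => ?_⟩
  obtain ⟨⟨h4, h5⟩, h6⟩ := hT₀ T (le_of_max_le_left hT)
  rw [pow_one, one_div_mul_eq_div, le_div_iff₀ (by positivity)] at h5
  rw [one_div_mul_eq_div, le_div_iff₀ (by positivity)] at h6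
  refine ⟨h4, by linarith, ?_⟩
  have : 0 ≤ Real.log T ^ (6 * k ^ 2) := by positivity
  rw [mul_pow]
  linarith

end BwSC

/-! ### Conclusion: the index is `stages`. -/

theorem theorem5 (k : ℕ) (hk : 2 ≤ k) :
    ∃ (m : BwSC.SwitchingGraph k → ℝ≥0 → ℕ) (c C : ℝ) (a T₀ : ℕ), 0 < c ∧ 0 < C ∧ 2 ≤ T₀ ∧
      ∀ G : BwSC.SwitchingGraph k, G.hamiltonianWeight ≠ 0 →
        (∀ S : ℝ≥0, (m G S = G.mU S ∨ m G S = G.mL S) ∧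
          BwSC.IsThetaTildeRate c C a T₀ (BwSC.optRegret G S) (m G S)) ∧
        (∀ (j : ℕ) (S : ℝ≥0), BwSC.criticalPoint (m G) j ≤ S →
          S < BwSC.criticalPoint (m G) (j + 1) →
            m G S = j ∧ BwSC.IsThetaTildeRate c C a T₀ (BwSC.optRegret G S) j) ∧
        (G.hamiltonianWeight ≠ ⊤ → StrictMono (BwSC.criticalPoint (m G))) := by
  have : NeZero k := ⟨by omega⟩
  have hk0 : (0 : ℝ) < k := by exact_mod_cast (by omega : 0 < k)
  obtain ⟨T₀, hT₀, hlog⟩ := BwSC.eventually_log_le k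
  refine ⟨fun G => G.stages, (192 * (k : ℝ) ^ 2 * 16 ^ (6 * k ^ 2))⁻¹,
    2 * ((4 * k + 2) * (2 * (2 * k + 2) * 3) + 2), 6 * k ^ 2 + 1, T₀, by positivity, by positivity,
    hT₀, fun G hH => ?_⟩
  have htheta : ∀ S : ℝ≥0, BwSC.IsThetaTildeRate (192 * (k : ℝ) ^ 2 * 16 ^ (6 * k ^ 2))⁻¹
      (2 * ((4 * k + 2) * (2 * (2 * k + 2) * 3) + 2)) (6 * k ^ 2 + 1) T₀ (BwSC.optRegret G S)
      (G.stages S) := by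
    intro S T hT
    obtain ⟨h1, h2, h3⟩ := hlog T hT
    -- By maximality of `stages S` one more stage is unaffordable, which is what the lower bound
    -- requires.
    have h4 : (S : ℝ≥0∞) < G.threshold (G.stages S + 1) := by
      by_contra h
      have := (G.le_stages_iff hH).2 (not_lt.1 h)
      omega
    have ha : 2 ≤ 6 * k ^ 2 + 1 := by
      have : 1 ≤ k ^ 2 := Nat.one_le_pow _ _ (by omega)
      omega
    exact ⟨BwSC.le_optRegret hk G h1 h2 h3 h4,
      BwSC.optRegret_le G h1 ((G.le_stages_iff hH).1 le_rfl) ha⟩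
  refine ⟨fun S => ⟨G.stages_eq_or hk hH S, htheta S⟩, fun j S h1 h2 => ?_, fun hT => ?_⟩
  · have hj : G.stages S = j := by
      rw [G.criticalPoint_stages hH] at h1 h2
      have h3 := (G.le_stages_iff hH).2 h1
      by_contra hne
      exact h2.not_ge ((G.le_stages_iff hH).1 (by omega))
    exact ⟨hj, hj ▸ htheta S⟩
  · have : BwSC.criticalPoint G.stages = G.threshold := funext (G.criticalPoint_stages hH)
    show StrictMono (BwSC.criticalPoint G.stages)
    rw [this]
    exact G.strictMono_threshold hH hT
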